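/- Let $k$ be a commutative ring. A *dg category* is a small category enriched in cochain complexes of $k$-modules, with $d(g\circ f)=dg\circ f+(-1)^{|g|}g\circ df$. A dg category $\mathcal C$ is *semifree* if its morphisms, treated as an algebra, are freely generated by a set of homogeneous morphisms $\{f_i\}$ indexed by an ordinal such that each $df_i$ is generated by $\{f_j\mid j<i\}$. A dg functor $F:\mathcal A\to\mathcal B$ is a *semifree extension* by a set of objects $R$ and a set of homogeneous morphisms $S=\{b_i\}$ if it is an inclusion, $\mathrm{Ob}\,\mathcal B=F(\mathrm{Ob}\,\mathcal A)\sqcup R$, the morphisms of $\mathcal B$ are a free extension of those of $F(\mathcal A)$ by $S$, and $S$ can be indexed by an ordinal so that each $db_i$ is generated by the morphisms of $F(\mathcal A)$ and $\{b_j\mid j<i\}$. Let $\mathrm{dgCat}_s$ be the category of semifree dg categories and dg functors. Fix a set of generating morphisms for each semifree dg category as in the definition. The *cylinder* $\mathrm{Cyl}(\mathcal A)$ is the semifree dg category with objects $A^1,A^2$ for $A\in\mathcal A$, freely generated by $a^1:X^1\to Y^1$, $a^2:X^2\to Y^2$, $t_a:X^1\to Y^2$ for each generating morphism $a:X\to Y$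 of $\mathcal A$, and $t_A:A^1\to A^2$, $t'_A:A^2\to A^1$, $\hat t_A:A^1\to A^1$, $\check t_A:A^2\to A^2$, $\bar t_A:A^1\to A^2$ for each object $A$, with $|a^r|=|a|$, $|t_a|=|a|-1$, $|t_A|=|t'_A|=0$, $|\hat t_A|=|\check t_A|=-1$, $|\bar t_A|=-2$ and $$dt_A=dt'_A=0,\quad d\hat t_A=1-t'_At_A,\quad d\check t_A=1-t_At'_A,\quad d\bar t_A=t_A\hat t_A-\check t_At_A,$$ $$da^r=(da)^r,\qquad dt_a=(-1)^{|a|}(a^2t_X-t_Ya^1)+t_{da}.$$ Here $\theta\mapsto\theta^r=i_r(\theta)$ extends $a\mapsto a^r$ to a functor $i_r:\mathcal A\to\mathrm{Cyl}(\mathcal A)$, and $\theta\mapsto t_\theta$ is the $k$-linear map with $t_{1_A}=0$ and $t_{f_n\cdots f_1}=\sum_j(-1)^{|f_{j-1}|+\dots+|f_1|}f_n^2\cdots f_{j+1}^2\,t_{f_j}\,f_{j-1}^1\cdots f_1^1$ for generating morphisms $f_j$. For a dg functor $F$, the functor $\mathrm{Cyl}(F)$ sends $A^r\mapsto F(A)^r$,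 $a^r\mapsto F(a)^r$, $t_a\mapsto t_{F(a)}$ and $t_A,t'_A,\hat t_A,\check t_A,\bar t_A\mapsto t_{F(A)},t'_{F(A)},\hat t_{F(A)},\check t_{F(A)},\bar t_{F(A)}$. The projection $p:\mathrm{Cyl}(\mathcal A)\to\mathcal A$ sends $A^r\mapsto A$, $a^r\mapsto a$, $t_A,t'_A\mapsto 1_A$ and $\hat t_A,\check t_A,\bar t_A,t_a\mapsto0$. **Theorem.** For every such choice of generating morphisms, $\mathrm{dgCat}_s$ with cofibrations the semifree extensions and $I=\mathrm{Cyl}$ is an $I$-category in the sense of Baues; that is, it has an initial object $\emptyset$ and: 1. (Cylinder) $I$ is a functor, $i_1,i_2:\mathrm{id}\Rightarrow I$ and $p:I\Rightarrow\mathrm{id}$ are natural, and $p\circ i_1=p\circ i_2=\mathrm{id}$. 2. (Pushout) For a cofibration $F:\mathcal A\to\mathcal B$ and any morphism $G:\mathcal A\to\mathcal C$ the pushout $\mathcal B\cup_{\mathcal A}\mathcal C$ exists, $\mathcal C\to\mathcal B\cup_{\mathcal A}\mathcal C$ is a cofibration, and $I$ sends this pushout square to a pushout square; moreover $I(\emptyset)=\emptyset$.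 3. (Cofibration) Isomorphisms and the morphisms $\emptyset\to\mathcal A$ are cofibrations, and cofibrations are closed under composition. For a cofibration $F:\mathcal A\to\mathcal B$, $r\in\{1,2\}$ and morphisms $G:\mathcal B\to\mathcal C$, $H:I(\mathcal A)\to\mathcal C$ with $G\circ F=H\circ i_r$ there is $E:I(\mathcal B)\to\mathcal C$ with $E\circ i_r=G$ and $E\circ I(F)=H$. 4. (Relative cylinder) Coproducts of two objects exist, and for a cofibration $F:\mathcal A\to\mathcal B$ the pushout of $F\sqcup F:\mathcal A\sqcup\mathcal A\to\mathcal B\sqcup\mathcal B$ and $i_1\sqcup i_2:\mathcal A\sqcup\mathcal A\to I(\mathcal A)$ exists, and the morphism from it to $I(\mathcal B)$ induced by $i_1\sqcup i_2:\mathcal B\sqcup\mathcal B\to I(\mathcal B)$ and $I(F)$ is a cofibration. 5. (Interchange) For each $\mathcal A$ there is $T:I(I(\mathcal A))\to I(I(\mathcal A))$ with $T\circ i_r=I(i_r)$ and $T\circ I(i_r)=i_r$ for $r\in\{1,2\}$. Moreover, $E$ (for $r=1$) and $T$ can be given by explicit formulas. If $F$ is a semifree extension by $R$ and $S$, then in 3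 with $r=1$ there is an $E$ as required such that $E(B^2)=E(B^1)$, $E(t_B)=E(t'_B)=1$ and $E(\hat t_B)=E(\check t_B)=E(\bar t_B)=0$ for $B\in R$, and, for each $b:U\to V$ in $S$ (a transfinite recursion along $S$), $$E(b^2)=E\big(t_Vb^1t'_U-(-1)^{|b|}t_{db}t'_U-(-1)^{|b|}(db)^2\check t_U\big),$$ $$E(t_b)=E\big(-t_Vb^1\hat t_U+(-1)^{|b|}t_{db}\hat t_U-(-1)^{|b|}(db)^2\bar t_U\big).$$ In 5 there is a $T$ as required that sends the object $(A^r)^s$ to $(A^s)^r$ and satisfies, for every object $A$ and every morphism $\theta$ of $\mathcal A$, $$t_{t_A}\mapsto-t_{t_A},\qquad t_{t_\theta}\mapsto-t_{t_\theta},$$ $$t_{t'_A}\mapsto t'_{A^2}t_{t_A}t'_{A^1}-\hat t_{A^2}(t_A)^1t'_{A^1}+t'_{A^2}(t_A)^2\check t_{A^1},$$ $$t_{\hat t_A}\mapsto-t'_{A^2}t_{t_A}\hat t_{A^1}+\hat t_{A^2}(t_A)^1\hat t_{A^1}+t'_{A^2}(t_A)^2\bar t_{A^1},$$ $$t_{\check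 t_A}\mapsto\check t_{A^2}t_{t_A}t'_{A^1}+\check t_{A^2}(t_A)^2\check t_{A^1}+\bar t_{A^2}(t_A)^1t'_{A^1},$$ $$t_{\bar t_A}\mapsto\check t_{A^2}t_{t_A}\hat t_{A^1}+\bar t_{A^2}(t_A)^1\hat t_{A^1}-\check t_{A^2}(t_A)^2\bar t_{A^1}.$$ -/

import Mathlib

open CategoryTheory

universe u

/-- The sign `(-1) ^ n` as an element of the coefficient ring. -/
def sgn (k : Type u) [CommRing k] (n : ℤ) : k := ((n.negOnePow : ℤ) : k)

section Sign

variable (k : Type u) [CommRing k]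

theorem sgn_zero : sgn k 0 = 1 := by simp [sgn]

theorem sgn_add (m n : ℤ) : sgn k (m + n) = sgn k m * sgn k n := by
  simp [sgn, Int.negOnePow_add]

theorem sgn_one : sgn k 1 = -1 := by simp [sgn]

theorem sgn_neg_one : sgn k (-1) = -1 := by simp [sgn, Int.negOnePow_neg]

theorem sgn_succ (n : ℤ) : sgn k (n + 1) = -sgn k n := by simp [sgn_add, sgn_one]

theorem sgn_sub_one (n : ℤ) : sgn k (n - 1) = -sgn k n := by
  rw [sub_eq_add_neg, sgn_add, sgn_neg_one]; ring

theorem sgn_mul_self (n : ℤ) : sgn k n * sgn k n = 1 := by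
  rw [← sgn_add]
  simp [sgn, Int.negOnePow_even (n + n) ⟨n, rfl⟩]

end Sign

/-- A small differential graded category over `k` (cohomological grading). The complex of morphisms
`X ⟶ Y` is given by its total module `Hom X Y`, the internal direct sum of the homogeneous parts
`homDeg X Y n`, with a differential of degree `1`; `comp g f` is the composite `g ∘ f`. -/
structure DGCat (k : Type u) [CommRing k] where
  Obj : Type u
  Hom : Obj → Obj → Type u
  [addCommGroup : ∀ X Y, AddCommGroup (Hom X Y)]
  [module : ∀ X Y, Module k (Hom X Y)]
  id : ∀ X, Hom X X
  comp : ∀ {X Y Z}, Hom Y Z →ₗ[k] Hom X Y →ₗ[k] Hom X Z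
  id_comp : ∀ {X Y} (f : Hom X Y), comp (id Y) f = f
  comp_id : ∀ {X Y} (f : Hom X Y), comp f (id X) = f
  assoc : ∀ {W X Y Z} (h : Hom Y Z) (g : Hom X Y) (f : Hom W X),
    comp (comp h g) f = comp h (comp g f)
  homDeg : ∀ X Y, ℤ → Submodule k (Hom X Y)
  isInternal : ∀ X Y, DirectSum.IsInternal (homDeg X Y)
  id_mem : ∀ X, id X ∈ homDeg X X 0
  comp_mem : ∀ {X Y Z} {m n : ℤ} {g : Hom Y Z} {f : Hom X Y},
    g ∈ homDeg Y Z m → f ∈ homDeg X Y n → comp g f ∈ homDeg X Z (m + n)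
  d : ∀ {X Y}, Hom X Y →ₗ[k] Hom X Y
  d_mem : ∀ {X Y} {n : ℤ} {f : Hom X Y}, f ∈ homDeg X Y n → d f ∈ homDeg X Y (n + 1)
  d_d : ∀ {X Y} (f : Hom X Y), d (d f) = 0
  leibniz : ∀ {X Y Z} {m : ℤ} {g : Hom Y Z} (f : Hom X Y), g ∈ homDeg Y Z m →
    d (comp g f) = comp (d g) f + sgn k m • comp g (d f)

attribute [instance] DGCat.addCommGroup DGCat.module

section Basic

variable {k : Type u} [CommRing k]

theorem DGCat.d_id (A : DGCat k) (X : A.Obj) : A.d (A.id X) = 0 := by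
  have h := A.leibniz (A.id X) (A.id_mem X)
  rw [A.id_comp, A.comp_id, A.id_comp, sgn_zero, one_smul] at h
  simpa using h

/-- A dg functor. -/
structure DGFunctor (A B : DGCat k) where
  obj : A.Obj → B.Obj
  map : ∀ {X Y}, A.Hom X Y →ₗ[k] B.Hom (obj X) (obj Y)
  map_id : ∀ X, map (A.id X) = B.id (obj X)
  map_comp : ∀ {X Y Z} (g : A.Hom Y Z) (f : A.Hom X Y),
    map (A.comp g f) = B.comp (map g) (map f)
  map_mem : ∀ {X Y} {n : ℤ} {f : A.Hom X Y}, f ∈ A.homDeg X Y n →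
    map f ∈ B.homDeg (obj X) (obj Y) n
  map_d : ∀ {X Y} (f : A.Hom X Y), map (A.d f) = B.d (map f)

theorem DGFunctor.hext {A B : DGCat k} {F G : DGFunctor A B} (h : F.obj = G.obj)
    (h' : ∀ (X Y : A.Obj) (f : A.Hom X Y), F.map f ≍ G.map f) : F = G := by
  obtain ⟨o, m, _, _, _, _⟩ := F
  obtain ⟨o', m', _, _, _, _⟩ := G
  obtain rfl : o = o' := h
  have : @m = @m' := by
    funext X Y
    exact LinearMap.ext fun f => eq_of_heq (h' X Y f)
  subst this
  rfl

/-- The category of small dg categories and dg functors. -/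
instance : Category.{u} (DGCat k) where
  Hom A B := DGFunctor A B
  id A :=
    { obj := fun X => X
      map := LinearMap.id
      map_id := fun _ => rfl
      map_comp := fun _ _ => rfl
      map_mem := fun h => h
      map_d := fun _ => rfl }
  comp F G :=
    { obj := fun X => G.obj (F.obj X)
      map := G.map.comp F.map
      map_id := fun X => by simp [F.map_id, G.map_id]
      map_comp := fun g f => by simp [F.map_comp, G.map_comp]
      map_mem := fun h => G.map_mem (F.map_mem h)
      map_d := fun f => by simp [F.map_d, G.map_d] }
  id_comp _ := rfl
  comp_id _ := rfl
  assoc _ _ _ := rfl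

/-- The morphisms of `A` generated by the class `P`: the smallest class of morphisms that contains
`P` and the identities and is closed under composition and `k`-linear combinations. -/
inductive DGCat.Generated (A : DGCat k) (P : ∀ ⦃X Y : A.Obj⦄, A.Hom X Y → Prop) :
    ∀ ⦃X Y : A.Obj⦄, A.Hom X Y → Prop
  | of {X Y} (f : A.Hom X Y) : P f → Generated A P f
  | id (X) : Generated A P (A.id X)
  | comp {X Y Z} (g : A.Hom Y Z) (f : A.Hom X Y) :
      Generated A P g → Generated A P f → Generated A P (A.comp g f)
  | zero (X Y) : Generated A P (0 : A.Hom X Y)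
  | add {X Y} (f g : A.Hom X Y) : Generated A P f → Generated A P g → Generated A P (f + g)
  | smul {X Y} (c : k) (f : A.Hom X Y) : Generated A P f → Generated A P (c • f)

end Basic

/-- Paths in a quiver with edges `E X Y` from `X` to `Y`; `cons e p` is `p` followed by `e`. -/
inductive QPath {V : Type u} (E : V → V → Type u) : V → V → Type u
  | nil (X : V) : QPath E X X
  | cons {X Y Z : V} (e : E Y Z) (p : QPath E X Y) : QPath E X Z

section FreeDG

variable {k : Type u} [CommRing k] {V : Type u} {E : V → V → Type u}

/-- The composite path `q ∘ p`. -/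
def QPath.comp {X Y : V} (p : QPath E X Y) : ∀ {Z : V}, QPath E Y Z → QPath E X Z
  | _, .nil _ => p
  | _, .cons e q => .cons e (QPath.comp p q)

theorem QPath.comp_nil {X Y : V} (p : QPath E X Y) : QPath.comp p (.nil Y) = p := rfl

theorem QPath.comp_cons {W X Y Z : V} (p : QPath E W X) (e : E Y Z) (q : QPath E X Y) :
    QPath.comp p (.cons e q) = .cons e (QPath.comp p q) := rfl

theorem QPath.nil_comp {X Y : V} (p : QPath E X Y) : QPath.comp (.nil X) p = p := by
  induction p with
  | nil => rfl
  | cons e p ih => rw [QPath.comp_cons, ih]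

theorem QPath.comp_assoc {W X Y Z : V} (p : QPath E W X) (q : QPath E X Y) (r : QPath E Y Z) :
    QPath.comp p (QPath.comp q r) = QPath.comp (QPath.comp p q) r := by
  induction r with
  | nil => rfl
  | cons e r ih => rw [QPath.comp_cons, QPath.comp_cons, QPath.comp_cons, ih]

/-- The degree of a path. -/
def QPath.deg (dg : ∀ ⦃X Y⦄, E X Y → ℤ) {X : V} : ∀ {Y : V}, QPath E X Y → ℤ
  | _, .nil _ => 0
  | _, .cons e p => dg e + QPath.deg dg p

theorem QPath.deg_comp (dg : ∀ ⦃X Y⦄, E X Y → ℤ) {X Y Z : V} (p : QPath E X Y) (q : QPath E Y Z) :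
    (QPath.comp p q).deg dg = q.deg dg + p.deg dg := by
  induction q with
  | nil => simp [QPath.comp, QPath.deg]
  | cons e q ih => simp [QPath.comp, QPath.deg, ih, add_assoc]

variable (k E) in
/-- Morphisms of the free `k`-linear category on a quiver: linear combinations of paths. -/
abbrev FHom (X Y : V) : Type u := QPath E X Y →₀ k

variable (k) in
/-- A path as a morphism of the free `k`-linear category. -/
noncomputable def pt {X Y : V} (p : QPath E X Y) : FHom k E X Y := Finsupp.single p 1

variable (k) in
/-- An edge as a morphism of the free `k`-linear category. -/
noncomputable def edge {X Y : V} (e : E X Y) : FHom k E X Y := pt k (.cons e (.nil X))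

/-- Two linear maps on `FHom` agree when they agree on paths. -/
theorem FHom.hom_ext {X Y : V} {M : Type*} [AddCommMonoid M] [Module k M]
    {f g : FHom k E X Y →ₗ[k] M} (h : ∀ p, f (pt k p) = g (pt k p)) : f = g :=
  Finsupp.lhom_ext' fun p => LinearMap.ext_ring (h p)

/-- Composition in the free `k`-linear category. -/
noncomputable def fcomp {X Y Z : V} : FHom k E Y Z →ₗ[k] FHom k E X Y →ₗ[k] FHom k E X Z :=
  Finsupp.linearCombination k fun q => Finsupp.lmapDomain k k fun p => QPath.comp p q

theorem fcomp_pt {X Y Z : V} (q : QPath E Y Z) (p : QPath E X Y) :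
    fcomp (pt k q) (pt k p) = pt k (QPath.comp p q) := by
  simp [fcomp, pt, Finsupp.linearCombination_single]

theorem pt_cons {X Y Z : V} (e : E Y Z) (p : QPath E X Y) :
    pt k (.cons e p) = fcomp (edge k e) (pt k p) := by
  rw [edge, fcomp_pt]; rfl

theorem fcomp_assoc {W X Y Z : V} (h : FHom k E Y Z) (g : FHom k E X Y) (f : FHom k E W X) :
    fcomp (fcomp h g) f = fcomp h (fcomp g f) := by
  have : (fcomp (k := k) (E := E) (X := W) (Y := X) (Z := Z)) ∘ₗ (fcomp.flip g) =
      ((LinearMap.lcomp k _ (fcomp.flip.flip g)).comp fcomp) := by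
    apply FHom.hom_ext
    intro r
    apply FHom.hom_ext
    intro p
    have h2 : ∀ g : FHom k E X Y, fcomp (fcomp (pt k r) g) (pt k p)
        = fcomp (pt k r) (fcomp g (pt k p)) := by
      intro g
      induction g using Finsupp.induction_linear with
      | zero => simp
      | add a b ha hb => simp only [map_add, LinearMap.add_apply, ha, hb]
      | single q c =>
        have : Finsupp.single q c = c • pt k q := by simp [pt]
        rw [this]
        simp only [map_smul, LinearMap.smul_apply, fcomp_pt, QPath.comp_assoc]
    exact h2 g
  exact congrArg (fun l => l h f) this

theorem id_fcomp {X Y : V} (f : FHom k E X Y) : fcomp (pt k (.nil Y)) f = f := by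
  have : fcomp (pt k (.nil Y)) = (LinearMap.id : FHom k E X Y →ₗ[k] _) := by
    apply FHom.hom_ext
    intro p
    rw [fcomp_pt]; rfl
  rw [this]; rfl

theorem fcomp_id {X Y : V} (f : FHom k E X Y) : fcomp f (pt k (.nil X)) = f := by
  have : fcomp.flip (pt k (.nil X)) = (LinearMap.id : FHom k E X Y →ₗ[k] _) := by
    apply FHom.hom_ext
    intro p
    simp only [LinearMap.flip_apply, fcomp_pt, QPath.nil_comp]; rfl
  exact congrArg (fun l => l f) this

variable (dg : ∀ ⦃X Y⦄, E X Y → ℤ)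

variable (k) in
/-- The span of the paths of degree `n`. -/
def fdeg (X Y : V) (n : ℤ) : Submodule k (FHom k E X Y) :=
  Finsupp.supported k k {p | p.deg dg = n}

theorem pt_mem_fdeg {X Y : V} (p : QPath E X Y) : pt k p ∈ fdeg k dg X Y (p.deg dg) :=
  Finsupp.single_mem_supported k 1 rfl

theorem pt_mem_fdeg' {X Y : V} (p : QPath E X Y) {n : ℤ} (h : p.deg dg = n) :
    pt k p ∈ fdeg k dg X Y n := h ▸ pt_mem_fdeg dg p

theorem edge_mem_fdeg {X Y : V} (e : E X Y) : edge k e ∈ fdeg k dg X Y (dg e) :=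
  pt_mem_fdeg' dg _ (by simp [QPath.deg])

theorem fdeg_eq_span (X Y : V) (n : ℤ) :
    fdeg k dg X Y n = Submodule.span k (pt k '' {p | p.deg dg = n}) :=
  Finsupp.supported_eq_span_single k _

/-- A linear map sends `fdeg n` into a submodule when it does so on paths of degree `n`. -/
theorem fdeg_map_mem {X Y : V} {M : Type*} [AddCommGroup M] [Module k M]
    (l : FHom k E X Y →ₗ[k] M) (N : Submodule k M) {n : ℤ}
    (h : ∀ p : QPath E X Y, p.deg dg = n → l (pt k p) ∈ N) {x : FHom k E X Y}
    (hx : x ∈ fdeg k dg X Y n) : l x ∈ N := by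
  rw [fdeg_eq_span] at hx
  have : Submodule.span k (pt k '' {p : QPath E X Y | p.deg dg = n}) ≤ N.comap l := by
    rw [Submodule.span_le]
    rintro _ ⟨p, hp, rfl⟩
    exact h p hp
  exact this hx

theorem fdeg_isInternal (X Y : V) : DirectSum.IsInternal (fdeg k dg X Y) := by
  classical
  rw [DirectSum.isInternal_submodule_iff_iSupIndep_and_iSup_eq_top]
  constructor
  · intro n
    have : (⨆ m, ⨆ (_ : m ≠ n), fdeg k dg X Y m) ≤
        Finsupp.supported k k {p : QPath E X Y | p.deg dg ≠ n} := by
      refine iSup₂_le fun m hm => Finsupp.supported_mono ?_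
      intro p hp
      exact fun h => hm (hp.symm.trans h)
    refine Disjoint.mono_right this ?_
    apply Finsupp.disjoint_supported_supported
    rw [Set.disjoint_left]
    intro p hp hq
    exact hq hp
  · rw [eq_top_iff]
    intro x _
    induction x using Finsupp.induction_linear with
    | zero => exact zero_mem _
    | add a b ha hb => exact add_mem (ha trivial) (hb trivial)
    | single p c =>
      exact Submodule.mem_iSup_of_mem (p.deg dg) (Finsupp.single_mem_supported k c rfl)

theorem fcomp_mem {X Y Z : V} {m n : ℤ} {g : FHom k E Y Z} {f : FHom k E X Y}
    (hg : g ∈ fdeg k dg Y Z m) (hf : f ∈ fdeg k dg X Y n) :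
    fcomp g f ∈ fdeg k dg X Z (m + n) := by
  refine fdeg_map_mem dg (fcomp.flip f) _ ?_ hg
  intro q hq
  refine fdeg_map_mem dg (fcomp (pt k q)) _ ?_ hf
  intro p hp
  rw [fcomp_pt]
  exact pt_mem_fdeg' dg _ (by rw [QPath.deg_comp, hq, hp])

variable (k) in
/-- The sign twist, multiplication by `(-1) ^ n` in degree `n`. -/
noncomputable def twist {X Y : V} : FHom k E X Y →ₗ[k] FHom k E X Y :=
  Finsupp.linearCombination k fun p => sgn k (p.deg dg) • pt k p

theorem twist_pt {X Y : V} (p : QPath E X Y) :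
    twist k dg (pt k p) = sgn k (p.deg dg) • pt k p := by
  simp [twist, pt, Finsupp.linearCombination_single]

theorem twist_of_mem {X Y : V} {n : ℤ} {x : FHom k E X Y} (hx : x ∈ fdeg k dg X Y n) :
    twist k dg x = sgn k n • x := by
  have := fdeg_map_mem dg (twist k dg - sgn k n • LinearMap.id) ⊥ (n := n) (x := x) (by
    intro p hp
    simp [twist_pt, hp]) hx
  simpa [sub_eq_zero] using this

theorem twist_fcomp {X Y Z : V} (g : FHom k E Y Z) (f : FHom k E X Y) :
    twist k dg (fcomp g f) = fcomp (twist k dg g) (twist k dg f) := by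
  have : fcomp.compr₂ (twist k dg) =
      (fcomp (k := k) (E := E) (X := X) (Y := Y) (Z := Z)).compl₁₂ (twist k dg) (twist k dg) := by
    clear g f
    apply FHom.hom_ext; intro q
    apply FHom.hom_ext; intro p
    simp [fcomp_pt, twist_pt, QPath.deg_comp, sgn_add, smul_smul, mul_comm]
  exact congrArg (fun l => l g f) this

variable (δ : ∀ ⦃X Y⦄, E X Y → FHom k E X Y)

/-- The derivation of the free category with prescribed values on edges, on paths. -/
noncomputable def dPath {X : V} : ∀ {Y : V}, QPath E X Y → FHom k E X Y
  | _, .nil _ => 0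
  | _, .cons e p => fcomp (δ e) (pt k p) + sgn k (dg e) • fcomp (edge k e) (dPath p)

/-- The derivation of the free category with prescribed values on edges. -/
noncomputable def fd {X Y : V} : FHom k E X Y →ₗ[k] FHom k E X Y :=
  Finsupp.linearCombination k (dPath dg δ)

theorem fd_pt {X Y : V} (p : QPath E X Y) : fd dg δ (pt k p) = dPath dg δ p := by
  simp [fd, pt, Finsupp.linearCombination_single]

theorem fd_edge {X Y : V} (e : E X Y) : fd dg δ (edge k e) = δ e := by
  rw [edge, fd_pt]
  simp [dPath, fcomp_id]

theorem fd_leibniz {X Y Z : V} (g : FHom k E Y Z) (f : FHom k E X Y) :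
    fd dg δ (fcomp g f) = fcomp (fd dg δ g) f + fcomp (twist k dg g) (fd dg δ f) := by
  have : fcomp.compr₂ (fd dg δ) =
      (fcomp (k := k) (E := E) (X := X) (Y := Y) (Z := Z)).comp (fd dg δ) +
      fcomp.compl₁₂ (twist k dg) (fd dg δ) := by
    clear g f
    apply FHom.hom_ext; intro q
    apply FHom.hom_ext; intro p
    simp only [LinearMap.compr₂_apply, LinearMap.add_apply, LinearMap.comp_apply,
      LinearMap.compl₁₂_apply]
    induction q with
    | nil =>
      rw [fcomp_pt, QPath.comp_nil, fd_pt, fd_pt, twist_pt]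
      simp [dPath, QPath.deg, sgn_zero, id_fcomp]
    | cons e q ih =>
      rw [fcomp_pt, QPath.comp_cons, fd_pt, dPath, ← fd_pt, ← fcomp_pt, ih, fd_pt _ _ (.cons e q),
        dPath, ← fd_pt, twist_pt, twist_pt, QPath.deg, sgn_add, pt_cons]
      simp only [map_add, map_smul, LinearMap.add_apply, LinearMap.smul_apply, smul_add, smul_smul,
        fcomp_assoc]
      abel
  exact congrArg (fun l => l g f) this

theorem fd_mem (hδ : ∀ ⦃X Y⦄ (e : E X Y), δ e ∈ fdeg k dg X Y (dg e + 1)) {X Y : V} {n : ℤ}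
    {x : FHom k E X Y} (hx : x ∈ fdeg k dg X Y n) : fd dg δ x ∈ fdeg k dg X Y (n + 1) := by
  refine fdeg_map_mem dg (fd dg δ) _ ?_ hx
  rintro p rfl
  rw [fd_pt]
  induction p with
  | nil => exact zero_mem _
  | cons e p ih =>
    rw [dPath, QPath.deg]
    refine add_mem ?_ (Submodule.smul_mem _ _ ?_)
    · have := fcomp_mem dg (hδ e) (pt_mem_fdeg (k := k) dg p)
      rwa [add_right_comm] at this
    · have := fcomp_mem dg (edge_mem_fdeg (k := k) dg e) (ih (pt_mem_fdeg dg p))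
      rwa [← add_assoc] at this

theorem fd_fd (hδ : ∀ ⦃X Y⦄ (e : E X Y), δ e ∈ fdeg k dg X Y (dg e + 1))
    (hδδ : ∀ ⦃X Y⦄ (e : E X Y), fd dg δ (δ e) = 0) {X Y : V} (x : FHom k E X Y) :
    fd dg δ (fd dg δ x) = 0 := by
  have : (fd dg δ).comp (fd dg δ) = (0 : FHom k E X Y →ₗ[k] _) := by
    clear x
    apply FHom.hom_ext; intro p
    simp only [LinearMap.comp_apply, LinearMap.zero_apply]
    induction p with
    | nil => simp [fd_pt, dPath]
    | cons e p ih =>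
      rw [pt_cons, fd_leibniz, fd_edge, map_add, fd_leibniz, fd_leibniz, hδδ, ih,
        twist_of_mem dg (hδ e), twist_of_mem dg (edge_mem_fdeg dg e), map_smul, map_smul, fd_edge, sgn_succ]
      simp
  exact congrArg (fun l => l x) this

/-- The dg category whose underlying graded `k`-linear category is free on the quiver `E` with
degrees `dg`, with differential `δ` on the edges. -/
noncomputable abbrev freeDG (hδ : ∀ ⦃X Y⦄ (e : E X Y), δ e ∈ fdeg k dg X Y (dg e + 1))
    (hδδ : ∀ ⦃X Y⦄ (e : E X Y), fd dg δ (δ e) = 0) : DGCat k where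
  Obj := V
  Hom := FHom k E
  id X := pt k (.nil X)
  comp := fcomp
  id_comp := id_fcomp
  comp_id := fcomp_id
  assoc := fcomp_assoc
  homDeg := fdeg k dg
  isInternal := fdeg_isInternal dg
  id_mem X := pt_mem_fdeg' dg _ rfl
  comp_mem := fcomp_mem dg
  d := fd dg δ
  d_mem := fd_mem dg δ hδ
  d_d := fd_fd dg δ hδ hδδ
  leibniz f hg := by rw [fd_leibniz, twist_of_mem dg hg, map_smul, LinearMap.smul_apply]

/-- The value of a path in a dg category in which edges have been assigned values. -/
def evPath (B : DGCat k) (o : V → B.Obj) (φ : ∀ ⦃X Y⦄, E X Y → B.Hom (o X) (o Y)) {X : V} :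
    ∀ {Y : V}, QPath E X Y → B.Hom (o X) (o Y)
  | _, .nil _ => B.id _
  | _, .cons e p => B.comp (φ e) (evPath B o φ p)

/-- The linear extension of `evPath`. -/
noncomputable def evL (B : DGCat k) (o : V → B.Obj) (φ : ∀ ⦃X Y⦄, E X Y → B.Hom (o X) (o Y)) {X Y : V} :
    FHom k E X Y →ₗ[k] B.Hom (o X) (o Y) :=
  Finsupp.linearCombination k (evPath B o φ)

section Ev

variable (B : DGCat k) (o : V → B.Obj) (φ : ∀ ⦃X Y⦄, E X Y → B.Hom (o X) (o Y))

theorem evL_pt {X Y : V} (p : QPath E X Y) : evL B o φ (pt k p) = evPath B o φ p := by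
  simp [evL, pt, Finsupp.linearCombination_single]

theorem evL_nil (X : V) : evL B o φ (pt k (.nil X)) = B.id (o X) := evL_pt B o φ _

theorem evL_edge {X Y : V} (e : E X Y) : evL B o φ (edge k e) = φ e := by
  rw [edge, evL_pt]; exact B.comp_id _

theorem evL_fcomp {X Y Z : V} (g : FHom k E Y Z) (f : FHom k E X Y) :
    evL B o φ (fcomp g f) = B.comp (evL B o φ g) (evL B o φ f) := by
  have : fcomp.compr₂ (evL B o φ) =
      (B.comp (X := o X) (Y := o Y) (Z := o Z)).compl₁₂ (evL B o φ) (evL B o φ) := by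
    clear g f
    apply FHom.hom_ext; intro q
    apply FHom.hom_ext; intro p
    simp only [LinearMap.compr₂_apply, LinearMap.compl₁₂_apply, fcomp_pt, evL_pt]
    induction q with
    | nil => exact (B.id_comp _).symm
    | cons e q ih => rw [QPath.comp_cons, evPath, ih, evPath, B.assoc]
  exact congrArg (fun l => l g f) this

theorem evL_mem (hφ : ∀ ⦃X Y⦄ (e : E X Y), φ e ∈ B.homDeg (o X) (o Y) (dg e)) {X Y : V} {n : ℤ}
    {x : FHom k E X Y} (hx : x ∈ fdeg k dg X Y n) : evL B o φ x ∈ B.homDeg (o X) (o Y) n := by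
  refine fdeg_map_mem dg (evL B o φ) _ ?_ hx
  rintro p rfl
  rw [evL_pt]
  induction p with
  | nil => exact B.id_mem _
  | cons e p ih => exact B.comp_mem (hφ e) (ih (pt_mem_fdeg dg p))

theorem evL_fd (hφ : ∀ ⦃X Y⦄ (e : E X Y), φ e ∈ B.homDeg (o X) (o Y) (dg e))
    (hd : ∀ ⦃X Y⦄ (e : E X Y), evL B o φ (δ e) = B.d (φ e)) {X Y : V} (x : FHom k E X Y) :
    evL B o φ (fd dg δ x) = B.d (evL B o φ x) := by
  have : (evL B o φ).comp (fd dg δ) = B.d.comp (evL B o φ (X := X) (Y := Y)) := by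
    clear x
    apply FHom.hom_ext; intro p
    simp only [LinearMap.comp_apply]
    induction p with
    | nil => simp [fd_pt, dPath, evL_nil, B.d_id]
    | cons e p ih =>
      rw [pt_cons, fd_leibniz, map_add, evL_fcomp, evL_fcomp, evL_fcomp, fd_edge, ih, hd,
        twist_of_mem dg (edge_mem_fdeg dg e), map_smul, evL_edge, B.leibniz _ (hφ e), map_smul,
        LinearMap.smul_apply]
  exact congrArg (fun l => l x) this

/-- A dg functor out of `freeDG`, given by its values on objects and edges. -/
noncomputable def freeDGLift (hδ : ∀ ⦃X Y⦄ (e : E X Y), δ e ∈ fdeg k dg X Y (dg e + 1))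
    (hδδ : ∀ ⦃X Y⦄ (e : E X Y), fd dg δ (δ e) = 0)
    (hφ : ∀ ⦃X Y⦄ (e : E X Y), φ e ∈ B.homDeg (o X) (o Y) (dg e))
    (hd : ∀ ⦃X Y⦄ (e : E X Y), evL B o φ (δ e) = B.d (φ e)) :
    freeDG dg δ hδ hδδ ⟶ B where
  obj := o
  map := evL B o φ
  map_id := evL_nil B o φ
  map_comp := evL_fcomp B o φ
  map_mem := evL_mem dg B o φ hφ
  map_d := evL_fd dg δ B o φ hφ hd

end Ev

end FreeDG

/-- The edges of the cylinder on a quiver `E`. Its vertices are two copies `(X, false)`, `(X, true)`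
(the first and the second copy, `i₁ X` and `i₂ X`) of each vertex `X`; its edges are two copies of
each edge of `E`, the edges `t`, `tInv` (written `t'`), `tHat`, `tCheck`, `tBar` for each vertex, and
an edge `tGen e` for each edge `e`. -/
inductive CylE {V : Type u} (E : V → V → Type u) : V × Bool → V × Bool → Type u
  | incl {X Y : V} (r : Bool) (e : E X Y) : CylE E (X, r) (Y, r)
  | t (X : V) : CylE E (X, false) (X, true)
  | tInv (X : V) : CylE E (X, true) (X, false)
  | tHat (X : V) : CylE E (X, false) (X, false)
  | tCheck (X : V) : CylE E (X, true) (X, true)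
  | tBar (X : V) : CylE E (X, false) (X, true)
  | tGen {X Y : V} (e : E X Y) : CylE E (X, false) (Y, true)

section FreeCyl

variable {k : Type u} [CommRing k] {V : Type u} {E : V → V → Type u}

/-- The degrees of the edges of the cylinder. -/
def cylDeg (dg : ∀ ⦃X Y⦄, E X Y → ℤ) : ∀ ⦃P Q⦄, CylE E P Q → ℤ
  | _, _, .incl _ e => dg e
  | _, _, .t _ => 0
  | _, _, .tInv _ => 0
  | _, _, .tHat _ => -1
  | _, _, .tCheck _ => -1
  | _, _, .tBar _ => -2
  | _, _, .tGen e => dg e - 1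

/-- The copy of a path in one end of the cylinder. -/
def iPath (r : Bool) {X : V} : ∀ {Y : V}, QPath E X Y → QPath (CylE E) (X, r) (Y, r)
  | _, .nil _ => .nil _
  | _, .cons e p => .cons (.incl r e) (iPath r p)

/-- The linear extension of `iPath`. -/
noncomputable def iL (r : Bool) {X Y : V} :
    FHom k E X Y →ₗ[k] FHom k (CylE E) (X, r) (Y, r) :=
  Finsupp.linearCombination k fun p => pt k (iPath r p)

variable (k) in
/-- The morphism `t_p` for a path `p`: for `p = e_n ∘ ⋯ ∘ e_1` this is the sum over `j` of
`(-1) ^ (|e_{j-1}| + ⋯ + |e_1|) i₂(e_n) ⋯ i₂(e_{j+1}) t_{e_j} i₁(e_{j-1}) ⋯ i₁(e_1)`. -/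
noncomputable def tPath (dg : ∀ ⦃X Y⦄, E X Y → ℤ) {X : V} :
    ∀ {Y : V}, QPath E X Y → FHom k (CylE E) (X, false) (Y, true)
  | _, .nil _ => 0
  | _, .cons e p => fcomp (edge k (.incl true e)) (tPath dg p) +
      sgn k (p.deg dg) • fcomp (edge k (.tGen e)) (pt k (iPath false p))

/-- The linear extension of `tPath`. -/
noncomputable def tL (dg : ∀ ⦃X Y⦄, E X Y → ℤ) {X Y : V} :
    FHom k E X Y →ₗ[k] FHom k (CylE E) (X, false) (Y, true) :=
  Finsupp.linearCombination k (tPath k dg)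

/-- The differentials of the edges of the cylinder. -/
noncomputable def cylδ (dg : ∀ ⦃X Y⦄, E X Y → ℤ) (δ : ∀ ⦃X Y⦄, E X Y → FHom k E X Y) :
    ∀ ⦃P Q⦄, CylE E P Q → FHom k (CylE E) P Q
  | _, _, .incl r e => iL r (δ e)
  | _, _, .t _ => 0
  | _, _, .tInv _ => 0
  | _, _, .tHat X => pt k (.nil _) - fcomp (edge k (.tInv X)) (edge k (.t X))
  | _, _, .tCheck X => pt k (.nil _) - fcomp (edge k (.t X)) (edge k (.tInv X))
  | _, _, .tBar X =>
      fcomp (edge k (.t X)) (edge k (.tHat X)) - fcomp (edge k (.tCheck X)) (edge k (.t X))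
  | _, _, @CylE.tGen _ _ X Y e =>
      sgn k (dg e) • (fcomp (edge k (.incl true e)) (edge k (.t X)) -
        fcomp (edge k (.t Y)) (edge k (.incl false e))) + tL dg (δ e)

theorem iL_pt (r : Bool) {X Y : V} (p : QPath E X Y) : iL r (pt k p) = pt k (iPath r p) := by
  simp [iL, pt, Finsupp.linearCombination_single]

theorem iL_edge (r : Bool) {X Y : V} (e : E X Y) :
    iL r (edge k e) = edge k (.incl r e) := iL_pt r _

theorem iPath_comp (r : Bool) {X Y Z : V} (p : QPath E X Y) (q : QPath E Y Z) :
    iPath r (QPath.comp p q) = QPath.comp (iPath r p) (iPath r q) := by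
  induction q with
  | nil => rfl
  | cons e q ih => rw [QPath.comp_cons, iPath, ih, iPath, QPath.comp_cons]

theorem iL_fcomp (r : Bool) {X Y Z : V} (g : FHom k E Y Z) (f : FHom k E X Y) :
    iL r (fcomp g f) = fcomp (iL r g) (iL r f) := by
  have : fcomp.compr₂ (iL r) =
      (fcomp (k := k) (E := CylE E) (X := (X, r)) (Y := (Y, r)) (Z := (Z, r))).compl₁₂
        (iL r) (iL r) := by
    apply FHom.hom_ext; intro q
    apply FHom.hom_ext; intro p
    simp [fcomp_pt, iL_pt, iPath_comp]
  exact congrArg (fun l => l g f) this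

variable (dg : ∀ ⦃X Y⦄, E X Y → ℤ)

theorem iPath_deg (r : Bool) {X Y : V} (p : QPath E X Y) :
    (iPath r p).deg (cylDeg dg) = p.deg dg := by
  induction p with
  | nil => rfl
  | cons e p ih => rw [iPath, QPath.deg, QPath.deg, ih, cylDeg]

theorem iL_mem (r : Bool) {X Y : V} {n : ℤ} {x : FHom k E X Y} (hx : x ∈ fdeg k dg X Y n) :
    iL r x ∈ fdeg k (cylDeg dg) (X, r) (Y, r) n := by
  refine fdeg_map_mem dg (iL r) _ ?_ hx
  intro p hp
  rw [iL_pt]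
  exact pt_mem_fdeg' _ _ (by rw [iPath_deg, hp])

theorem tL_pt {X Y : V} (p : QPath E X Y) : tL dg (pt k p) = tPath k dg p := by
  simp [tL, pt, Finsupp.linearCombination_single]

theorem tL_edge {X Y : V} (e : E X Y) : tL dg (edge k e) = edge k (.tGen e) := by
  rw [edge, tL_pt, tPath, tPath, iPath, QPath.deg, sgn_zero, map_zero, zero_add, one_smul, fcomp_id]

theorem tPath_mem {X Y : V} (p : QPath E X Y) :
    tPath k dg p ∈ fdeg k (cylDeg dg) (X, false) (Y, true) (p.deg dg - 1) := by
  induction p with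
  | nil => exact zero_mem _
  | cons e p ih =>
    rw [tPath, QPath.deg]
    refine add_mem ?_ (Submodule.smul_mem _ _ ?_)
    · have := fcomp_mem _ (edge_mem_fdeg (k := k) (cylDeg dg) (.incl true e)) ih
      rwa [cylDeg, ← add_sub_assoc] at this
    · have := fcomp_mem _ (edge_mem_fdeg (k := k) (cylDeg dg) (.tGen e))
        (pt_mem_fdeg' (k := k) (cylDeg dg) _ (iPath_deg dg false p))
      rwa [cylDeg, sub_add_eq_add_sub] at this

theorem tL_mem {X Y : V} {n : ℤ} {x : FHom k E X Y} (hx : x ∈ fdeg k dg X Y n) :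
    tL dg x ∈ fdeg k (cylDeg dg) (X, false) (Y, true) (n - 1) := by
  refine fdeg_map_mem dg (tL dg) _ ?_ hx
  rintro p rfl
  rw [tL_pt]
  exact tPath_mem dg p

theorem tL_fcomp {X Y Z : V} (g : FHom k E Y Z) (f : FHom k E X Y) :
    tL dg (fcomp g f) =
      fcomp (iL true g) (tL dg f) + fcomp (tL dg g) (iL false (twist k dg f)) := by
  have : fcomp.compr₂ (tL dg) =
      (fcomp (k := k) (E := CylE E) (X := (X, false)) (Y := (Y, true)) (Z := (Z, true))).compl₁₂
        (iL true) (tL dg) +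
      (fcomp (k := k) (E := CylE E) (X := (X, false)) (Y := (Y, false)) (Z := (Z, true))).compl₁₂
        (tL dg) (iL false ∘ₗ twist k dg) := by
    clear g f
    apply FHom.hom_ext; intro q
    apply FHom.hom_ext; intro p
    simp only [LinearMap.compr₂_apply, LinearMap.add_apply, LinearMap.comp_apply,
      LinearMap.compl₁₂_apply]
    induction q with
    | nil =>
      rw [fcomp_pt, QPath.comp_nil, tL_pt, tL_pt, iL_pt, tPath, iPath, id_fcomp]
      simp
    | cons e q ih =>
      have h : tL dg (pt k (QPath.comp p q)) = _ := (congrArg _ (fcomp_pt q p).symm).trans ih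
      rw [fcomp_pt, QPath.comp_cons, tL_pt, tPath, ← tL_pt, h, tL_pt _ (.cons e q), tPath,
        QPath.deg_comp, iPath_comp, ← fcomp_pt, sgn_add, iL_pt _ (.cons e q), iPath, pt_cons,
        iL_pt, ← tL_pt, twist_pt, map_smul, iL_pt]
      simp only [map_add, map_smul, LinearMap.add_apply, LinearMap.smul_apply, smul_smul,
        smul_add, fcomp_assoc, add_assoc, mul_comm]
  exact congrArg (fun l => l g f) this

theorem twist_twist {X Y : V} (x : FHom k E X Y) : twist k dg (twist k dg x) = x := by
  have : (twist k dg).comp (twist k dg) = (LinearMap.id : FHom k E X Y →ₗ[k] _) := by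
    apply FHom.hom_ext; intro p
    simp [twist_pt, smul_smul, sgn_mul_self]
  exact congrArg (fun l => l x) this

theorem twist_iL (r : Bool) {X Y : V} (x : FHom k E X Y) :
    twist k (cylDeg dg) (iL r x) = iL r (twist k dg x) := by
  have : (twist k (cylDeg dg)).comp (iL r) =
      (iL r).comp (twist k dg (X := X) (Y := Y)) := by
    apply FHom.hom_ext; intro p
    simp [twist_pt, iL_pt, iPath_deg]
  exact congrArg (fun l => l x) this

theorem twist_tL {X Y : V} (x : FHom k E X Y) :
    twist k (cylDeg dg) (tL dg x) = -tL dg (twist k dg x) := by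
  have : (twist k (cylDeg dg)).comp (tL dg) =
      -((tL dg).comp (twist k dg (X := X) (Y := Y))) := by
    apply FHom.hom_ext; intro p
    have := tL_mem dg (pt_mem_fdeg (k := k) dg p)
    simp [twist_pt, twist_of_mem _ this, sgn_sub_one]
  exact congrArg (fun l => l x) this

variable (δ : ∀ ⦃X Y⦄, E X Y → FHom k E X Y)

theorem twist_fd (hδ : ∀ ⦃X Y⦄ (e : E X Y), δ e ∈ fdeg k dg X Y (dg e + 1)) {X Y : V}
    (x : FHom k E X Y) : twist k dg (fd dg δ x) = -fd dg δ (twist k dg x) := by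
  have : (twist k dg).comp (fd dg δ) = -((fd dg δ).comp (twist k dg (X := X) (Y := Y))) := by
    apply FHom.hom_ext; intro p
    have := fd_mem dg δ hδ (pt_mem_fdeg (k := k) dg p)
    simp [twist_pt, twist_of_mem _ this, sgn_succ]
  exact congrArg (fun l => l x) this

theorem fd_iL (r : Bool) {X Y : V} (x : FHom k E X Y) :
    fd (cylDeg dg) (cylδ dg δ) (iL r x) = iL r (fd dg δ x) := by
  have : (fd (cylDeg dg) (cylδ dg δ)).comp (iL r) =
      (iL r).comp (fd dg δ (X := X) (Y := Y)) := by
    clear x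
    apply FHom.hom_ext; intro p
    simp only [LinearMap.comp_apply]
    induction p with
    | nil => rw [iL_pt, iPath, fd_pt, fd_pt, dPath, dPath, map_zero]
    | cons e p ih =>
      rw [pt_cons, iL_fcomp, fd_leibniz, fd_leibniz, ih, twist_iL, iL_edge, fd_edge, fd_edge,
        map_add, iL_fcomp, iL_fcomp, cylδ]
  exact congrArg (fun l => l x) this

theorem fd_tL (hδ : ∀ ⦃X Y⦄ (e : E X Y), δ e ∈ fdeg k dg X Y (dg e + 1)) {X Y : V}
    (x : FHom k E X Y) :
    fd (cylDeg dg) (cylδ dg δ) (tL dg x) =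
      fcomp (iL true (twist k dg x)) (edge k (.t X)) -
        fcomp (edge k (.t Y)) (iL false (twist k dg x)) + tL dg (fd dg δ x) := by
  have : (fd (cylDeg dg) (cylδ dg δ)).comp (tL dg) =
      (fcomp.flip (edge k (.t X))).comp ((iL true).comp (twist k dg)) -
        (fcomp (edge k (.t Y))).comp ((iL false).comp (twist k dg (X := X) (Y := Y))) +
      (tL dg).comp (fd dg δ) := by
    clear x
    apply FHom.hom_ext; intro p
    simp only [LinearMap.comp_apply, LinearMap.add_apply, LinearMap.sub_apply,
      LinearMap.flip_apply]
    induction p with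
    | nil =>
      rw [tL_pt, fd_pt, tPath, dPath, twist_pt, QPath.deg, sgn_zero, one_smul, iL_pt, iL_pt, iPath,
        iPath, id_fcomp, fcomp_id]
      simp
    | cons e p ih =>
      have he : fd (cylDeg dg) (cylδ dg δ) (tL dg (edge k e)) =
          fcomp (iL true (twist k dg (edge k e))) (edge k (.t _)) -
            fcomp (edge k (.t _)) (iL false (twist k dg (edge k e))) + tL dg (δ e) := by
        rw [tL_edge, fd_edge, twist_of_mem _ (edge_mem_fdeg dg e), cylδ]
        simp only [map_smul, LinearMap.smul_apply, iL_edge, smul_sub]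
      rw [pt_cons, tL_fcomp, map_add, fd_leibniz, fd_leibniz, ih, he, twist_tL, fd_iL, fd_iL,
        twist_iL, fd_leibniz, map_add (tL dg), tL_fcomp, tL_fcomp, fd_edge, twist_fcomp, iL_fcomp,
        iL_fcomp, twist_fd _ _ hδ]
      simp only [map_add, map_sub, map_neg, LinearMap.add_apply, LinearMap.sub_apply,
        LinearMap.neg_apply, fcomp_assoc]
      abel
  exact congrArg (fun l => l x) this

theorem cylδ_mem (hδ : ∀ ⦃X Y⦄ (e : E X Y), δ e ∈ fdeg k dg X Y (dg e + 1)) ⦃P Q : V × Bool⦄ (e : CylE E P Q) :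
    cylδ dg δ e ∈ fdeg k (cylDeg dg) P Q (cylDeg dg e + 1) := by
  have hh : ∀ {P Q R : V × Bool} (b : CylE E Q R) (a : CylE E P Q) {n : ℤ},
      cylDeg dg b + cylDeg dg a = n →
      fcomp (edge k b) (edge k a) ∈ fdeg k (cylDeg dg) P R n := by
    rintro P Q R b a n rfl
    exact fcomp_mem _ (edge_mem_fdeg _ b) (edge_mem_fdeg _ a)
  cases e with
  | incl r e => exact iL_mem dg r (hδ e)
  | t X => exact zero_mem _
  | tInv X => exact zero_mem _
  | tHat X => exact sub_mem (pt_mem_fdeg' _ _ rfl) (hh _ _ rfl)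
  | tCheck X => exact sub_mem (pt_mem_fdeg' _ _ rfl) (hh _ _ rfl)
  | tBar X => exact sub_mem (hh _ _ rfl) (hh _ _ rfl)
  | tGen e =>
    refine add_mem (Submodule.smul_mem _ _ (sub_mem (hh _ _ ?_) (hh _ _ ?_))) ?_
    · simp [cylDeg]
    · simp [cylDeg]
    · have := tL_mem dg (hδ e)
      simpa [cylDeg] using this

theorem fd_cylδ (hδ : ∀ ⦃X Y⦄ (e : E X Y), δ e ∈ fdeg k dg X Y (dg e + 1))
    (hδδ : ∀ ⦃X Y⦄ (e : E X Y), fd dg δ (δ e) = 0) ⦃P Q : V × Bool⦄ (e : CylE E P Q) :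
    fd (cylDeg dg) (cylδ dg δ) (cylδ dg δ e) = 0 := by
  have h1 : ∀ {P Q : V × Bool} (b : CylE E P Q),
      twist k (cylDeg dg) (edge k b) = sgn k (cylDeg dg b) • edge k b := fun b =>
    twist_of_mem _ (edge_mem_fdeg _ b)
  have h0 : ∀ P : V × Bool, fd (cylDeg dg) (cylδ dg δ) (pt k (.nil P)) = 0 := fun P => by
    rw [fd_pt, dPath]
  cases e with
  | incl r e => rw [cylδ, fd_iL, hδδ, map_zero]
  | t X => rw [cylδ, map_zero]
  | tInv X => rw [cylδ, map_zero]
  | tHat X => simp [cylδ, fd_leibniz, fd_edge, h0]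
  | tCheck X => simp [cylδ, fd_leibniz, fd_edge, h0]
  | tBar X =>
    rw [cylδ, map_sub, fd_leibniz, fd_leibniz, h1, h1, fd_edge, fd_edge, fd_edge, cylδ, cylδ, cylδ,
      cylDeg, cylDeg, sgn_zero, sgn_neg_one]
    simp [id_fcomp, fcomp_id, fcomp_assoc]
  | tGen e =>
    rw [cylδ, map_add, fd_tL _ _ hδ, hδδ, twist_of_mem _ (hδ e), map_smul, map_sub, fd_leibniz,
      fd_leibniz, h1, h1, fd_edge, fd_edge, fd_edge, sgn_succ]
    simp [cylδ, cylDeg, sgn_zero, fd_edge, smul_sub]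

end FreeCyl

section Semifree

variable {k : Type u} [CommRing k]

/-- A set of homogeneous morphisms of `A`, indexed by the edges of a quiver on its objects. -/
structure Gens (A : DGCat k) where
  E : A.Obj → A.Obj → Type u
  gen : ∀ ⦃X Y⦄, E X Y → A.Hom X Y
  deg : ∀ ⦃X Y⦄, E X Y → ℤ
  gen_mem : ∀ ⦃X Y⦄ (e : E X Y), gen e ∈ A.homDeg X Y (deg e)

namespace Gens

variable {A : DGCat k} (a : Gens A)

/-- Evaluation of linear combinations of paths of generators. -/
noncomputable def lin {X Y : A.Obj} : FHom k a.E X Y →ₗ[k] A.Hom X Y :=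
  evL A (fun X => X) a.gen

/-- The morphisms of `A` are freely generated by `a`: the composites of paths of generators (with
the identities as empty composites) form a basis of each module of morphisms. -/
def IsFree : Prop := ∀ X Y : A.Obj, Function.Bijective (a.lin (X := X) (Y := Y))

/-- The set of all generators. -/
abbrev Idx : Type u := Σ X Y : A.Obj, a.E X Y

/-- The class of generators that precede `j` in the order `r`. -/
inductive Before (r : a.Idx → a.Idx → Prop) (j : a.Idx) : ∀ ⦃X Y : A.Obj⦄, A.Hom X Y → Prop
  | gen {X Y : A.Obj} (e : a.E X Y) : r ⟨X, Y, e⟩ j → Before r j (a.gen e)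

/-- `A` is semifree on `a`: it is freely generated by `a`, and for some well-ordering of the
generators, the differential of each generator is generated by the preceding ones. -/
def IsSemifree : Prop :=
  a.IsFree ∧ ∃ r : a.Idx → a.Idx → Prop, IsWellOrder a.Idx r ∧
    ∀ (X Y : A.Obj) (e : a.E X Y), A.Generated (a.Before r ⟨X, Y, e⟩) (A.d (a.gen e))

end Gens

/-- `A` is a semifree dg category. -/
def IsSemifree : ObjectProperty (DGCat k) := fun A => ∃ a : Gens A, a.IsSemifree

/-- The edges given by the images under `F` of the generators in `a` and by the morphisms in `S`. -/
inductive ExtE {A B : DGCat k} (F : A ⟶ B) (a : Gens A) (S : Gens B) : B.Obj → B.Obj → Type u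
  | old {X Y : A.Obj} (e : a.E X Y) : ExtE F a S (F.obj X) (F.obj Y)
  | new {U W : B.Obj} (s : S.E U W) : ExtE F a S U W

/-- The images under `F` of the generators in `a`, together with the morphisms in `S`. -/
def extGens {A B : DGCat k} (F : A ⟶ B) (a : Gens A) (S : Gens B) : Gens B where
  E := ExtE F a S
  gen := fun
    | _, _, .old e => F.map (a.gen e)
    | _, _, .new s => S.gen s
  deg := fun
    | _, _, .old e => a.deg e
    | _, _, .new s => S.deg s
  gen_mem := fun
    | _, _, .old e => F.map_mem (a.gen_mem e)
    | _, _, .new s => S.gen_mem s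

/-- The morphisms in the image of `F` and the morphisms in `S` that precede `j`. -/
inductive ExtBefore {A B : DGCat k} (F : A ⟶ B) (S : Gens B) (r : S.Idx → S.Idx → Prop)
    (j : S.Idx) : ∀ ⦃U W : B.Obj⦄, B.Hom U W → Prop
  | image {X Y : A.Obj} (f : A.Hom X Y) : ExtBefore F S r j (F.map f)
  | gen {U W : B.Obj} (s : S.E U W) : r ⟨U, W, s⟩ j → ExtBefore F S r j (S.gen s)

/-- `F : A ⟶ B` is a semifree extension by the set of morphisms `S` (and by the set of the objects
of `B` outside the image of `F`): `F` is an inclusion, the morphisms of `B` are a free extension of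
those of `F(A)` by `S`, and for some well-ordering of `S` the differential of each element of `S` is
generated by the morphisms of `F(A)` and the preceding elements of `S`. As `A` is semifree, freeness
over `F(A)` means that the images of free generators of `A`, together with `S`, freely generate
`B`; this does not depend on the chosen generators of `A`. -/
structure IsSemifreeExtensionBy {A B : DGCat k} (F : A ⟶ B) (S : Gens B) : Prop where
  obj_injective : Function.Injective F.obj
  map_injective : ∀ X Y : A.Obj, Function.Injective (F.map (X := X) (Y := Y))
  free : ∃ a : Gens A, a.IsSemifree ∧ (extGens F a S).IsFree
  order : ∃ r : S.Idx → S.Idx → Prop, IsWellOrder S.Idx r ∧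
    ∀ (U W : B.Obj) (s : S.E U W), B.Generated (ExtBefore F S r ⟨U, W, s⟩) (B.d (S.gen s))

variable (k) in
/-- The category of small semifree dg categories over `k` and dg functors. -/
abbrev SemifreeDGCat : Type (u + 1) := (IsSemifree (k := k)).FullSubcategory

variable (k) in
/-- The cofibrations: semifree extensions. -/
def semifreeExtensions : MorphismProperty (SemifreeDGCat k) := fun _ B F =>
  ∃ S : Gens B.obj, IsSemifreeExtensionBy F.hom S

end Semifree

section Cylinder

variable {k : Type u} [CommRing k]

namespace Gens

variable {A : DGCat k} (a : Gens A) (h : a.IsFree)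

/-- The expansion of morphisms in terms of free generators. -/
noncomputable def inv {X Y : A.Obj} : A.Hom X Y ≃ₗ[k] FHom k a.E X Y :=
  (LinearEquiv.ofBijective a.lin (h X Y)).symm

/-- The differentials of the generators, expanded in terms of the generators. -/
noncomputable def δ ⦃X Y : A.Obj⦄ (e : a.E X Y) : FHom k a.E X Y := a.inv h (A.d (a.gen e))

theorem lin_nil (X : A.Obj) : a.lin (pt k (.nil X)) = A.id X := evL_nil A _ a.gen X

theorem lin_edge {X Y : A.Obj} (e : a.E X Y) : a.lin (edge k e) = a.gen e := evL_edge A _ a.gen e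

theorem lin_fcomp {X Y Z : A.Obj} (g : FHom k a.E Y Z) (f : FHom k a.E X Y) :
    a.lin (fcomp g f) = A.comp (a.lin g) (a.lin f) := evL_fcomp A _ a.gen g f

theorem lin_inv {X Y : A.Obj} (f : A.Hom X Y) : a.lin (a.inv h f) = f :=
  (LinearEquiv.ofBijective a.lin (h X Y)).apply_symm_apply f

theorem inv_lin {X Y : A.Obj} (x : FHom k a.E X Y) : a.inv h (a.lin x) = x :=
  (LinearEquiv.ofBijective a.lin (h X Y)).symm_apply_apply x

theorem lin_mem {X Y : A.Obj} {n : ℤ} {x : FHom k a.E X Y} (hx : x ∈ fdeg k a.deg X Y n) :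
    a.lin x ∈ A.homDeg X Y n := evL_mem a.deg A _ a.gen a.gen_mem hx

theorem inv_mem {X Y : A.Obj} {n : ℤ} {f : A.Hom X Y} (hf : f ∈ A.homDeg X Y n) :
    a.inv h f ∈ fdeg k a.deg X Y n := by
  classical
  have hd := (fdeg_isInternal (k := k) a.deg X Y).chooseDecomposition
  have hA := (A.isInternal X Y).chooseDecomposition
  set x := a.inv h f with hx
  have hsum := DirectSum.sum_support_decompose (fdeg k a.deg X Y) x
  have key : ∀ m, a.lin (DirectSum.decompose (fdeg k a.deg X Y) x m : FHom k a.E X Y) =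
      (DirectSum.decompose (A.homDeg X Y) (a.lin x) m : A.Hom X Y) := by
    intro m
    conv_rhs => rw [← hsum]
    rw [map_sum, DirectSum.decompose_sum, DFinsupp.finsetSum_apply, AddSubmonoidClass.coe_finsetSum]
    rw [Finset.sum_eq_single m]
    · rw [DirectSum.decompose_of_mem_same _ (a.lin_mem (SetLike.coe_mem _))]
    · intro j _ hj
      rw [DirectSum.decompose_of_mem_ne _ (a.lin_mem (SetLike.coe_mem _)) hj]
    · intro hm
      rw [DFinsupp.notMem_support_iff.mp hm]
      simp
  rw [← hsum]
  refine sum_mem fun m _ => ?_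
  by_cases hm : m = n
  · subst hm; exact SetLike.coe_mem _
  · have h0 := key m
    rw [hx, lin_inv, DirectSum.decompose_of_mem_ne _ hf (Ne.symm hm)] at h0
    rw [← hx] at h0
    have : (DirectSum.decompose (fdeg k a.deg X Y) x m : FHom k a.E X Y) = 0 := by
      apply (h X Y).1
      rw [h0, map_zero]
    rw [this]
    exact zero_mem _

theorem δ_mem ⦃X Y : A.Obj⦄ (e : a.E X Y) : a.δ h e ∈ fdeg k a.deg X Y (a.deg e + 1) :=
  a.inv_mem h (A.d_mem (a.gen_mem e))

theorem lin_fd {X Y : A.Obj} (x : FHom k a.E X Y) :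
    a.lin (fd a.deg (a.δ h) x) = A.d (a.lin x) :=
  evL_fd a.deg (a.δ h) A _ a.gen a.gen_mem (fun _ _ e => a.lin_inv h (A.d (a.gen e))) x

theorem inv_d {X Y : A.Obj} (f : A.Hom X Y) :
    a.inv h (A.d f) = fd a.deg (a.δ h) (a.inv h f) := by
  apply (h X Y).1
  rw [lin_fd, lin_inv, lin_inv]

theorem fd_δ ⦃X Y : A.Obj⦄ (e : a.E X Y) : fd a.deg (a.δ h) (a.δ h e) = 0 := by
  rw [δ, ← inv_d, A.d_d, map_zero]

theorem inv_comp {X Y Z : A.Obj} (g : A.Hom Y Z) (f : A.Hom X Y) :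
    a.inv h (A.comp g f) = fcomp (a.inv h g) (a.inv h f) := by
  apply (h X Z).1
  rw [lin_inv, lin_fcomp, lin_inv, lin_inv]

theorem inv_id (X : A.Obj) : a.inv h (A.id X) = pt k (.nil X) := by
  apply (h X X).1
  rw [lin_inv, lin_nil]

theorem inv_gen {X Y : A.Obj} (e : a.E X Y) : a.inv h (a.gen e) = edge k e := by
  apply (h X Y).1
  rw [lin_inv, lin_edge]

end Gens

/-- The cylinder `Cyl(A)` of a dg category `A` that is freely generated by `a`. Its objects are
`(X, false) = i₁ X` and `(X, true) = i₂ X`. -/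
noncomputable abbrev Cyl (A : DGCat k) (a : Gens A) (h : a.IsFree) : DGCat k :=
  freeDG (cylDeg a.deg) (cylδ a.deg (a.δ h)) (cylδ_mem a.deg (a.δ h) (a.δ_mem h))
    (fd_cylδ a.deg (a.δ h) (a.δ_mem h) (a.fd_δ h))

namespace Cyl

variable {A B C : DGCat k} (a : Gens A) (h : a.IsFree) (b : Gens B) (hb : b.IsFree)
  (c : Gens C) (hc : c.IsFree)

/-- The two copies of the morphisms of `A` in the cylinder: `inclMap false θ` is `i₁ θ` and
`inclMap true θ` is `i₂ θ`. -/
noncomputable def inclMap (r : Bool) {X Y : A.Obj} :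
    A.Hom X Y →ₗ[k] (Cyl A a h).Hom (X, r) (Y, r) :=
  (iL r).comp (a.inv h).toLinearMap

theorem inclMap_id (r : Bool) (X : A.Obj) :
    inclMap a h r (A.id X) = (Cyl A a h).id (X, r) := by
  simp only [inclMap, LinearMap.comp_apply, LinearEquiv.coe_coe, Gens.inv_id, iL_pt]
  rfl

theorem inclMap_comp (r : Bool) {X Y Z : A.Obj} (g : A.Hom Y Z) (f : A.Hom X Y) :
    inclMap a h r (A.comp g f) = (Cyl A a h).comp (inclMap a h r g) (inclMap a h r f) := by
  simp only [inclMap, LinearMap.comp_apply, LinearEquiv.coe_coe, Gens.inv_comp, iL_fcomp]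

theorem inclMap_mem (r : Bool) {X Y : A.Obj} {n : ℤ} {f : A.Hom X Y} (hf : f ∈ A.homDeg X Y n) :
    inclMap a h r f ∈ (Cyl A a h).homDeg (X, r) (Y, r) n :=
  iL_mem a.deg r (a.inv_mem h hf)

theorem inclMap_d (r : Bool) {X Y : A.Obj} (f : A.Hom X Y) :
    inclMap a h r (A.d f) = (Cyl A a h).d (inclMap a h r f) := by
  simp only [inclMap, LinearMap.comp_apply, LinearEquiv.coe_coe, Gens.inv_d]
  exact (fd_iL a.deg (a.δ h) r _).symm

/-- The two ends of the cylinder: `incl false` is `i₁` and `incl true` is `i₂`. -/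
noncomputable def incl (r : Bool) : A ⟶ Cyl A a h where
  obj X := (X, r)
  map := inclMap a h r
  map_id := inclMap_id a h r
  map_comp := inclMap_comp a h r
  map_mem := inclMap_mem a h r
  map_d := inclMap_d a h r

theorem d_edge {P Q : A.Obj × Bool} (e : CylE a.E P Q) :
    (Cyl A a h).d (X := P) (Y := Q) (edge k e) = cylδ a.deg (a.δ h) e :=
  fd_edge _ _ e

/-- The morphism `t_X : i₁ X ⟶ i₂ X`. -/
noncomputable def t (X : A.Obj) : (Cyl A a h).Hom (X, false) (X, true) := edge k (.t X)

/-- The morphism `t'_X : i₂ X ⟶ i₁ X`. -/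
noncomputable def tInv (X : A.Obj) : (Cyl A a h).Hom (X, true) (X, false) := edge k (.tInv X)

/-- The morphism `t̂_X : i₁ X ⟶ i₁ X`. -/
noncomputable def tHat (X : A.Obj) : (Cyl A a h).Hom (X, false) (X, false) := edge k (.tHat X)

/-- The morphism `ť_X : i₂ X ⟶ i₂ X`. -/
noncomputable def tCheck (X : A.Obj) : (Cyl A a h).Hom (X, true) (X, true) := edge k (.tCheck X)

/-- The morphism `t̄_X : i₁ X ⟶ i₂ X`. -/
noncomputable def tBar (X : A.Obj) : (Cyl A a h).Hom (X, false) (X, true) := edge k (.tBar X)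

/-- The morphism `t_θ : i₁ X ⟶ i₂ Y` for a morphism `θ : X ⟶ Y` of `A`, linear in `θ`. -/
noncomputable def tMor {X Y : A.Obj} : A.Hom X Y →ₗ[k] (Cyl A a h).Hom (X, false) (Y, true) :=
  (tL a.deg).comp (a.inv h).toLinearMap

theorem tMor_id (X : A.Obj) : tMor a h (A.id X) = 0 := by
  simp only [tMor, LinearMap.comp_apply, LinearEquiv.coe_coe, Gens.inv_id]
  exact tL_pt _ _

theorem tMor_comp {X Y Z : A.Obj} {n : ℤ} (g : A.Hom Y Z) {f : A.Hom X Y}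
    (hf : f ∈ A.homDeg X Y n) :
    tMor a h (A.comp g f) =
      (Cyl A a h).comp (inclMap a h true g) (tMor a h f) +
        sgn k n • (Cyl A a h).comp (tMor a h g) (inclMap a h false f) := by
  simp only [tMor, LinearMap.comp_apply, LinearEquiv.coe_coe, Gens.inv_comp, tL_fcomp,
    twist_of_mem _ (a.inv_mem h hf), map_smul]
  rfl

theorem tMor_mem {X Y : A.Obj} {n : ℤ} {f : A.Hom X Y} (hf : f ∈ A.homDeg X Y n) :
    tMor a h f ∈ (Cyl A a h).homDeg (X, false) (Y, true) (n - 1) :=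
  tL_mem a.deg (a.inv_mem h hf)

theorem d_tMor {X Y : A.Obj} {n : ℤ} {f : A.Hom X Y} (hf : f ∈ A.homDeg X Y n) :
    (Cyl A a h).d (tMor a h f) =
      sgn k n • ((Cyl A a h).comp (inclMap a h true f) (t a h X) -
        (Cyl A a h).comp (t a h Y) (inclMap a h false f)) + tMor a h (A.d f) := by
  have := fd_tL a.deg (a.δ h) (a.δ_mem h) (a.inv h f)
  rw [twist_of_mem _ (a.inv_mem h hf), ← Gens.inv_d] at this
  simp only [map_smul, LinearMap.smul_apply, ← smul_sub] at this
  exact this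

/-- The values of `Cyl(F)` on the edges of the cylinder. -/
noncomputable def mapE (F : A ⟶ B) : ∀ ⦃P Q : A.Obj × Bool⦄, CylE a.E P Q →
    (Cyl B b hb).Hom (F.obj P.1, P.2) (F.obj Q.1, Q.2)
  | _, _, .incl r e => inclMap b hb r (F.map (a.gen e))
  | _, _, .t X => t b hb (F.obj X)
  | _, _, .tInv X => tInv b hb (F.obj X)
  | _, _, .tHat X => tHat b hb (F.obj X)
  | _, _, .tCheck X => tCheck b hb (F.obj X)
  | _, _, .tBar X => tBar b hb (F.obj X)
  | _, _, .tGen e => tMor b hb (F.map (a.gen e))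

/-- The linear extension of `mapE`. -/
noncomputable def mapL (F : A ⟶ B) {P Q : A.Obj × Bool} : FHom k (CylE a.E) P Q →ₗ[k]
    (Cyl B b hb).Hom (F.obj P.1, P.2) (F.obj Q.1, Q.2) :=
  evL (Cyl B b hb) (fun P : A.Obj × Bool => (F.obj P.1, P.2)) (mapE a b hb F)

theorem mapL_edge (F : A ⟶ B) {P Q : A.Obj × Bool} (e : CylE a.E P Q) :
    mapL a b hb F (edge k e) = mapE a b hb F e := evL_edge _ _ _ e

theorem mapL_fcomp (F : A ⟶ B) {P Q R : A.Obj × Bool} (y : FHom k (CylE a.E) Q R)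
    (x : FHom k (CylE a.E) P Q) :
    mapL a b hb F (fcomp y x) = (Cyl B b hb).comp (mapL a b hb F y) (mapL a b hb F x) :=
  evL_fcomp _ _ _ y x

theorem mapL_nil (F : A ⟶ B) (P : A.Obj × Bool) :
    mapL a b hb F (pt k (.nil P)) = (Cyl B b hb).id _ := evL_nil _ _ _ P

theorem mapL_iL (F : A ⟶ B) (r : Bool) {X Y : A.Obj} (x : FHom k a.E X Y) :
    mapL a b hb F (iL r x) = inclMap b hb r (F.map (a.lin x)) := by
  have : (mapL a b hb F).comp (iL r) =
      ((inclMap b hb r).comp F.map).comp (a.lin (X := X) (Y := Y)) := by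
    clear x
    apply FHom.hom_ext; intro p
    simp only [LinearMap.comp_apply]
    induction p with
    | nil =>
      rw [iL_pt, iPath, mapL_nil, Gens.lin_nil, F.map_id]
      exact (inclMap_id b hb r _).symm
    | cons e p ih =>
      rw [pt_cons, iL_fcomp, mapL_fcomp, ih, iL_edge, mapL_edge, Gens.lin_fcomp, Gens.lin_edge,
        F.map_comp]
      exact (inclMap_comp b hb r _ _).symm
  exact congrArg (fun l => l x) this

theorem mapL_tL (F : A ⟶ B) {X Y : A.Obj} (x : FHom k a.E X Y) :
    mapL a b hb F (tL a.deg x) = tMor b hb (F.map (a.lin x)) := by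
  have : (mapL a b hb F).comp (tL a.deg) =
      ((tMor b hb).comp F.map).comp (a.lin (X := X) (Y := Y)) := by
    clear x
    apply FHom.hom_ext; intro p
    simp only [LinearMap.comp_apply]
    induction p with
    | nil =>
      rw [tL_pt, tPath, map_zero, Gens.lin_nil, F.map_id]
      exact (tMor_id b hb _).symm
    | cons e p ih =>
      rw [pt_cons, tL_fcomp, map_add, mapL_fcomp, mapL_fcomp, ih, twist_pt, map_smul, map_smul,
        map_smul, iL_edge, tL_edge, mapL_edge, mapL_edge, mapL_iL, Gens.lin_fcomp, Gens.lin_edge,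
        F.map_comp]
      exact (tMor_comp b hb _ (F.map_mem (a.lin_mem (pt_mem_fdeg a.deg p)))).symm
  exact congrArg (fun l => l x) this

/-- The dg functor `Cyl(F)`. -/
noncomputable def map (F : A ⟶ B) : Cyl A a h ⟶ Cyl B b hb :=
  freeDGLift (cylDeg a.deg) (cylδ a.deg (a.δ h)) (Cyl B b hb) (fun P : A.Obj × Bool => (F.obj P.1, P.2))
    (mapE a b hb F) (cylδ_mem a.deg (a.δ h) (a.δ_mem h))
    (fd_cylδ a.deg (a.δ h) (a.δ_mem h) (a.fd_δ h))
    (by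
      intro P Q e
      cases e with
      | incl r e => exact inclMap_mem b hb r (F.map_mem (a.gen_mem e))
      | t X => exact edge_mem_fdeg (cylDeg b.deg) (.t _)
      | tInv X => exact edge_mem_fdeg (cylDeg b.deg) (.tInv _)
      | tHat X => exact edge_mem_fdeg (cylDeg b.deg) (.tHat _)
      | tCheck X => exact edge_mem_fdeg (cylDeg b.deg) (.tCheck _)
      | tBar X => exact edge_mem_fdeg (cylDeg b.deg) (.tBar _)
      | tGen e => exact tMor_mem b hb (F.map_mem (a.gen_mem e)))
    (by
      intro P Q e
      change mapL a b hb F _ = _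
      cases e with
      | incl r e =>
        rw [cylδ, mapL_iL, Gens.δ, Gens.lin_inv, F.map_d]
        exact inclMap_d b hb r _
      | t X => rw [cylδ, map_zero]; exact (d_edge b hb (.t _)).symm
      | tInv X => rw [cylδ, map_zero]; exact (d_edge b hb (.tInv _)).symm
      | tHat X =>
        rw [cylδ, map_sub, mapL_fcomp, mapL_nil, mapL_edge, mapL_edge]
        exact (d_edge b hb (.tHat _)).symm
      | tCheck X =>
        rw [cylδ, map_sub, mapL_fcomp, mapL_nil, mapL_edge, mapL_edge]
        exact (d_edge b hb (.tCheck _)).symm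
      | tBar X =>
        rw [cylδ, map_sub, mapL_fcomp, mapL_fcomp, mapL_edge, mapL_edge, mapL_edge]
        exact (d_edge b hb (.tBar _)).symm
      | tGen e =>
        rw [cylδ, map_add, map_smul, map_sub, mapL_fcomp, mapL_fcomp, mapL_edge, mapL_edge,
          mapL_edge, mapL_edge, mapL_tL, Gens.δ, Gens.lin_inv, F.map_d]
        exact (d_tMor b hb (F.map_mem (a.gen_mem e))).symm)

theorem map_map_incl (F : A ⟶ B) (r : Bool) {X Y : A.Obj} (f : A.Hom X Y) :
    (map a h b hb F).map (inclMap a h r f) = inclMap b hb r (F.map f) := by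
  have := mapL_iL a b hb F r (a.inv h f)
  rw [Gens.lin_inv] at this
  exact this

theorem map_map_tMor (F : A ⟶ B) {X Y : A.Obj} (f : A.Hom X Y) :
    (map a h b hb F).map (tMor a h f) = tMor b hb (F.map f) := by
  have := mapL_tL a b hb F (a.inv h f)
  rw [Gens.lin_inv] at this
  exact this

theorem map_map_edge (F : A ⟶ B) {P Q : A.Obj × Bool} (e : CylE a.E P Q) :
    (map a h b hb F).map (X := P) (Y := Q) (edge k e) = mapE a b hb F e := mapL_edge a b hb F e

theorem incl_map (F : A ⟶ B) (r : Bool) :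
    incl a h r ≫ map a h b hb F = F ≫ incl b hb r :=
  DGFunctor.hext rfl fun _ _ f => heq_of_eq (map_map_incl a h b hb F r f)

/-- Two dg functors on the cylinder agree when they agree on objects and on edges. -/
theorem hom_ext {D : DGCat k} {F G : Cyl A a h ⟶ D} (ho : F.obj = G.obj)
    (he : ∀ (P Q : A.Obj × Bool) (e : CylE a.E P Q),
      F.map (X := P) (Y := Q) (edge k e) ≍ G.map (X := P) (Y := Q) (edge k e)) : F = G := by
  obtain ⟨o, m, m1, m2, m3, m4⟩ := F
  obtain ⟨o', m', m1', m2', m3', m4'⟩ := G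
  obtain rfl : o = o' := ho
  have key : ∀ (P Q : A.Obj × Bool), (m : (Cyl A a h).Hom P Q →ₗ[k] _) = m' := by
    intro P Q
    refine FHom.hom_ext (k := k) (E := CylE a.E) ?_
    intro p
    induction p with
    | nil => exact (m1 _).trans (m1' _).symm
    | cons e p ih =>
      rw [pt_cons]
      refine (m2 _ _).trans (Eq.trans ?_ (m2' _ _).symm)
      rw [ih]
      have := eq_of_heq (he _ _ e)
      exact congrArg (fun y => D.comp y _) this
  have : @m = @m' := by
    funext P Q
    exact key P Q
  subst this
  rfl

theorem map_id : map a h a h (𝟙 A) = 𝟙 (Cyl A a h) := by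
  refine hom_ext a h rfl fun P Q e => heq_of_eq ?_
  refine (map_map_edge a h a h (𝟙 A) e).trans ?_
  cases e with
  | incl r e => exact (congrArg (iL r) (a.inv_gen h e)).trans (iL_edge r e)
  | tGen e => exact (congrArg (tL a.deg) (a.inv_gen h e)).trans (tL_edge a.deg e)
  | _ => rfl

theorem map_comp (F : A ⟶ B) (G : B ⟶ C) :
    map a h c hc (F ≫ G) = map a h b hb F ≫ map b hb c hc G := by
  refine hom_ext a h rfl fun P Q e => heq_of_eq ?_
  refine (map_map_edge a h c hc (F ≫ G) e).trans ?_
  refine Eq.trans ?_ (congrArg (map b hb c hc G).map (map_map_edge a h b hb F e)).symm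
  cases e with
  | incl r e => exact (map_map_incl b hb c hc G r (F.map (a.gen e))).symm
  | tGen e => exact (map_map_tMor b hb c hc G (F.map (a.gen e))).symm
  | t X => exact (map_map_edge b hb c hc G (.t _)).symm
  | tInv X => exact (map_map_edge b hb c hc G (.tInv _)).symm
  | tHat X => exact (map_map_edge b hb c hc G (.tHat _)).symm
  | tCheck X => exact (map_map_edge b hb c hc G (.tCheck _)).symm
  | tBar X => exact (map_map_edge b hb c hc G (.tBar _)).symm

/-- The values of the projection of the cylinder on its edges. -/
def projE : ∀ ⦃P Q : A.Obj × Bool⦄, CylE a.E P Q → A.Hom P.1 Q.1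
  | _, _, .incl _ e => a.gen e
  | _, _, .t X => A.id X
  | _, _, .tInv X => A.id X
  | _, _, .tHat _ => 0
  | _, _, .tCheck _ => 0
  | _, _, .tBar _ => 0
  | _, _, .tGen _ => 0

/-- The linear extension of `projE`. -/
noncomputable def projL {P Q : A.Obj × Bool} : FHom k (CylE a.E) P Q →ₗ[k] A.Hom P.1 Q.1 :=
  evL A (fun P : A.Obj × Bool => P.1) (projE a)

theorem projL_edge {P Q : A.Obj × Bool} (e : CylE a.E P Q) :
    projL a (edge k e) = projE a e := evL_edge _ _ _ e

theorem projL_fcomp {P Q R : A.Obj × Bool} (y : FHom k (CylE a.E) Q R)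
    (x : FHom k (CylE a.E) P Q) :
    projL a (fcomp y x) = A.comp (projL a y) (projL a x) := evL_fcomp _ _ _ y x

theorem projL_nil (P : A.Obj × Bool) : projL a (pt k (.nil P)) = A.id P.1 := evL_nil _ _ _ P

theorem projL_iL (r : Bool) {X Y : A.Obj} (x : FHom k a.E X Y) :
    projL a (iL r x) = a.lin x := by
  have : (projL a).comp (iL r) = a.lin (X := X) (Y := Y) := by
    clear x
    apply FHom.hom_ext; intro p
    simp only [LinearMap.comp_apply]
    induction p with
    | nil =>
      rw [iL_pt, iPath, projL_nil, Gens.lin_nil]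
    | cons e p ih =>
      rw [pt_cons, iL_fcomp, projL_fcomp, ih, iL_edge, projL_edge, Gens.lin_fcomp, Gens.lin_edge,
        projE]
  exact congrArg (fun l => l x) this

theorem projL_tL {X Y : A.Obj} (x : FHom k a.E X Y) : projL a (tL a.deg x) = 0 := by
  have : (projL a).comp (tL a.deg) = (0 : FHom k a.E X Y →ₗ[k] _) := by
    clear x
    apply FHom.hom_ext; intro p
    simp only [LinearMap.comp_apply]
    induction p with
    | nil => rw [tL_pt, tPath, map_zero]; rfl
    | cons e p ih =>
      rw [pt_cons, tL_fcomp, map_add, projL_fcomp, projL_fcomp, ih, tL_edge, projL_edge, projE]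
      simp
  exact congrArg (fun l => l x) this

/-- The projection `p` of the cylinder. -/
noncomputable def proj : Cyl A a h ⟶ A :=
  freeDGLift (cylDeg a.deg) (cylδ a.deg (a.δ h)) A (fun P => P.1)
    (projE a) (cylδ_mem a.deg (a.δ h) (a.δ_mem h))
    (fd_cylδ a.deg (a.δ h) (a.δ_mem h) (a.fd_δ h))
    (by
      intro P Q e
      cases e with
      | incl r e => exact a.gen_mem e
      | t X => exact A.id_mem X
      | tInv X => exact A.id_mem X
      | _ => exact zero_mem _)
    (by
      intro P Q e
      change projL a _ = _
      cases e with
      | incl r e => rw [cylδ, projL_iL, Gens.δ, Gens.lin_inv, projE]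
      | t X => rw [cylδ, map_zero, projE, A.d_id]
      | tInv X => rw [cylδ, map_zero, projE, A.d_id]
      | tHat X =>
        rw [cylδ, map_sub, projL_fcomp, projL_nil, projL_edge, projL_edge, projE, projE, projE,
          A.id_comp, sub_self, map_zero]
      | tCheck X =>
        rw [cylδ, map_sub, projL_fcomp, projL_nil, projL_edge, projL_edge, projE, projE, projE,
          A.id_comp, sub_self, map_zero]
      | tBar X =>
        rw [cylδ, map_sub, projL_fcomp, projL_fcomp, projL_edge, projL_edge, projL_edge, projE,
          projE, projE, projE]
        simp
      | tGen e =>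
        rw [cylδ, map_add, map_smul, map_sub, projL_fcomp, projL_fcomp, projL_edge, projL_edge,
          projL_edge, projL_edge, projL_tL, projE, projE, projE, projE, projE, A.id_comp,
          A.comp_id, sub_self, smul_zero, add_zero, map_zero])

theorem proj_map_edge {P Q : A.Obj × Bool} (e : CylE a.E P Q) :
    (proj a h).map (X := P) (Y := Q) (edge k e) = projE a e := projL_edge a e

theorem incl_proj (r : Bool) : incl a h r ≫ proj a h = 𝟙 A :=
  DGFunctor.hext rfl fun _ _ f => heq_of_eq ((projL_iL a r (a.inv h f)).trans (a.lin_inv h f))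

theorem map_proj (F : A ⟶ B) : map a h b hb F ≫ proj b hb = proj a h ≫ F := by
  refine hom_ext a h rfl fun P Q e => heq_of_eq ?_
  refine (congrArg (proj b hb).map (map_map_edge a h b hb F e)).trans ?_
  refine Eq.trans ?_ (congrArg F.map (proj_map_edge a h e)).symm
  cases e with
  | incl r e => exact (projL_iL b r (b.inv hb _)).trans (b.lin_inv hb _)
  | tGen e => exact (projL_tL b (b.inv hb _)).trans F.map.map_zero.symm
  | t X => exact (projL_edge b (.t _)).trans (F.map_id X).symm
  | tInv X => exact (projL_edge b (.tInv _)).trans (F.map_id X).symm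
  | tHat X => exact (projL_edge b (.tHat _)).trans F.map.map_zero.symm
  | tCheck X => exact (projL_edge b (.tCheck _)).trans F.map.map_zero.symm
  | tBar X => exact (projL_edge b (.tBar _)).trans F.map.map_zero.symm

end Cyl

end Cylinder

section CylinderSemifree

variable {k : Type u} [CommRing k]

theorem DGCat.Generated.mono {A : DGCat k} {P P' : ∀ ⦃X Y : A.Obj⦄, A.Hom X Y → Prop}
    (hP : ∀ ⦃X Y : A.Obj⦄ (f : A.Hom X Y), P f → A.Generated P' f) {X Y : A.Obj} {f : A.Hom X Y}
    (hf : A.Generated P f) : A.Generated P' f := by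
  induction hf with
  | of f h => exact hP f h
  | id X => exact .id X
  | comp g f _ _ hg hf => exact .comp g f hg hf
  | zero X Y => exact .zero X Y
  | add f g _ _ hf hg => exact .add f g hf hg
  | smul c f _ hf => exact .smul c f hf

theorem DGCat.Generated.sub {A : DGCat k} {P : ∀ ⦃X Y : A.Obj⦄, A.Hom X Y → Prop}
    {X Y : A.Obj} {f g : A.Hom X Y} (hf : A.Generated P f) (hg : A.Generated P g) :
    A.Generated P (f - g) := by
  have h : f - g = f + (-1 : k) • g := by rw [neg_one_smul, sub_eq_add_neg]
  rw [h]
  exact .add _ _ hf (.smul _ _ hg)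

namespace Cyl

variable {A : DGCat k} (a : Gens A) (h : a.IsFree)

/-- The generating morphisms of the cylinder. -/
noncomputable def gens : Gens (Cyl A a h) where
  E := CylE a.E
  gen _ _ e := edge k e
  deg := cylDeg a.deg
  gen_mem _ _ e := edge_mem_fdeg (cylDeg a.deg) e

theorem gens_isFree : (gens a h).IsFree := by
  intro P Q
  have : (gens a h).lin (X := P) (Y := Q) = (LinearMap.id : FHom k (CylE a.E) P Q →ₗ[k] _) := by
    refine FHom.hom_ext (k := k) (E := CylE a.E) ?_
    intro p
    induction p with
    | nil => exact (gens a h).lin_nil _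
    | cons e p ih =>
      rw [pt_cons]
      exact ((gens a h).lin_fcomp _ _).trans
        (congrArg₂ (fun y x => fcomp y x) ((gens a h).lin_edge e) ih)
  rw [this]
  exact Function.bijective_id

/-- The rank of an edge of the cylinder, given the ranks of the generators. -/
noncomputable def rank (ρ : a.Idx → Ordinal.{u}) : (gens a h).Idx → ℕ ×ₗ Ordinal.{u}
  | ⟨_, _, @CylE.incl _ _ X Y _ e⟩ => toLex (3, ρ ⟨X, Y, e⟩)
  | ⟨_, _, .t _⟩ => toLex (0, 0)
  | ⟨_, _, .tInv _⟩ => toLex (0, 0)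
  | ⟨_, _, .tHat _⟩ => toLex (1, 0)
  | ⟨_, _, .tCheck _⟩ => toLex (1, 0)
  | ⟨_, _, .tBar _⟩ => toLex (2, 0)
  | ⟨_, _, @CylE.tGen _ _ X Y e⟩ => toLex (4, ρ ⟨X, Y, e⟩)

theorem generated_aux {P : ∀ ⦃X Y : A.Obj⦄, A.Hom X Y → Prop}
    {Q : ∀ ⦃X Y : A.Obj × Bool⦄, (Cyl A a h).Hom X Y → Prop}
    (hP : ∀ ⦃X Y : A.Obj⦄ (f : A.Hom X Y), P f → ∃ e : a.E X Y, f = a.gen e ∧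
      (Cyl A a h).Generated Q (X := (X, true)) (Y := (Y, true)) (edge k (.incl true e)) ∧
      (Cyl A a h).Generated Q (X := (X, false)) (Y := (Y, false)) (edge k (.incl false e)) ∧
      (Cyl A a h).Generated Q (X := (X, false)) (Y := (Y, true)) (edge k (.tGen e)))
    {X Y : A.Obj} {f : A.Hom X Y} (hf : A.Generated P f) :
    (Cyl A a h).Generated Q (X := (X, true)) (Y := (Y, true)) (iL true (a.inv h f)) ∧
    (Cyl A a h).Generated Q (X := (X, false)) (Y := (Y, false)) (iL false (a.inv h f)) ∧
    (Cyl A a h).Generated Q (X := (X, false)) (Y := (Y, false))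
      (iL false (twist k a.deg (a.inv h f))) ∧
    (Cyl A a h).Generated Q (X := (X, false)) (Y := (Y, true)) (tL a.deg (a.inv h f)) := by
  induction hf with
  | of f hf =>
    obtain ⟨e, rfl, h1, h2, h3⟩ := hP f hf
    rw [Gens.inv_gen, twist_of_mem _ (edge_mem_fdeg a.deg e), map_smul, iL_edge, iL_edge, tL_edge]
    exact ⟨h1, h2, .smul _ _ h2, h3⟩
  | id X =>
    rw [Gens.inv_id, twist_pt, QPath.deg, sgn_zero, one_smul, iL_pt, iL_pt, tL_pt]
    exact ⟨.id (A := Cyl A a h) (X, true), .id (A := Cyl A a h) (X, false),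
      .id (A := Cyl A a h) (X, false), .zero _ _⟩
  | comp g f _ _ hg hf =>
    obtain ⟨g1, g2, g3, g4⟩ := hg
    obtain ⟨f1, f2, f3, f4⟩ := hf
    rw [Gens.inv_comp, twist_fcomp, iL_fcomp, iL_fcomp, iL_fcomp, tL_fcomp]
    exact ⟨.comp (A := Cyl A a h) _ _ g1 f1, .comp (A := Cyl A a h) _ _ g2 f2,
      .comp (A := Cyl A a h) _ _ g3 f3,
      .add _ _ (.comp (A := Cyl A a h) _ _ g1 f4) (.comp (A := Cyl A a h) _ _ g4 f3)⟩
  | zero X Y =>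
    simp only [map_zero]
    exact ⟨.zero _ _, .zero _ _, .zero _ _, .zero _ _⟩
  | add f g _ _ hf hg =>
    simp only [map_add]
    exact ⟨.add _ _ hf.1 hg.1, .add _ _ hf.2.1 hg.2.1, .add _ _ hf.2.2.1 hg.2.2.1,
      .add _ _ hf.2.2.2 hg.2.2.2⟩
  | smul c f _ hf =>
    simp only [map_smul]
    exact ⟨.smul _ _ hf.1, .smul _ _ hf.2.1, .smul _ _ hf.2.2.1, .smul _ _ hf.2.2.2⟩

theorem generated_incl (r : Bool) {P : ∀ ⦃X Y : A.Obj⦄, A.Hom X Y → Prop}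
    {Q : ∀ ⦃X Y : A.Obj × Bool⦄, (Cyl A a h).Hom X Y → Prop}
    (hP : ∀ ⦃X Y : A.Obj⦄ (f : A.Hom X Y), P f → ∃ e : a.E X Y, f = a.gen e ∧
      (Cyl A a h).Generated Q (X := (X, r)) (Y := (Y, r)) (edge k (.incl r e)))
    {X Y : A.Obj} {f : A.Hom X Y} (hf : A.Generated P f) :
    (Cyl A a h).Generated Q (X := (X, r)) (Y := (Y, r)) (iL r (a.inv h f)) := by
  induction hf with
  | of f hf =>
    obtain ⟨e, rfl, h1⟩ := hP f hf
    rw [Gens.inv_gen, iL_edge]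
    exact h1
  | id X => rw [Gens.inv_id, iL_pt]; exact .id (A := Cyl A a h) (X, r)
  | comp g f _ _ hg hf =>
    rw [Gens.inv_comp, iL_fcomp]; exact .comp (A := Cyl A a h) _ _ hg hf
  | zero X Y => rw [map_zero, map_zero]; exact .zero _ _
  | add f g _ _ hf hg => rw [map_add, map_add]; exact .add _ _ hf hg
  | smul c f _ hf => rw [map_smul, map_smul]; exact .smul _ _ hf

theorem gens_isSemifree (ha : a.IsSemifree) : (gens a h).IsSemifree := by
  refine ⟨gens_isFree a h, ?_⟩
  obtain ⟨-, r, hr, hd⟩ := ha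
  have hwf : IsWellFounded _ (InvImage (· < ·) (rank a h (IsWellFounded.rank r))) :=
    ⟨InvImage.wf _ wellFounded_lt⟩
  obtain ⟨s, hs, hws⟩ := IsWellFounded.exists_well_order_ge
    (InvImage (· < ·) (rank a h (IsWellFounded.rank r)))
  refine ⟨s, hws, ?_⟩
  have hlt : ∀ {P Q P' Q' : A.Obj × Bool} {e : CylE a.E P Q} (e' : CylE a.E P' Q'),
      rank a h (IsWellFounded.rank r) ⟨P', Q', e'⟩ < rank a h (IsWellFounded.rank r) ⟨P, Q, e⟩ →
      (Cyl A a h).Generated ((gens a h).Before s ⟨P, Q, e⟩) (X := P') (Y := Q') (edge k e') :=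
    fun e' hlt => .of _ (.gen (a := gens a h) e' (hs _ _ hlt))
  have h1 : ∀ {m n : ℕ} {α β : Ordinal.{u}}, m < n → (toLex (m, α) : ℕ ×ₗ Ordinal.{u}) < toLex (n, β) :=
    fun hmn => Prod.Lex.toLex_lt_toLex.2 (Or.inl hmn)
  have h2 : ∀ {n : ℕ} {α β : Ordinal.{u}}, α < β → (toLex (n, α) : ℕ ×ₗ Ordinal.{u}) < toLex (n, β) :=
    fun hab => Prod.Lex.toLex_lt_toLex.2 (Or.inr ⟨rfl, hab⟩)
  intro P Q e
  have hde : (Cyl A a h).d ((gens a h).gen e) = cylδ a.deg (a.δ h) e := d_edge a h e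
  rw [hde]
  cases e with
  | @incl X Y b e =>
    refine generated_incl a h b ?_ (hd X Y e)
    intro X' Y' f hf
    obtain ⟨e', hlt'⟩ := hf
    exact ⟨e', rfl, hlt _ (h2 (IsWellFounded.rank_lt_of_rel hlt'))⟩
  | t X => exact .zero _ _
  | tInv X => exact .zero _ _
  | tHat X =>
    exact .sub (.id (A := Cyl A a h) (X, false)) (.comp (A := Cyl A a h) _ _
      (hlt (.tInv X) (h1 (by norm_num))) (hlt (.t X) (h1 (by norm_num))))
  | tCheck X =>
    exact .sub (.id (A := Cyl A a h) (X, true)) (.comp (A := Cyl A a h) _ _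
      (hlt (.t X) (h1 (by norm_num))) (hlt (.tInv X) (h1 (by norm_num))))
  | tBar X =>
    exact .sub (.comp (A := Cyl A a h) _ _ (hlt (.t X) (h1 (by norm_num)))
        (hlt (.tHat X) (h1 (by norm_num))))
      (.comp (A := Cyl A a h) _ _ (hlt (.tCheck X) (h1 (by norm_num)))
        (hlt (.t X) (h1 (by norm_num))))
  | @tGen X Y e =>
    refine .add _ _ (.smul _ _ (.sub (.comp (A := Cyl A a h) _ _
      (hlt (.incl true e) (h1 (by norm_num))) (hlt (.t X) (h1 (by norm_num))))
      (.comp (A := Cyl A a h) _ _ (hlt (.t Y) (h1 (by norm_num)))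
      (hlt (.incl false e) (h1 (by norm_num)))))) ?_
    refine (generated_aux a h ?_ (hd X Y e)).2.2.2
    intro X' Y' f hf
    obtain ⟨e', hlt'⟩ := hf
    exact ⟨e', rfl, hlt _ (h1 (by norm_num)), hlt _ (h1 (by norm_num)),
      hlt _ (h2 (IsWellFounded.rank_lt_of_rel hlt'))⟩

end Cyl

end CylinderSemifree

section CylinderFunctor

variable {k : Type u} [CommRing k]

variable (k) in
/-- A choice of generating morphisms for each semifree dg category. -/
abbrev GeneratorChoice : Type (u + 1) :=
  ∀ A : SemifreeDGCat k, { a : Gens A.obj // a.IsSemifree }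

variable (γ : GeneratorChoice k)

/-- The cylinder of a semifree dg category, as a semifree dg category. -/
noncomputable abbrev cylObj (A : SemifreeDGCat k) : SemifreeDGCat k :=
  ⟨Cyl A.obj (γ A).1 (γ A).2.1, Cyl.gens (γ A).1 (γ A).2.1,
    Cyl.gens_isSemifree (γ A).1 (γ A).2.1 (γ A).2⟩

/-- The cylinder functor `Cyl`. -/
noncomputable def cylFunctor : SemifreeDGCat k ⥤ SemifreeDGCat k where
  obj := cylObj γ
  map {A B} F := ObjectProperty.homMk (Cyl.map (γ A).1 (γ A).2.1 (γ B).1 (γ B).2.1 F.hom)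
  map_id A := ObjectProperty.hom_ext _ (Cyl.map_id (γ A).1 (γ A).2.1)
  map_comp {A B C} F G := ObjectProperty.hom_ext _
    (Cyl.map_comp (γ A).1 (γ A).2.1 (γ B).1 (γ B).2.1 (γ C).1 (γ C).2.1 F.hom G.hom)

/-- The natural transformations `i₁ = cylIncl γ false` and `i₂ = cylIncl γ true`. -/
noncomputable def cylIncl (r : Bool) : 𝟭 (SemifreeDGCat k) ⟶ cylFunctor γ where
  app A := ObjectProperty.homMk (Cyl.incl (γ A).1 (γ A).2.1 r)
  naturality A B F := ObjectProperty.hom_ext _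
    (Cyl.incl_map (γ A).1 (γ A).2.1 (γ B).1 (γ B).2.1 F.hom r).symm

/-- The natural transformation `p`. -/
noncomputable def cylProj : cylFunctor γ ⟶ 𝟭 (SemifreeDGCat k) where
  app A := ObjectProperty.homMk (Cyl.proj (γ A).1 (γ A).2.1)
  naturality A B F := ObjectProperty.hom_ext _
    (Cyl.map_proj (γ A).1 (γ A).2.1 (γ B).1 (γ B).2.1 F.hom)

end CylinderFunctor

open Limits in
/-- The axioms of an `I`-category for a category `M`, a class `cof` of morphisms (the cofibrations)
and a functor `I` with natural transformations `i₁ = i false`, `i₂ = i true` and `p`. -/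
structure IsICategory {M : Type*} [Category M] (cof : MorphismProperty M) (I : M ⥤ M)
    (i : Bool → (𝟭 M ⟶ I)) (p : I ⟶ 𝟭 M) : Prop where
  hasInitial : HasInitial M
  /-- Cylinder axiom. -/
  cylinder : ∀ r : Bool, i r ≫ p = 𝟙 (𝟭 M)
  /-- Pushout axiom. -/
  hasPushout : ∀ {A B C : M} (F : A ⟶ B) (G : A ⟶ C), cof F → HasPushout F G
  pushout_cof : ∀ {A B C D : M} (F : A ⟶ B) (G : A ⟶ C) (G' : B ⟶ D) (F' : C ⟶ D),
    cof F → IsPushout F G G' F' → cof F'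
  pushout_map : ∀ {A B C D : M} (F : A ⟶ B) (G : A ⟶ C) (G' : B ⟶ D) (F' : C ⟶ D),
    cof F → IsPushout F G G' F' → IsPushout (I.map F) (I.map G) (I.map G') (I.map F')
  initial_map : ∀ X : M, Nonempty (IsInitial X) → Nonempty (IsInitial (I.obj X))
  /-- Cofibration axiom. -/
  isIso_cof : ∀ {A B : M} (F : A ⟶ B), IsIso F → cof F
  initial_cof : ∀ {X A : M} (F : X ⟶ A), Nonempty (IsInitial X) → cof F
  comp_cof : ∀ {A B C : M} (F : A ⟶ B) (G : B ⟶ C), cof F → cof G → cof (F ≫ G)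
  homotopy_extension : ∀ (r : Bool) {A B C : M} (F : A ⟶ B) (G : B ⟶ C) (H : I.obj A ⟶ C),
    cof F → F ≫ G = (i r).app A ≫ H →
    ∃ E : I.obj B ⟶ C, (i r).app B ≫ E = G ∧ I.map F ≫ E = H
  /-- Relative cylinder axiom. -/
  hasBinaryCoproducts : HasBinaryCoproducts M
  relative_hasPushout : ∀ {A B : M} (F : A ⟶ B), cof F →
    HasPushout (coprod.map F F)
      (coprod.desc ((i false).app A : A ⟶ I.obj A) ((i true).app A : A ⟶ I.obj A))
  relative_cylinder : ∀ {A B P : M} (F : A ⟶ B) (u : B ⨿ B ⟶ P) (v : I.obj A ⟶ P)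
    (G : P ⟶ I.obj B), cof F →
    IsPushout (coprod.map F F)
      (coprod.desc ((i false).app A : A ⟶ I.obj A) ((i true).app A : A ⟶ I.obj A)) u v →
    u ≫ G = coprod.desc ((i false).app B : B ⟶ I.obj B) ((i true).app B : B ⟶ I.obj B) →
    v ≫ G = I.map F → cof G
  /-- Interchange axiom. -/
  interchange : ∀ A : M, ∃ T : I.obj (I.obj A) ⟶ I.obj (I.obj A), ∀ r : Bool,
    (i r).app (I.obj A) ≫ T = I.map ((i r).app A) ∧ I.map ((i r).app A) ≫ T = (i r).app (I.obj A)

section Formulas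

variable {k : Type u} [CommRing k]

/-- The explicit description of a dg functor `E : Cyl(B) ⟶ C` that extends a homotopy along a
semifree extension by the objects in `R` and the morphisms in `S`, starting at `i₁`. -/
structure IsExtensionFormula {B C : DGCat k} (b : Gens B) (h : b.IsFree) (R : Set B.Obj)
    (S : Gens B) (E : Cyl B b h ⟶ C) : Prop where
  obj : ∀ X ∈ R, E.obj (X, true) = E.obj (X, false)
  t : ∀ X ∈ R, E.map (Cyl.t b h X) ≍ C.id (E.obj (X, false))
  tInv : ∀ X ∈ R, E.map (Cyl.tInv b h X) ≍ C.id (E.obj (X, false))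
  tHat : ∀ X ∈ R, E.map (Cyl.tHat b h X) = 0
  tCheck : ∀ X ∈ R, E.map (Cyl.tCheck b h X) = 0
  tBar : ∀ X ∈ R, E.map (Cyl.tBar b h X) = 0
  /-- `E(s²) = E(t_W s¹ t'_U - (-1)^|s| t_{ds} t'_U - (-1)^|s| (ds)² ť_U)`. -/
  incl_gen : ∀ (U W : B.Obj) (s : S.E U W),
    E.map (Cyl.inclMap b h true (S.gen s)) =
      E.map ((Cyl B b h).comp (Cyl.t b h W)
          ((Cyl B b h).comp (Cyl.inclMap b h false (S.gen s)) (Cyl.tInv b h U)) -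
        sgn k (S.deg s) • (Cyl B b h).comp (Cyl.tMor b h (B.d (S.gen s))) (Cyl.tInv b h U) -
        sgn k (S.deg s) •
          (Cyl B b h).comp (Cyl.inclMap b h true (B.d (S.gen s))) (Cyl.tCheck b h U))
  /-- `E(t_s) = E(-t_W s¹ t̂_U + (-1)^|s| t_{ds} t̂_U - (-1)^|s| (ds)² t̄_U)`. -/
  tMor_gen : ∀ (U W : B.Obj) (s : S.E U W),
    E.map (Cyl.tMor b h (S.gen s)) =
      E.map (-(Cyl B b h).comp (Cyl.t b h W)
          ((Cyl B b h).comp (Cyl.inclMap b h false (S.gen s)) (Cyl.tHat b h U)) +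
        sgn k (S.deg s) • (Cyl B b h).comp (Cyl.tMor b h (B.d (S.gen s))) (Cyl.tHat b h U) -
        sgn k (S.deg s) •
          (Cyl B b h).comp (Cyl.inclMap b h true (B.d (S.gen s))) (Cyl.tBar b h U))

/-- The explicit description of the interchange dg functor `T` on `Cyl(Cyl(A))`. In the comments,
`X^r` is the `r`-th copy of an object `X` of `A` in `Cyl(A)`, and `(θ)^r` is the `r`-th copy of a
morphism `θ` of `Cyl(A)` in `Cyl(Cyl(A))`. -/
structure IsInterchangeFormula {A : DGCat k} (a : Gens A) (h : a.IsFree) (c : Gens (Cyl A a h))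
    (hc : c.IsFree) (T : Cyl (Cyl A a h) c hc ⟶ Cyl (Cyl A a h) c hc) : Prop where
  obj : ∀ (X : A.Obj) (r s : Bool), T.obj ((X, r), s) = ((X, s), r)
  /-- `t_{t_X} ↦ -t_{t_X}`. -/
  t : ∀ X : A.Obj, T.map (Cyl.tMor c hc (Cyl.t a h X)) ≍ -Cyl.tMor c hc (Cyl.t a h X)
  /-- `t_{t'_X} ↦ t'_{X²} t_{t_X} t'_{X¹} - t̂_{X²} (t_X)¹ t'_{X¹} + t'_{X²} (t_X)² ť_{X¹}`. -/
  tInv : ∀ X : A.Obj, T.map (Cyl.tMor c hc (Cyl.tInv a h X)) ≍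
    (Cyl (Cyl A a h) c hc).comp (Cyl.tInv c hc (X, true))
        ((Cyl (Cyl A a h) c hc).comp (Cyl.tMor c hc (Cyl.t a h X)) (Cyl.tInv c hc (X, false))) -
      (Cyl (Cyl A a h) c hc).comp (Cyl.tHat c hc (X, true))
        ((Cyl (Cyl A a h) c hc).comp (Cyl.inclMap c hc false (Cyl.t a h X))
          (Cyl.tInv c hc (X, false))) +
      (Cyl (Cyl A a h) c hc).comp (Cyl.tInv c hc (X, true))
        ((Cyl (Cyl A a h) c hc).comp (Cyl.inclMap c hc true (Cyl.t a h X))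
          (Cyl.tCheck c hc (X, false)))
  /-- `t_{t̂_X} ↦ -t'_{X²} t_{t_X} t̂_{X¹} + t̂_{X²} (t_X)¹ t̂_{X¹} + t'_{X²} (t_X)² t̄_{X¹}`. -/
  tHat : ∀ X : A.Obj, T.map (Cyl.tMor c hc (Cyl.tHat a h X)) ≍
    -(Cyl (Cyl A a h) c hc).comp (Cyl.tInv c hc (X, true))
        ((Cyl (Cyl A a h) c hc).comp (Cyl.tMor c hc (Cyl.t a h X)) (Cyl.tHat c hc (X, false))) +
      (Cyl (Cyl A a h) c hc).comp (Cyl.tHat c hc (X, true))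
        ((Cyl (Cyl A a h) c hc).comp (Cyl.inclMap c hc false (Cyl.t a h X))
          (Cyl.tHat c hc (X, false))) +
      (Cyl (Cyl A a h) c hc).comp (Cyl.tInv c hc (X, true))
        ((Cyl (Cyl A a h) c hc).comp (Cyl.inclMap c hc true (Cyl.t a h X))
          (Cyl.tBar c hc (X, false)))
  /-- `t_{ť_X} ↦ ť_{X²} t_{t_X} t'_{X¹} + ť_{X²} (t_X)² ť_{X¹} + t̄_{X²} (t_X)¹ t'_{X¹}`. -/
  tCheck : ∀ X : A.Obj, T.map (Cyl.tMor c hc (Cyl.tCheck a h X)) ≍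
    (Cyl (Cyl A a h) c hc).comp (Cyl.tCheck c hc (X, true))
        ((Cyl (Cyl A a h) c hc).comp (Cyl.tMor c hc (Cyl.t a h X)) (Cyl.tInv c hc (X, false))) +
      (Cyl (Cyl A a h) c hc).comp (Cyl.tCheck c hc (X, true))
        ((Cyl (Cyl A a h) c hc).comp (Cyl.inclMap c hc true (Cyl.t a h X))
          (Cyl.tCheck c hc (X, false))) +
      (Cyl (Cyl A a h) c hc).comp (Cyl.tBar c hc (X, true))
        ((Cyl (Cyl A a h) c hc).comp (Cyl.inclMap c hc false (Cyl.t a h X))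
          (Cyl.tInv c hc (X, false)))
  /-- `t_{t̄_X} ↦ ť_{X²} t_{t_X} t̂_{X¹} + t̄_{X²} (t_X)¹ t̂_{X¹} - ť_{X²} (t_X)² t̄_{X¹}`. -/
  tBar : ∀ X : A.Obj, T.map (Cyl.tMor c hc (Cyl.tBar a h X)) ≍
    (Cyl (Cyl A a h) c hc).comp (Cyl.tCheck c hc (X, true))
        ((Cyl (Cyl A a h) c hc).comp (Cyl.tMor c hc (Cyl.t a h X)) (Cyl.tHat c hc (X, false))) +
      (Cyl (Cyl A a h) c hc).comp (Cyl.tBar c hc (X, true))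
        ((Cyl (Cyl A a h) c hc).comp (Cyl.inclMap c hc false (Cyl.t a h X))
          (Cyl.tHat c hc (X, false))) -
      (Cyl (Cyl A a h) c hc).comp (Cyl.tCheck c hc (X, true))
        ((Cyl (Cyl A a h) c hc).comp (Cyl.inclMap c hc true (Cyl.t a h X))
          (Cyl.tBar c hc (X, false)))
  /-- `t_{t_θ} ↦ -t_{t_θ}` for each morphism `θ` of `A`. -/
  tMor : ∀ (X Y : A.Obj) (θ : A.Hom X Y),
    T.map (Cyl.tMor c hc (Cyl.tMor a h θ)) ≍ -Cyl.tMor c hc (Cyl.tMor a h θ)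

end Formulas

/-! The cylinder is governed by a path object. For a dg category `C`, the objects of `pathCat C` are
homotopy equivalences in `C`, together with exactly the homotopies that the cylinder records. Its
morphisms from `P` to `Q` are triples: a morphism of sources, a morphism of targets, and a homotopy
of degree one less from the source of `P` to the target of `Q`, whose differential is corrected by
the two composites with `P.t` and `Q.t`. The relations between the generators of the cylinder say
precisely that a dg functor from `Cyl(A)` to `C` is the same as a dg functor from `A` to `pathCat
C`. This is the bijection `flat`, `sharp`. It is natural in `A` (`flat_map_comp`), and restriction
along `i_r` becomes projection to an end (`incl_sharp`). Three of the axioms follow by transposing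
along it.

Pushouts: a cocone under the cylinders transposes to a cocone under the original square with values
in a path category, so the cylinder preserves pushouts taken among all dg categories
(`isPushout_map`).

Homotopy extension: the transposed problem is to lift a semifree extension against an end
projection. On morphisms this projection is a surjection with acyclic kernel, and `fillSrc`,
`fillTgt` solve the equation `d z = y` with a prescribed end by an explicit formula in `t`, `t'` and
the higher homotopies. A transfinite recursion along `S` (`exists_linOver`) assembles the lift; new
objects go to identity equivalences. Transposed back, `fillSrc` is the stated formula for `E`.

Interchange: an object of `pathCat (pathCat C)` contains a square of homotopy equivalences commuting
up to homotopy. Such a square can be transposed, once compatible homotopies for the inverses and the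
higher homotopies are produced (`sqInv`, `sqHat`, `sqCheck`, `sqBar`). Applied to the square that
corresponds to the identity of the double cylinder, `swapFunctor` gives `T`.

The remaining axioms concern freeness. It is proved by generation together with a `k`-linear
retraction onto the free category on the proposed generators (`isFree_of_retraction`). A pushout of
a semifree extension is the free category on the generators of `C` and on `S`, with the differential
carried over from `C` and `B`. The relative cylinder is obtained by two successive pushouts along
`F`. If `B` is generated by those of `A` and by `S`, then `Cyl(B)` has, beyond the relative
cylinder, just the five generators of each new object and one `t_s` for each `s` in `S`; this
exhibits the comparison map as a semifree extension. -/

/-! ### Sign twists and bilinear forms of the Leibniz rules -/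

section Twist

variable {k : Type u} [CommRing k]

namespace DGCat

variable (A : DGCat k)

/-- Two linear maps agree when they agree on homogeneous morphisms. -/
theorem hom_lin_ext {X Y : A.Obj} {M : Type*} [AddCommMonoid M] [Module k M]
    {l l' : A.Hom X Y →ₗ[k] M} (h : ∀ n, ∀ f ∈ A.homDeg X Y n, l f = l' f) : l = l' := by
  classical
  ext f
  have hf : f ∈ ⨆ n, A.homDeg X Y n := by
    rw [(A.isInternal X Y).submodule_iSup_eq_top]; trivial
  induction hf using Submodule.iSup_induction' with
  | mem n f hf => exact h n f hf
  | zero => simp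
  | add f g _ _ hf hg => rw [map_add, map_add, hf, hg]

/-- Multiplication by `(-1) ^ n` in degree `n`. -/
noncomputable def twist {X Y : A.Obj} : A.Hom X Y →ₗ[k] A.Hom X Y :=
  (DirectSum.toModule k ℤ _ fun n => sgn k n • (A.homDeg X Y n).subtype) ∘ₗ
    (LinearEquiv.ofBijective (DirectSum.coeLinearMap (A.homDeg X Y)) (A.isInternal X Y)).symm

theorem twist_of_mem {X Y : A.Obj} {n : ℤ} {f : A.Hom X Y} (hf : f ∈ A.homDeg X Y n) :
    A.twist f = sgn k n • f := by
  have : (LinearEquiv.ofBijective (DirectSum.coeLinearMap (A.homDeg X Y))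
      (A.isInternal X Y)).symm f = DirectSum.lof k ℤ (fun n => A.homDeg X Y n) n ⟨f, hf⟩ := by
    rw [LinearEquiv.symm_apply_eq]
    exact (DirectSum.coeLinearMap_lof (A.homDeg X Y) n ⟨f, hf⟩).symm
  simp [twist, this]

theorem twist_mem {X Y : A.Obj} {n : ℤ} {f : A.Hom X Y} (hf : f ∈ A.homDeg X Y n) :
    A.twist f ∈ A.homDeg X Y n := by
  rw [A.twist_of_mem hf]; exact Submodule.smul_mem _ _ hf

@[simp] theorem twist_id (X : A.Obj) : A.twist (A.id X) = A.id X := by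
  rw [A.twist_of_mem (A.id_mem X), sgn_zero, one_smul]

theorem twist_twist {X Y : A.Obj} (f : A.Hom X Y) : A.twist (A.twist f) = f := by
  have : A.twist ∘ₗ A.twist = (LinearMap.id : A.Hom X Y →ₗ[k] _) :=
    A.hom_lin_ext fun n f hf => by
      simp [A.twist_of_mem hf, smul_smul, sgn_mul_self]
  exact congrArg (fun l => l f) this

theorem twist_comp {X Y Z : A.Obj} (g : A.Hom Y Z) (f : A.Hom X Y) :
    A.twist (A.comp g f) = A.comp (A.twist g) (A.twist f) := by
  have : A.comp.compr₂ A.twist = (A.comp (X := X) (Y := Y) (Z := Z)).compl₁₂ A.twist A.twist :=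
    A.hom_lin_ext fun m g hg => A.hom_lin_ext fun n f hf => by
      simp [A.twist_of_mem hg, A.twist_of_mem hf, A.twist_of_mem (A.comp_mem hg hf), sgn_add,
        smul_smul, mul_comm]
  exact congrArg (fun l => l g f) this

theorem twist_d {X Y : A.Obj} (f : A.Hom X Y) : A.twist (A.d f) = -A.d (A.twist f) := by
  have : A.twist ∘ₗ A.d = -(A.d ∘ₗ A.twist : A.Hom X Y →ₗ[k] _) :=
    A.hom_lin_ext fun n f hf => by
      simp [A.twist_of_mem hf, A.twist_of_mem (A.d_mem hf), sgn_succ]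
  exact congrArg (fun l => l f) this

/-- With the operator `twist` in place of the sign of a degree, both sides are bilinear, so the rule
passes from homogeneous morphisms to all of them. Later calculations can then dispense with
homogeneity. -/
theorem d_comp {X Y Z : A.Obj} (g : A.Hom Y Z) (f : A.Hom X Y) :
    A.d (A.comp g f) = A.comp (A.d g) f + A.comp (A.twist g) (A.d f) := by
  have : A.comp.compr₂ A.d = (A.comp (X := X) (Y := Y) (Z := Z)).comp A.d +
      A.comp.compl₁₂ A.twist A.d :=
    A.hom_lin_ext fun m g hg => LinearMap.ext fun f => by
      simp [A.twist_of_mem hg, A.leibniz f hg]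
  exact congrArg (fun l => l g f) this

end DGCat

theorem DGFunctor.map_twist {A B : DGCat k} (F : DGFunctor A B) {X Y : A.Obj} (f : A.Hom X Y) :
    F.map (A.twist f) = B.twist (F.map f) := by
  have : F.map ∘ₗ A.twist = (B.twist ∘ₗ F.map : A.Hom X Y →ₗ[k] _) :=
    A.hom_lin_ext fun n f hf => by
      simp [A.twist_of_mem hf, B.twist_of_mem (F.map_mem hf)]
  exact congrArg (fun l => l f) this

namespace Cyl

variable {A : DGCat k} (a : Gens A) (h : a.IsFree)

/-- This product rule is the model for the homotopy component of a composite in `pathCat`. -/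
theorem tMor_comp' {X Y Z : A.Obj} (g : A.Hom Y Z) (f : A.Hom X Y) :
    tMor a h (A.comp g f) =
      (Cyl A a h).comp (inclMap a h true g) (tMor a h f) +
        (Cyl A a h).comp (tMor a h g) (inclMap a h false (A.twist f)) := by
  have : (tMor a h) ∘ₗ (A.comp g) = (Cyl A a h).comp (inclMap a h true g) ∘ₗ (tMor a h (X := X)) +
      (Cyl A a h).comp (tMor a h g) ∘ₗ (inclMap a h false ∘ₗ A.twist) :=
    A.hom_lin_ext fun n f hf => by
      simp only [LinearMap.comp_apply, LinearMap.add_apply, A.twist_of_mem hf, map_smul]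
      exact tMor_comp a h g hf
  exact congrArg (fun l => l f) this

/-- Solved for the term with `A.d f`, this is the model for the homotopy component of the
differential in `pathCat`. -/
theorem d_tMor' {X Y : A.Obj} (f : A.Hom X Y) :
    (Cyl A a h).d (tMor a h f) =
      (Cyl A a h).comp (inclMap a h true (A.twist f)) (t a h X) -
        (Cyl A a h).comp (t a h Y) (inclMap a h false (A.twist f)) + tMor a h (A.d f) := by
  have : (Cyl A a h).d ∘ₗ (tMor a h) =
      (Cyl A a h).comp.flip (t a h X) ∘ₗ (inclMap a h true ∘ₗ A.twist) -
        (Cyl A a h).comp (t a h Y) ∘ₗ (inclMap a h false ∘ₗ A.twist) +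
          (tMor a h ∘ₗ A.d (X := X) (Y := Y)) :=
    A.hom_lin_ext fun n f hf => by
      simp only [LinearMap.comp_apply, LinearMap.add_apply, LinearMap.sub_apply,
        A.twist_of_mem hf, map_smul]
      refine (d_tMor a h hf).trans ?_
      rw [smul_sub]; rfl
  exact congrArg (fun l => l f) this

end Cyl

end Twist

/-! ### The path object: homotopy equivalences and their morphisms -/

section PathObject

variable {k : Type u} [CommRing k]

/-- A homotopy equivalence in a dg category, with the homotopies that the cylinder records. -/
@[ext]
structure HEquiv (C : DGCat k) where
  src : C.Obj
  tgt : C.Obj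
  t : C.Hom src tgt
  tInv : C.Hom tgt src
  tHat : C.Hom src src
  tCheck : C.Hom tgt tgt
  tBar : C.Hom src tgt
  t_mem : t ∈ C.homDeg _ _ 0
  tInv_mem : tInv ∈ C.homDeg _ _ 0
  tHat_mem : tHat ∈ C.homDeg _ _ (-1)
  tCheck_mem : tCheck ∈ C.homDeg _ _ (-1)
  tBar_mem : tBar ∈ C.homDeg _ _ (-2)
  d_t : C.d t = 0
  d_tInv : C.d tInv = 0
  d_tHat : C.d tHat = C.id src - C.comp tInv t
  d_tCheck : C.d tCheck = C.id tgt - C.comp t tInv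
  d_tBar : C.d tBar = C.comp t tHat - C.comp tCheck t

namespace HEquiv

variable {C : DGCat k}

theorem twist_t (P : HEquiv C) : C.twist P.t = P.t := by
  rw [C.twist_of_mem P.t_mem, sgn_zero, one_smul]

theorem twist_tInv (P : HEquiv C) : C.twist P.tInv = P.tInv := by
  rw [C.twist_of_mem P.tInv_mem, sgn_zero, one_smul]

theorem twist_tHat (P : HEquiv C) : C.twist P.tHat = -P.tHat := by
  rw [C.twist_of_mem P.tHat_mem, sgn_neg_one, neg_one_smul]

theorem twist_tCheck (P : HEquiv C) : C.twist P.tCheck = -P.tCheck := by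
  rw [C.twist_of_mem P.tCheck_mem, sgn_neg_one, neg_one_smul]

theorem twist_tBar (P : HEquiv C) : C.twist P.tBar = P.tBar := by
  rw [C.twist_of_mem P.tBar_mem, show (-2 : ℤ) = -1 - 1 by norm_num, sgn_sub_one, sgn_neg_one,
    neg_neg, one_smul]

variable (C) in
/-- The identity of an object as a homotopy equivalence. -/
def refl (X : C.Obj) : HEquiv C where
  src := X
  tgt := X
  t := C.id X
  tInv := C.id X
  tHat := 0
  tCheck := 0
  tBar := 0
  t_mem := C.id_mem X
  tInv_mem := C.id_mem X
  tHat_mem := zero_mem _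
  tCheck_mem := zero_mem _
  tBar_mem := zero_mem _
  d_t := C.d_id X
  d_tInv := C.d_id X
  d_tHat := by simp [C.id_comp]
  d_tCheck := by simp [C.id_comp]
  d_tBar := by simp

/-- Morphisms of homotopy equivalences: morphisms between sources and between targets and a
homotopy. -/
abbrev Hom (P Q : HEquiv C) : Type u :=
  C.Hom P.src Q.src × C.Hom P.tgt Q.tgt × C.Hom P.src Q.tgt

/-- Composition of morphisms of homotopy equivalences. -/
noncomputable def comp {P Q R : HEquiv C} : Hom Q R →ₗ[k] Hom P Q →ₗ[k] Hom P R :=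
  LinearMap.mk₂ k (fun g f => (C.comp g.1 f.1, C.comp g.2.1 f.2.1,
      C.comp g.2.1 f.2.2 + C.comp g.2.2 (C.twist f.1)))
    (by intros; ext <;> simp; abel) (by intros; ext <;> simp)
    (by intros; ext <;> simp; abel) (by intros; ext <;> simp)

theorem hcomp_apply {P Q R : HEquiv C} (g : Hom Q R) (f : Hom P Q) :
    comp g f = (C.comp g.1 f.1, C.comp g.2.1 f.2.1,
      C.comp g.2.1 f.2.2 + C.comp g.2.2 (C.twist f.1)) := rfl

/-- The differential of morphisms of homotopy equivalences. -/
noncomputable def d {P Q : HEquiv C} : Hom P Q →ₗ[k] Hom P Q where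
  toFun f := (C.d f.1, C.d f.2.1,
    C.d f.2.2 - (C.comp (C.twist f.2.1) P.t - C.comp Q.t (C.twist f.1)))
  map_add' f g := by ext <;> simp; abel
  map_smul' c f := by ext <;> simp [smul_sub]

theorem hd_apply {P Q : HEquiv C} (f : Hom P Q) : d f = (C.d f.1, C.d f.2.1,
    C.d f.2.2 - (C.comp (C.twist f.2.1) P.t - C.comp Q.t (C.twist f.1))) := rfl

/-- The homogeneous parts of the morphisms of homotopy equivalences. -/
def homDeg (P Q : HEquiv C) (n : ℤ) : Submodule k (Hom P Q) :=
  (C.homDeg P.src Q.src n).prod ((C.homDeg P.tgt Q.tgt n).prod (C.homDeg P.src Q.tgt (n - 1)))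

/-- Independence and spanning are inherited from the three components. The last one is shifted: a
homotopy of degree `n` is homogeneous of degree `n + 1` as a morphism of equivalences. -/
theorem homDeg_isInternal (P Q : HEquiv C) : DirectSum.IsInternal (homDeg P Q) := by
  classical
  rw [DirectSum.isInternal_submodule_iff_iSupIndep_and_iSup_eq_top]
  have h1 := (DirectSum.isInternal_submodule_iff_iSupIndep_and_iSup_eq_top _).1
    (C.isInternal P.src Q.src)
  have h2 := (DirectSum.isInternal_submodule_iff_iSupIndep_and_iSup_eq_top _).1
    (C.isInternal P.tgt Q.tgt)
  have h3 := (DirectSum.isInternal_submodule_iff_iSupIndep_and_iSup_eq_top _).1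
    (C.isInternal P.src Q.tgt)
  constructor
  · intro n
    rw [Submodule.disjoint_def]
    intro x hx hx'
    have hle : (⨆ m, ⨆ (_ : m ≠ n), homDeg P Q m) ≤
        (⨆ m, ⨆ (_ : m ≠ n), C.homDeg P.src Q.src m).prod
          ((⨆ m, ⨆ (_ : m ≠ n), C.homDeg P.tgt Q.tgt m).prod
            (⨆ m, ⨆ (_ : m ≠ n - 1), C.homDeg P.src Q.tgt m)) := by
      refine iSup₂_le fun m hm => ?_
      rintro y ⟨y1, y2, y3⟩
      exact ⟨Submodule.mem_iSup_of_mem m (Submodule.mem_iSup_of_mem hm y1),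
        Submodule.mem_iSup_of_mem m (Submodule.mem_iSup_of_mem hm y2),
        Submodule.mem_iSup_of_mem (m - 1) (Submodule.mem_iSup_of_mem (by omega) y3)⟩
    obtain ⟨y1, y2, y3⟩ := hle hx'
    exact Prod.ext (Submodule.disjoint_def.1 (h1.1 n) _ hx.1 y1)
      (Prod.ext (Submodule.disjoint_def.1 (h2.1 n) _ hx.2.1 y2)
        (Submodule.disjoint_def.1 (h3.1 (n - 1)) _ hx.2.2 y3))
  · rw [eq_top_iff]
    rintro ⟨x, y, z⟩ -
    have hx : x ∈ (⨆ n, homDeg P Q n).comap (LinearMap.inl k _ _) := by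
      have : x ∈ ⨆ n, C.homDeg P.src Q.src n := by rw [h1.2]; trivial
      refine (iSup_le fun n => ?_ : (⨆ n, C.homDeg P.src Q.src n) ≤ _) this
      exact fun x hx => Submodule.mem_iSup_of_mem n ⟨hx, zero_mem _, zero_mem _⟩
    have hy : y ∈ (⨆ n, homDeg P Q n).comap (LinearMap.inr k _ _ ∘ₗ LinearMap.inl k _ _) := by
      have : y ∈ ⨆ n, C.homDeg P.tgt Q.tgt n := by rw [h2.2]; trivial
      refine (iSup_le fun n => ?_ : (⨆ n, C.homDeg P.tgt Q.tgt n) ≤ _) this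
      exact fun x hx => Submodule.mem_iSup_of_mem n ⟨zero_mem _, hx, zero_mem _⟩
    have hz : z ∈ (⨆ n, homDeg P Q n).comap (LinearMap.inr k _ _ ∘ₗ LinearMap.inr k _ _) := by
      have : z ∈ ⨆ n, C.homDeg P.src Q.tgt n := by rw [h3.2]; trivial
      refine (iSup_le fun n => ?_ : (⨆ n, C.homDeg P.src Q.tgt n) ≤ _) this
      exact fun x hx => Submodule.mem_iSup_of_mem (n + 1)
        ⟨zero_mem _, zero_mem _, by simpa using hx⟩
    have := add_mem (add_mem (Submodule.mem_comap.1 hx) (Submodule.mem_comap.1 hy))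
      (Submodule.mem_comap.1 hz)
    simpa using this

end HEquiv

open HEquiv in
/-- The dg category of homotopy equivalences in `C`. -/
noncomputable abbrev pathCat (C : DGCat k) : DGCat k where
  Obj := HEquiv C
  Hom := HEquiv.Hom
  id P := (C.id P.src, C.id P.tgt, 0)
  comp := HEquiv.comp
  id_comp f := by simp [hcomp_apply, C.id_comp]
  comp_id f := by simp [hcomp_apply, C.comp_id]
  assoc h g f := by
    simp [hcomp_apply, C.assoc, C.twist_comp, add_assoc]
  homDeg := HEquiv.homDeg
  isInternal := homDeg_isInternal
  id_mem P := ⟨C.id_mem _, C.id_mem _, zero_mem _⟩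
  comp_mem := by
    rintro P Q R m n g f ⟨g1, g2, g3⟩ ⟨f1, f2, f3⟩
    refine ⟨C.comp_mem g1 f1, C.comp_mem g2 f2, add_mem ?_ ?_⟩
    · have := C.comp_mem g2 f3
      rwa [← add_sub_assoc] at this
    · have := C.comp_mem g3 (C.twist_mem f1)
      rwa [sub_add_eq_add_sub] at this
  d := HEquiv.d
  d_mem := by
    rintro P Q n f ⟨f1, f2, f3⟩
    refine ⟨C.d_mem f1, C.d_mem f2, sub_mem ?_ (sub_mem ?_ ?_)⟩
    · have := C.d_mem f3
      rwa [sub_add_eq_add_sub] at this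
    · have := C.comp_mem (C.twist_mem f2) P.t_mem
      simpa using this
    · have := C.comp_mem Q.t_mem (C.twist_mem f1)
      simpa using this
  d_d := by
    -- In the homotopy component the corrections cancel because `twist` anticommutes with `d` and
    -- because `P.t` and `Q.t` are closed.
    intro P Q f
    simp only [hd_apply, C.d_d, map_sub, C.d_comp, C.twist_d, C.twist_twist, P.d_t, Q.d_t, map_zero,
      LinearMap.zero_apply, map_neg, LinearMap.neg_apply, add_zero, zero_add, Q.twist_t]
    refine Prod.ext rfl (Prod.ext rfl ?_)
    change _ = (0 : C.Hom P.src Q.tgt)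
    simp only
    abel
  leibniz := by
    -- In the homotopy component the two terms that pass through the middle equivalence `Q.t`
    -- cancel; all others match one by one.
    rintro P Q R m g f hg
    obtain ⟨g1, g2, g3⟩ := hg
    simp only [hcomp_apply, hd_apply, C.d_comp, C.twist_comp, C.twist_d, map_add,
      map_sub, LinearMap.sub_apply, C.assoc, C.twist_of_mem g1, C.twist_of_mem g2,
      C.twist_of_mem g3, sgn_sub_one, map_smul, LinearMap.smul_apply, neg_smul, map_neg,
      LinearMap.neg_apply]
    ext
    · simp
    · simp
    · simp only [Prod.snd_add, Prod.smul_snd, smul_add, smul_sub, smul_neg]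
      abel

end PathObject

/-! ### Functors on the cylinder as functors to the path object -/

section Adjunction

variable {k : Type u} [CommRing k]

/-- The source functor of the category of homotopy equivalences. -/
noncomputable abbrev pathSrc (C : DGCat k) : pathCat C ⟶ C where
  obj P := P.src
  map := LinearMap.fst k _ _
  map_id _ := rfl
  map_comp _ _ := rfl
  map_mem h := h.1
  map_d _ := rfl

/-- The target functor of the category of homotopy equivalences. -/
noncomputable abbrev pathTgt (C : DGCat k) : pathCat C ⟶ C where
  obj P := P.tgt
  map := LinearMap.fst k _ _ ∘ₗ LinearMap.snd k _ _
  map_id _ := rfl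
  map_comp _ _ := rfl
  map_mem h := h.2.1
  map_d _ := rfl

/-- The two ends of a homotopy equivalence. -/
noncomputable def pathEnd (C : DGCat k) : Bool → (pathCat C ⟶ C)
  | false => pathSrc C
  | true => pathTgt C

namespace Cyl

variable {A B C : DGCat k} (a : Gens A) (h : a.IsFree) (b : Gens B) (hb : b.IsFree)

theorem inclMap_gen (r : Bool) {X Y : A.Obj} (e : a.E X Y) :
    inclMap a h r (a.gen e) = edge k (.incl r e) :=
  (congrArg (iL r) (a.inv_gen h e)).trans (iL_edge r e)

theorem tMor_gen {X Y : A.Obj} (e : a.E X Y) : tMor a h (a.gen e) = edge k (.tGen e) :=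
  (congrArg (tL a.deg) (a.inv_gen h e)).trans (tL_edge a.deg e)

/-- The homotopy equivalence `t_X` in the cylinder. -/
noncomputable def hequiv (X : A.Obj) : HEquiv (Cyl A a h) where
  src := (X, false)
  tgt := (X, true)
  t := t a h X
  tInv := tInv a h X
  tHat := tHat a h X
  tCheck := tCheck a h X
  tBar := tBar a h X
  t_mem := edge_mem_fdeg (cylDeg a.deg) (.t X)
  tInv_mem := edge_mem_fdeg (cylDeg a.deg) (.tInv X)
  tHat_mem := edge_mem_fdeg (cylDeg a.deg) (.tHat X)
  tCheck_mem := edge_mem_fdeg (cylDeg a.deg) (.tCheck X)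
  tBar_mem := edge_mem_fdeg (cylDeg a.deg) (.tBar X)
  d_t := d_edge a h (.t X)
  d_tInv := d_edge a h (.tInv X)
  d_tHat := d_edge a h (.tHat X)
  d_tCheck := d_edge a h (.tCheck X)
  d_tBar := d_edge a h (.tBar X)

end Cyl

/-- The image of a homotopy equivalence under a dg functor. -/
noncomputable abbrev HEquiv.mapObj {C D : DGCat k} (F : C ⟶ D) (P : HEquiv C) : HEquiv D where
  src := F.obj P.src
  tgt := F.obj P.tgt
  t := F.map P.t
  tInv := F.map P.tInv
  tHat := F.map P.tHat
  tCheck := F.map P.tCheck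
  tBar := F.map P.tBar
  t_mem := F.map_mem P.t_mem
  tInv_mem := F.map_mem P.tInv_mem
  tHat_mem := F.map_mem P.tHat_mem
  tCheck_mem := F.map_mem P.tCheck_mem
  tBar_mem := F.map_mem P.tBar_mem
  d_t := by rw [← F.map_d, P.d_t, map_zero]
  d_tInv := by rw [← F.map_d, P.d_tInv, map_zero]
  d_tHat := by rw [← F.map_d, P.d_tHat, map_sub, F.map_id, F.map_comp]
  d_tCheck := by rw [← F.map_d, P.d_tCheck, map_sub, F.map_id, F.map_comp]
  d_tBar := by rw [← F.map_d, P.d_tBar, map_sub, F.map_comp, F.map_comp]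

namespace Cyl

variable {A B C : DGCat k} (a : Gens A) (h : a.IsFree) (b : Gens B) (hb : b.IsFree)

/-- The dg functor to homotopy equivalences that corresponds to a dg functor on the cylinder. -/
noncomputable def flat (K : Cyl A a h ⟶ C) : A ⟶ pathCat C where
  obj X := (hequiv a h X).mapObj K
  map {X Y} := (K.map ∘ₗ inclMap a h false).prod
    ((K.map ∘ₗ inclMap a h true).prod (K.map ∘ₗ tMor a h))
  map_id X := by
    refine Prod.ext ?_ (Prod.ext ?_ ?_)
    · exact (congrArg K.map (inclMap_id a h false X)).trans (K.map_id _)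
    · exact (congrArg K.map (inclMap_id a h true X)).trans (K.map_id _)
    · exact (congrArg K.map (tMor_id a h X)).trans (map_zero _)
  map_comp g f := by
    refine Prod.ext ?_ (Prod.ext ?_ ?_)
    · exact (congrArg K.map (inclMap_comp a h false g f)).trans (K.map_comp _ _)
    · exact (congrArg K.map (inclMap_comp a h true g f)).trans (K.map_comp _ _)
    · refine (congrArg K.map (tMor_comp' a h g f)).trans ((map_add _ _ _).trans ?_)
      refine congrArg₂ (· + ·) (K.map_comp _ _) ((K.map_comp _ _).trans ?_)
      refine congrArg _ ?_
      exact ((K.map_twist _).symm.trans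
        (congrArg K.map ((incl a h false).map_twist f).symm)).symm
  map_mem hf := ⟨K.map_mem (inclMap_mem a h false hf), K.map_mem (inclMap_mem a h true hf),
    K.map_mem (tMor_mem a h hf)⟩
  map_d {X Y} f := by
    refine Prod.ext ?_ (Prod.ext ?_ ?_)
    · exact (congrArg K.map (inclMap_d a h false f)).trans (K.map_d _)
    · exact (congrArg K.map (inclMap_d a h true f)).trans (K.map_d _)
    · have h1 := congrArg K.map (d_tMor' a h f)
      rw [map_add, map_sub, K.map_d] at h1
      refine (eq_sub_of_add_eq' h1.symm).trans ?_
      refine congrArg₂ (· - ·) rfl (congrArg₂ (· - ·) ?_ ?_)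
      · refine (K.map_comp _ _).trans ?_
        exact congrArg (fun z => C.comp z (K.map (t a h X)))
          ((congrArg K.map ((incl a h true).map_twist f)).trans (K.map_twist _))
      · refine (K.map_comp _ _).trans ?_
        exact congrArg (C.comp (K.map (t a h Y)))
          ((congrArg K.map ((incl a h false).map_twist f)).trans (K.map_twist _))

section Sharp

variable (N : A ⟶ pathCat C)

/-- The values of `sharp` on objects. -/
def sharpObj : A.Obj × Bool → C.Obj
  | (X, false) => (N.obj X).src
  | (X, true) => (N.obj X).tgt

/-- The values of `sharp` on edges. -/
noncomputable def sharpE : ∀ ⦃P Q : A.Obj × Bool⦄, CylE a.E P Q → C.Hom (sharpObj N P) (sharpObj N Q)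
  | _, _, .incl false e => (N.map (a.gen e)).1
  | _, _, .incl true e => (N.map (a.gen e)).2.1
  | _, _, .t X => (N.obj X).t
  | _, _, .tInv X => (N.obj X).tInv
  | _, _, .tHat X => (N.obj X).tHat
  | _, _, .tCheck X => (N.obj X).tCheck
  | _, _, .tBar X => (N.obj X).tBar
  | _, _, .tGen e => (N.map (a.gen e)).2.2

/-- The linear extension of `sharpE`. -/
noncomputable def sharpL {P Q : A.Obj × Bool} : FHom k (CylE a.E) P Q →ₗ[k]
    C.Hom (sharpObj N P) (sharpObj N Q) :=
  evL C (sharpObj N) (sharpE a N)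

theorem sharpL_edge {P Q : A.Obj × Bool} (e : CylE a.E P Q) :
    sharpL a N (edge k e) = sharpE a N e := evL_edge _ _ _ e

theorem sharpL_fcomp {P Q R : A.Obj × Bool} (y : FHom k (CylE a.E) Q R)
    (x : FHom k (CylE a.E) P Q) :
    sharpL a N (fcomp y x) = C.comp (sharpL a N y) (sharpL a N x) :=
  evL_fcomp _ _ _ y x

theorem sharpL_nil (P : A.Obj × Bool) :
    sharpL a N (pt k (.nil P)) = C.id _ := evL_nil _ _ _ P

/-- Both sides are multiplicative along a path and agree on edges by definition. The same induction
handles the other end and, with the product rule for `t`, the homotopy part. -/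
theorem sharpL_iL_false {X Y : A.Obj} (x : FHom k a.E X Y) :
    sharpL a N (iL false x) = (N.map (a.lin x)).1 := by
  have key : ∀ {Y : A.Obj} (p : QPath a.E X Y),
      sharpL a N (iL false (pt k p)) = (N.map (a.lin (pt k p))).1 := by
    intro Y p
    induction p with
    | nil =>
      rw [iL_pt, iPath, sharpL_nil, Gens.lin_nil, N.map_id]
      rfl
    | cons e p ih =>
      rw [pt_cons, iL_fcomp, sharpL_fcomp, ih, iL_edge, sharpL_edge, Gens.lin_fcomp, Gens.lin_edge,
        N.map_comp]
      rfl
  have : (sharpL a N).comp (iL false) =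
      (LinearMap.fst k _ _ ∘ₗ N.map).comp (a.lin (X := X) (Y := Y)) := FHom.hom_ext key
  exact congrArg (fun l => l x) this

theorem sharpL_iL_true {X Y : A.Obj} (x : FHom k a.E X Y) :
    sharpL a N (iL true x) = (N.map (a.lin x)).2.1 := by
  have key : ∀ {Y : A.Obj} (p : QPath a.E X Y),
      sharpL a N (iL true (pt k p)) = (N.map (a.lin (pt k p))).2.1 := by
    intro Y p
    induction p with
    | nil =>
      rw [iL_pt, iPath, sharpL_nil, Gens.lin_nil, N.map_id]
      rfl
    | cons e p ih =>
      rw [pt_cons, iL_fcomp, sharpL_fcomp, ih, iL_edge, sharpL_edge, Gens.lin_fcomp, Gens.lin_edge,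
        N.map_comp]
      rfl
  have : (sharpL a N).comp (iL true) =
      ((LinearMap.fst k _ _ ∘ₗ LinearMap.snd k _ _) ∘ₗ N.map).comp (a.lin (X := X) (Y := Y)) :=
    FHom.hom_ext key
  exact congrArg (fun l => l x) this

theorem sharpL_tL {X Y : A.Obj} (x : FHom k a.E X Y) :
    sharpL a N (tL a.deg x) = (N.map (a.lin x)).2.2 := by
  have key : ∀ {Y : A.Obj} (p : QPath a.E X Y),
      sharpL a N (tL a.deg (pt k p)) = (N.map (a.lin (pt k p))).2.2 := by
    intro Y p
    induction p with
    | nil =>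
      rw [tL_pt, tPath, map_zero, Gens.lin_nil, N.map_id]
      rfl
    | cons e p ih =>
      -- A path is homogeneous, so the twist in the product rule for `tL` is a sign and agrees with
      -- the twist in `C`.
      have hp : (N.map (a.lin (twist k a.deg (pt k p)))).1 = C.twist (N.map (a.lin (pt k p))).1 := by
        rw [twist_pt, C.twist_of_mem (N.map_mem (a.lin_mem (pt_mem_fdeg a.deg p))).1, map_smul,
          map_smul]
        rfl
      rw [pt_cons, tL_fcomp, map_add, sharpL_fcomp, sharpL_fcomp, ih, iL_edge, tL_edge,
        sharpL_edge, sharpL_edge, sharpL_iL_false, hp, Gens.lin_fcomp, Gens.lin_edge,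
        N.map_comp]
      rfl
  have : (sharpL a N).comp (tL a.deg) =
      ((LinearMap.snd k _ _ ∘ₗ LinearMap.snd k _ _) ∘ₗ N.map).comp (a.lin (X := X) (Y := Y)) :=
    FHom.hom_ext key
  exact congrArg (fun l => l x) this

/-- The dg functor on the cylinder that corresponds to a dg functor to homotopy equivalences. -/
noncomputable def sharp : Cyl A a h ⟶ C :=
  freeDGLift (cylDeg a.deg) (cylδ a.deg (a.δ h)) C (sharpObj N)
    (sharpE a N) (cylδ_mem a.deg (a.δ h) (a.δ_mem h))
    (fd_cylδ a.deg (a.δ h) (a.δ_mem h) (a.fd_δ h))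
    (by
      intro P Q e
      cases e with
      | incl r e =>
        cases r
        · exact (N.map_mem (a.gen_mem e)).1
        · exact (N.map_mem (a.gen_mem e)).2.1
      | t X => exact (N.obj X).t_mem
      | tInv X => exact (N.obj X).tInv_mem
      | tHat X => exact (N.obj X).tHat_mem
      | tCheck X => exact (N.obj X).tCheck_mem
      | tBar X => exact (N.obj X).tBar_mem
      | tGen e => exact (N.map_mem (a.gen_mem e)).2.2)
    (by
      intro P Q e
      change sharpL a N _ = _
      cases e with
      | incl r e =>
        cases r
        · rw [cylδ, sharpL_iL_false, Gens.δ, Gens.lin_inv, N.map_d]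
          rfl
        · rw [cylδ, sharpL_iL_true, Gens.δ, Gens.lin_inv, N.map_d]
          rfl
      | t X => rw [cylδ, map_zero]; exact (N.obj X).d_t.symm
      | tInv X => rw [cylδ, map_zero]; exact (N.obj X).d_tInv.symm
      | tHat X =>
        rw [cylδ, map_sub, sharpL_fcomp, sharpL_nil, sharpL_edge, sharpL_edge]
        exact (N.obj X).d_tHat.symm
      | tCheck X =>
        rw [cylδ, map_sub, sharpL_fcomp, sharpL_nil, sharpL_edge, sharpL_edge]
        exact (N.obj X).d_tCheck.symm
      | tBar X =>
        rw [cylδ, map_sub, sharpL_fcomp, sharpL_fcomp, sharpL_edge, sharpL_edge, sharpL_edge]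
        exact (N.obj X).d_tBar.symm
      | @tGen X Y e =>
        -- Compatibility of `N` with `d`, read in the homotopy component, is the relation defining
        -- `d t_e` after the corrections are moved to the other side.
        have h1 : (N.map (A.d (a.gen e))).2.2 = C.d (N.map (a.gen e)).2.2 -
            (C.comp (C.twist (N.map (a.gen e)).2.1) (N.obj X).t -
              C.comp (N.obj Y).t (C.twist (N.map (a.gen e)).1)) :=
          congrArg (fun z => z.2.2) (N.map_d (a.gen e))
        rw [C.twist_of_mem (N.map_mem (a.gen_mem e)).1,
          C.twist_of_mem (N.map_mem (a.gen_mem e)).2.1] at h1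
        rw [cylδ, map_add, map_smul, map_sub, sharpL_fcomp, sharpL_fcomp, sharpL_edge, sharpL_edge,
          sharpL_edge, sharpL_edge, sharpL_tL, Gens.δ, Gens.lin_inv, h1, map_smul, map_smul,
          smul_sub]
        exact add_sub_cancel _ _)

theorem sharp_incl_false {X Y : A.Obj} (f : A.Hom X Y) :
    (sharp a h N).map (inclMap a h false f) = (N.map f).1 :=
  (sharpL_iL_false a N (a.inv h f)).trans (by rw [Gens.lin_inv])

theorem sharp_incl_true {X Y : A.Obj} (f : A.Hom X Y) :
    (sharp a h N).map (inclMap a h true f) = (N.map f).2.1 :=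
  (sharpL_iL_true a N (a.inv h f)).trans (by rw [Gens.lin_inv])

theorem sharp_tMor {X Y : A.Obj} (f : A.Hom X Y) :
    (sharp a h N).map (tMor a h f) = (N.map f).2.2 :=
  (sharpL_tL a N (a.inv h f)).trans (by rw [Gens.lin_inv])

theorem sharp_t (X : A.Obj) : (sharp a h N).map (t a h X) = (N.obj X).t := sharpL_edge a N _

theorem sharp_tInv (X : A.Obj) : (sharp a h N).map (tInv a h X) = (N.obj X).tInv :=
  sharpL_edge a N _

theorem sharp_tHat (X : A.Obj) : (sharp a h N).map (tHat a h X) = (N.obj X).tHat :=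
  sharpL_edge a N _

theorem sharp_tCheck (X : A.Obj) : (sharp a h N).map (tCheck a h X) = (N.obj X).tCheck :=
  sharpL_edge a N _

theorem sharp_tBar (X : A.Obj) : (sharp a h N).map (tBar a h X) = (N.obj X).tBar :=
  sharpL_edge a N _

/-- This is what turns homotopy extension at `i_r` into a lifting problem against the end projection
`pathEnd C r`. -/
theorem incl_sharp (r : Bool) : incl a h r ≫ sharp a h N = N ≫ pathEnd C r := by
  cases r
  · exact DGFunctor.hext rfl fun _ _ f => heq_of_eq (sharp_incl_false a h N f)
  · exact DGFunctor.hext rfl fun _ _ f => heq_of_eq (sharp_incl_true a h N f)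

end Sharp

/-- A functor on the cylinder is determined by its edges, and `flat` records all of them: the five
edges of a vertex as the value on an object, the others as the three components of the value on a
generator. -/
theorem flat_injective : Function.Injective (flat a h (C := C)) := by
  intro K L hKL
  have hobj : ∀ X, (hequiv a h X).mapObj K = (hequiv a h X).mapObj L := fun X =>
    congrArg (fun N : A ⟶ pathCat C => N.obj X) hKL
  have hmap : ∀ {X Y : A.Obj} (f : A.Hom X Y), (flat a h K).map f ≍ (flat a h L).map f := by
    intro X Y f; rw [hKL]
  have ho : K.obj = L.obj := by
    funext ⟨X, r⟩
    cases r
    · exact congrArg HEquiv.src (hobj X)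
    · exact congrArg HEquiv.tgt (hobj X)
  obtain ⟨o, m, m1, m2, m3, m4⟩ := K
  obtain ⟨o', m', m1', m2', m3', m4'⟩ := L
  obtain rfl : o = o' := ho
  refine hom_ext a h rfl fun P Q e => heq_of_eq ?_
  cases e with
  | @incl X Y r e =>
    have := eq_of_heq (hmap (a.gen e))
    rw [← inclMap_gen a h]
    cases r
    · exact congrArg Prod.fst this
    · exact congrArg (fun z => z.2.1) this
  | @tGen X Y e =>
    have := eq_of_heq (hmap (a.gen e))
    rw [← tMor_gen a h]
    exact congrArg (fun z => z.2.2) this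
  | t X =>
    have := hobj X
    simp only [HEquiv.mapObj, HEquiv.mk.injEq] at this
    exact eq_of_heq this.2.2.1
  | tInv X =>
    have := hobj X
    simp only [HEquiv.mapObj, HEquiv.mk.injEq] at this
    exact eq_of_heq this.2.2.2.1
  | tHat X =>
    have := hobj X
    simp only [HEquiv.mapObj, HEquiv.mk.injEq] at this
    exact eq_of_heq this.2.2.2.2.1
  | tCheck X =>
    have := hobj X
    simp only [HEquiv.mapObj, HEquiv.mk.injEq] at this
    exact eq_of_heq this.2.2.2.2.2.1
  | tBar X =>
    have := hobj X
    simp only [HEquiv.mapObj, HEquiv.mk.injEq] at this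
    exact eq_of_heq this.2.2.2.2.2.2

/-- Together with `flat_injective` this makes `flat` and `sharp` mutually inverse. -/
theorem flat_sharp (N : A ⟶ pathCat C) : flat a h (sharp a h N) = N :=
  DGFunctor.hext
    (funext fun X => HEquiv.ext rfl rfl (heq_of_eq (sharp_t a h N X))
      (heq_of_eq (sharp_tInv a h N X)) (heq_of_eq (sharp_tHat a h N X))
      (heq_of_eq (sharp_tCheck a h N X)) (heq_of_eq (sharp_tBar a h N X)))
    fun _ _ f => heq_of_eq (Prod.ext (sharp_incl_false a h N f)
      (Prod.ext (sharp_incl_true a h N f) (sharp_tMor a h N f)))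

/-- Naturality of the correspondence in the source: `Cyl(F)` carries each `t_X` to `t_{F(X)}` and
each `t_θ` to `t_{F(θ)}`, so transposition turns precomposition with it into precomposition with
`F`. -/
theorem flat_map_comp (F : A ⟶ B) (K : Cyl B b hb ⟶ C) :
    flat a h (map a h b hb F ≫ K) = F ≫ flat b hb K :=
  DGFunctor.hext
    (funext fun X => HEquiv.ext rfl rfl
      (heq_of_eq (congrArg K.map (map_map_edge a h b hb F (.t X))))
      (heq_of_eq (congrArg K.map (map_map_edge a h b hb F (.tInv X))))
      (heq_of_eq (congrArg K.map (map_map_edge a h b hb F (.tHat X))))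
      (heq_of_eq (congrArg K.map (map_map_edge a h b hb F (.tCheck X))))
      (heq_of_eq (congrArg K.map (map_map_edge a h b hb F (.tBar X)))))
    fun _ _ f => heq_of_eq (Prod.ext (congrArg K.map (map_map_incl a h b hb F false f))
      (Prod.ext (congrArg K.map (map_map_incl a h b hb F true f))
        (congrArg K.map (map_map_tMor a h b hb F f))))

theorem map_comp_sharp (F : A ⟶ B) (N : B ⟶ pathCat C) :
    map a h b hb F ≫ sharp b hb N = sharp a h (F ≫ N) :=
  flat_injective a h (by rw [flat_map_comp, flat_sharp, flat_sharp])

/-- The cylinder preserves pushouts. -/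
theorem isPushout_map {A B C D : DGCat k} (a : Gens A) (h : a.IsFree) (b : Gens B) (hb : b.IsFree)
    (c : Gens C) (hc : c.IsFree) (d : Gens D) (hd : d.IsFree) {F : A ⟶ B} {G : A ⟶ C}
    {G' : B ⟶ D} {F' : C ⟶ D} (sq : IsPushout F G G' F') :
    IsPushout (map a h b hb F) (map a h c hc G) (map b hb d hd G') (map c hc d hd F') := by
  -- The functor out of the cylinder on `D` is the transpose of one induced from `D` to a path
  -- category. As `pathCat` of a dg category need not be semifree, the given square has to be a
  -- pushout among all dg categories.
  refine ⟨⟨?_⟩, ⟨Limits.PushoutCocone.IsColimit.mk _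
    (fun s => sharp d hd (sq.desc (flat b hb s.inl) (flat c hc s.inr) ?_)) ?_ ?_ ?_⟩⟩
  · rw [← map_comp, ← map_comp, sq.w]
  · rw [← flat_map_comp a h, ← flat_map_comp a h, s.condition]
  · intro s
    apply flat_injective
    rw [flat_map_comp, flat_sharp, sq.inl_desc]
  · intro s
    apply flat_injective
    rw [flat_map_comp, flat_sharp, sq.inr_desc]
  · intro s m h1 h2
    apply flat_injective
    rw [flat_sharp]
    apply sq.hom_ext
    · rw [sq.inl_desc, ← flat_map_comp, h1]
    · rw [sq.inr_desc, ← flat_map_comp, h2]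

end Cyl

end Adjunction

/-! ### Transposing squares of homotopy equivalences -/

section Swap

variable {k : Type u} [CommRing k]

/-- The sign on the homotopy component comes from its degree being one less than that of the triple.
-/
theorem pathCat_twist {C : DGCat k} {P Q : HEquiv C} (f : HEquiv.Hom P Q) :
    (pathCat C).twist (X := P) (Y := Q) f =
      (C.twist f.1, C.twist f.2.1, -C.twist f.2.2) := by
  have : (pathCat C).twist (X := P) (Y := Q) =
      (C.twist ∘ₗ LinearMap.fst k _ _).prod
        ((C.twist ∘ₗ LinearMap.fst k _ _ ∘ₗ LinearMap.snd k _ _).prod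
          (-(C.twist ∘ₗ LinearMap.snd k _ _ ∘ₗ LinearMap.snd k _ _))) := by
    refine (pathCat C).hom_lin_ext fun n f hf => ?_
    rw [(pathCat C).twist_of_mem hf]
    obtain ⟨h1, h2, h3⟩ := hf
    simp [C.twist_of_mem h1, C.twist_of_mem h2, C.twist_of_mem h3, sgn_sub_one]
    rfl
  exact congrArg (fun l => l f) this

namespace HEquiv

variable {C : DGCat k}

section Square

/-! A closed morphism of degree `0` of homotopy equivalences is a homotopy commutative square. The
square extends to a homotopy commutative square on the homotopy inverses, and so on. -/

variable {P Q : HEquiv C} (f : C.Hom P.src Q.src) (g : C.Hom P.tgt Q.tgt) (τ : C.Hom P.src Q.tgt)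

/-- The homotopy for the square of homotopy inverses. -/
def sqInv : C.Hom P.tgt Q.src :=
  C.comp Q.tInv (C.comp τ P.tInv) - C.comp Q.tHat (C.comp f P.tInv) +
    C.comp Q.tInv (C.comp g P.tCheck)

/-- The component of the interchange at `tHat`. -/
def sqHat : C.Hom P.src Q.src :=
  -C.comp Q.tInv (C.comp τ P.tHat) + C.comp Q.tHat (C.comp f P.tHat) +
    C.comp Q.tInv (C.comp g P.tBar)

/-- The component of the interchange at `tCheck`. -/
def sqCheck : C.Hom P.tgt Q.tgt :=
  C.comp Q.tCheck (C.comp τ P.tInv) + C.comp Q.tCheck (C.comp g P.tCheck) +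
    C.comp Q.tBar (C.comp f P.tInv)

/-- The component of the interchange at `tBar`. -/
def sqBar : C.Hom P.src Q.tgt :=
  C.comp Q.tCheck (C.comp τ P.tHat) + C.comp Q.tBar (C.comp f P.tHat) -
    C.comp Q.tCheck (C.comp g P.tBar)

variable {f g τ} (hf : f ∈ C.homDeg _ _ 0) (hg : g ∈ C.homDeg _ _ 0) (hτ : τ ∈ C.homDeg _ _ (-1))
include hf hg hτ

theorem sqInv_mem : sqInv f g τ ∈ C.homDeg _ _ (-1) :=
  add_mem (sub_mem (C.comp_mem Q.tInv_mem (C.comp_mem hτ P.tInv_mem))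
    (C.comp_mem Q.tHat_mem (C.comp_mem hf P.tInv_mem)))
    (C.comp_mem Q.tInv_mem (C.comp_mem hg P.tCheck_mem))

theorem sqHat_mem : sqHat f g τ ∈ C.homDeg _ _ (-2) :=
  add_mem (add_mem (neg_mem (C.comp_mem Q.tInv_mem (C.comp_mem hτ P.tHat_mem)))
    (C.comp_mem Q.tHat_mem (C.comp_mem hf P.tHat_mem)))
    (C.comp_mem Q.tInv_mem (C.comp_mem hg P.tBar_mem))

theorem sqCheck_mem : sqCheck f g τ ∈ C.homDeg _ _ (-2) :=
  add_mem (add_mem (C.comp_mem Q.tCheck_mem (C.comp_mem hτ P.tInv_mem))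
    (C.comp_mem Q.tCheck_mem (C.comp_mem hg P.tCheck_mem)))
    (C.comp_mem Q.tBar_mem (C.comp_mem hf P.tInv_mem))

theorem sqBar_mem : sqBar f g τ ∈ C.homDeg _ _ (-3) :=
  sub_mem (add_mem (C.comp_mem Q.tCheck_mem (C.comp_mem hτ P.tHat_mem))
    (C.comp_mem Q.tBar_mem (C.comp_mem hf P.tHat_mem)))
    (C.comp_mem Q.tCheck_mem (C.comp_mem hg P.tBar_mem))

variable (df : C.d f = 0) (dg : C.d g = 0) (dτ : C.d τ = C.comp g P.t - C.comp Q.t f)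
include df dg dτ

/-- Each summand deforms one step: `d τ` moves from `t' g t t'` to `t' t f t'`, and the two others
remove `t t'` at the start and `t' t` at the end. -/
theorem d_sqInv : C.d (sqInv f g τ) = C.comp Q.tInv g - C.comp f P.tInv := by
  have tf : C.twist f = f := by rw [C.twist_of_mem hf, sgn_zero, one_smul]
  have tg : C.twist g = g := by rw [C.twist_of_mem hg, sgn_zero, one_smul]
  have tτ : C.twist τ = -τ := by rw [C.twist_of_mem hτ, sgn_neg_one, neg_one_smul]
  simp only [sqInv, C.d_comp, map_add, map_sub, map_neg, df, dg, dτ, tf, tg, tτ, P.d_tInv, P.d_tCheck,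
    Q.d_tInv, Q.d_tHat, Q.twist_tInv, Q.twist_tHat, map_zero, LinearMap.zero_apply,
    LinearMap.sub_apply, C.assoc, C.comp_id, C.id_comp]
  abel

/-- The right-hand side is what the relation `d t̂ = 1 - t' t` for triples demands of the homotopy
component, and it is used in that form in `swap`. The statements for `sqCheck` and `sqBar` have the
same role for `ť` and `t̄`. -/
theorem d_sqHat : C.d (sqHat f g τ) =
    C.comp Q.tInv τ - C.comp (sqInv f g τ) P.t - C.comp Q.tHat f + C.comp f P.tHat := by
  have tf : C.twist f = f := by rw [C.twist_of_mem hf, sgn_zero, one_smul]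
  have tg : C.twist g = g := by rw [C.twist_of_mem hg, sgn_zero, one_smul]
  have tτ : C.twist τ = -τ := by rw [C.twist_of_mem hτ, sgn_neg_one, neg_one_smul]
  simp only [sqInv, sqHat, C.d_comp, map_add, map_sub, map_neg, df, dg, dτ, tf, tg, tτ, P.d_tHat,
    P.d_tBar, Q.d_tInv, Q.d_tHat, Q.twist_tInv, Q.twist_tHat, map_zero, LinearMap.zero_apply,
    LinearMap.add_apply, LinearMap.sub_apply, LinearMap.neg_apply, C.assoc, C.comp_id, C.id_comp]
  abel

theorem d_sqCheck : C.d (sqCheck f g τ) =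
    C.comp τ P.tInv - C.comp Q.t (sqInv f g τ) - C.comp Q.tCheck g + C.comp g P.tCheck := by
  have tf : C.twist f = f := by rw [C.twist_of_mem hf, sgn_zero, one_smul]
  have tg : C.twist g = g := by rw [C.twist_of_mem hg, sgn_zero, one_smul]
  have tτ : C.twist τ = -τ := by rw [C.twist_of_mem hτ, sgn_neg_one, neg_one_smul]
  simp only [sqInv, sqCheck, C.d_comp, map_add, map_sub, map_neg, df, dg, dτ, tf, tg, tτ, P.d_tInv,
    P.d_tCheck, Q.d_tCheck, Q.d_tBar, Q.twist_tCheck, Q.twist_tBar, map_zero, LinearMap.zero_apply,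
    LinearMap.sub_apply, LinearMap.neg_apply, C.assoc, C.comp_id, C.id_comp]
  abel

theorem d_sqBar : C.d (sqBar f g τ) =
    C.comp Q.t (sqHat f g τ) + C.comp τ P.tHat + C.comp Q.tCheck τ -
      C.comp (sqCheck f g τ) P.t + C.comp Q.tBar f - C.comp g P.tBar := by
  have tf : C.twist f = f := by rw [C.twist_of_mem hf, sgn_zero, one_smul]
  have tg : C.twist g = g := by rw [C.twist_of_mem hg, sgn_zero, one_smul]
  have tτ : C.twist τ = -τ := by rw [C.twist_of_mem hτ, sgn_neg_one, neg_one_smul]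
  simp only [sqHat, sqCheck, sqBar, C.d_comp, map_add, map_sub, map_neg, df, dg, dτ, tf, tg, tτ,
    P.d_tHat, P.d_tBar, Q.d_tCheck, Q.d_tBar, Q.twist_tCheck, Q.twist_tBar, map_zero,
    LinearMap.zero_apply, LinearMap.add_apply, LinearMap.sub_apply, LinearMap.neg_apply, C.assoc,
    C.comp_id, C.id_comp]
  abel

end Square

variable (P : HEquiv (pathCat C))

theorem t_snd_mem : P.t.2.2 ∈ C.homDeg _ _ (-1) := P.t_mem.2.2

/-- Closedness of `P.t` in the path category says that its third component is a homotopy filling the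
square with sides `P.t.1` and `P.t.2.1`. -/
theorem d_t_snd : C.d P.t.2.2 = C.comp P.t.2.1 P.src.t - C.comp P.tgt.t P.t.1 := by
  have h := congrArg (fun z => z.2.2) P.d_t
  have h1 := C.twist_of_mem P.t_mem.1
  have h2 := C.twist_of_mem P.t_mem.2.1
  rw [sgn_zero, one_smul] at h1 h2
  have h3 : C.d P.t.2.2 - (C.comp (C.twist P.t.2.1) P.src.t - C.comp P.tgt.t (C.twist P.t.1)) = 0 :=
    h
  rw [h1, h2] at h3
  exact sub_eq_zero.1 h3

/-- The transposed square of homotopy equivalences. -/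
noncomputable def swap : HEquiv (pathCat C) where
  src := P.mapObj (pathSrc C)
  tgt := P.mapObj (pathTgt C)
  -- Transposition exchanges the two composites around the square, so the homotopy between them
  -- changes sign.
  t := (P.src.t, P.tgt.t, -P.t.2.2)
  -- From here on the homotopy components are rebuilt from the square `P.t` and the four sides.
  -- Those of `P.tInv`, `P.tHat`, `P.tCheck` and `P.tBar` do not enter.
  tInv := (P.src.tInv, P.tgt.tInv, sqInv (P := P.src) (Q := P.tgt) P.t.1 P.t.2.1 P.t.2.2)
  tHat := (P.src.tHat, P.tgt.tHat, sqHat (P := P.src) (Q := P.tgt) P.t.1 P.t.2.1 P.t.2.2)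
  tCheck := (P.src.tCheck, P.tgt.tCheck, sqCheck (P := P.src) (Q := P.tgt) P.t.1 P.t.2.1 P.t.2.2)
  tBar := (P.src.tBar, P.tgt.tBar, sqBar (P := P.src) (Q := P.tgt) P.t.1 P.t.2.1 P.t.2.2)
  t_mem := ⟨P.src.t_mem, P.tgt.t_mem, neg_mem P.t_mem.2.2⟩
  tInv_mem := ⟨P.src.tInv_mem, P.tgt.tInv_mem, sqInv_mem P.t_mem.1 P.t_mem.2.1 P.t_snd_mem⟩
  tHat_mem := ⟨P.src.tHat_mem, P.tgt.tHat_mem, sqHat_mem P.t_mem.1 P.t_mem.2.1 P.t_snd_mem⟩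
  tCheck_mem := ⟨P.src.tCheck_mem, P.tgt.tCheck_mem,
    sqCheck_mem P.t_mem.1 P.t_mem.2.1 P.t_snd_mem⟩
  tBar_mem := ⟨P.src.tBar_mem, P.tgt.tBar_mem, sqBar_mem P.t_mem.1 P.t_mem.2.1 P.t_snd_mem⟩
  d_t := by
    refine Prod.ext P.src.d_t (Prod.ext P.tgt.d_t ?_)
    change C.d (-P.t.2.2) - (C.comp (C.twist P.tgt.t) P.t.1 - C.comp P.t.2.1 (C.twist P.src.t)) = 0
    rw [map_neg, d_t_snd, twist_t, twist_t]
    abel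
  d_tInv := by
    refine Prod.ext P.src.d_tInv (Prod.ext P.tgt.d_tInv ?_)
    change C.d (sqInv _ _ _) -
      (C.comp (C.twist P.tgt.tInv) P.t.2.1 - C.comp P.t.1 (C.twist P.src.tInv)) = 0
    rw [d_sqInv P.t_mem.1 P.t_mem.2.1 P.t_snd_mem (congrArg (fun z => z.1) P.d_t)
      (congrArg (fun z => z.2.1) P.d_t) P.d_t_snd, twist_tInv, twist_tInv]
    abel
  d_tHat := by
    refine Prod.ext P.src.d_tHat (Prod.ext P.tgt.d_tHat ?_)
    change C.d (sqHat _ _ _) -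
      (C.comp (C.twist P.tgt.tHat) P.t.1 - C.comp P.t.1 (C.twist P.src.tHat)) =
      0 - (C.comp P.tgt.tInv (-P.t.2.2) + C.comp (sqInv _ _ _) (C.twist P.src.t))
    rw [d_sqHat P.t_mem.1 P.t_mem.2.1 P.t_snd_mem (congrArg (fun z => z.1) P.d_t)
      (congrArg (fun z => z.2.1) P.d_t) P.d_t_snd, twist_tHat, twist_tHat, twist_t]
    simp only [map_neg, LinearMap.neg_apply]
    abel
  d_tCheck := by
    refine Prod.ext P.src.d_tCheck (Prod.ext P.tgt.d_tCheck ?_)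
    change C.d (sqCheck _ _ _) -
      (C.comp (C.twist P.tgt.tCheck) P.t.2.1 - C.comp P.t.2.1 (C.twist P.src.tCheck)) =
      0 - (C.comp P.tgt.t (sqInv _ _ _) + C.comp (-P.t.2.2) (C.twist P.src.tInv))
    rw [d_sqCheck P.t_mem.1 P.t_mem.2.1 P.t_snd_mem (congrArg (fun z => z.1) P.d_t)
      (congrArg (fun z => z.2.1) P.d_t) P.d_t_snd, twist_tCheck, twist_tCheck, twist_tInv]
    simp only [map_neg, LinearMap.neg_apply]
    abel
  d_tBar := by
    refine Prod.ext P.src.d_tBar (Prod.ext P.tgt.d_tBar ?_)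
    change C.d (sqBar _ _ _) -
      (C.comp (C.twist P.tgt.tBar) P.t.1 - C.comp P.t.2.1 (C.twist P.src.tBar)) =
      (C.comp P.tgt.t (sqHat _ _ _) + C.comp (-P.t.2.2) (C.twist P.src.tHat)) -
      (C.comp P.tgt.tCheck (-P.t.2.2) + C.comp (sqCheck _ _ _) (C.twist P.src.t))
    rw [d_sqBar P.t_mem.1 P.t_mem.2.1 P.t_snd_mem (congrArg (fun z => z.1) P.d_t)
      (congrArg (fun z => z.2.1) P.d_t) P.d_t_snd, twist_tBar, twist_tBar, twist_tHat, twist_t]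
    simp only [map_neg, LinearMap.neg_apply]
    abel

end HEquiv

/-- The transposition of squares of homotopy equivalences. -/
noncomputable def swapFunctor (C : DGCat k) : pathCat (pathCat C) ⟶ pathCat (pathCat C) where
  obj P := HEquiv.swap P
  map {P Q} :=
    -- A morphism is a three by three array, and it is transposed. The corner is a homotopy in both
    -- directions, and exchanging two directions of degree `-1` costs a sign.
    { toFun := fun f => ((f.1.1, f.2.1.1, f.2.2.1), (f.1.2.1, f.2.1.2.1, f.2.2.2.1),
        (f.1.2.2, f.2.1.2.2, -f.2.2.2.2))
      map_add' := fun f g => by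
        refine Prod.ext rfl (Prod.ext rfl (Prod.ext rfl (Prod.ext rfl ?_)))
        exact neg_add _ _
      map_smul' := fun c f => by
        refine Prod.ext rfl (Prod.ext rfl (Prod.ext rfl (Prod.ext rfl ?_)))
        exact (smul_neg _ _).symm }
  map_id P := by
    refine Prod.ext rfl (Prod.ext rfl (Prod.ext rfl (Prod.ext rfl ?_)))
    exact neg_zero
  map_comp {P Q R} g f := by
    have h1 := pathCat_twist (P := P.src) (Q := Q.src) f.1
    have h2 := pathCat_twist (P := P.mapObj (pathSrc C)) (Q := Q.mapObj (pathSrc C))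
      (f.1.1, f.2.1.1, f.2.2.1)
    refine Prod.ext (Prod.ext rfl (Prod.ext rfl ?_)) (Prod.ext (Prod.ext rfl (Prod.ext rfl ?_))
      (Prod.ext ?_ (Prod.ext ?_ ?_)))
    · exact congrArg (fun z => C.comp g.2.1.1 f.2.2.1 + C.comp g.2.2.1 z)
        (congrArg (fun z => z.1) h1)
    · exact congrArg (fun z => C.comp g.2.1.2.1 f.2.2.2.1 + C.comp g.2.2.2.1 z)
        (congrArg (fun z => z.2.1) h1)
    · exact (congrArg (fun z => C.comp g.1.2.1 f.1.2.2 + C.comp g.1.2.2 z)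
        (congrArg (fun z => z.1) h2)).symm
    · exact (congrArg (fun z => C.comp g.2.1.2.1 f.2.1.2.2 + C.comp g.2.1.2.2 z)
        (congrArg (fun z => z.2.1) h2)).symm
    -- The corner of a composite has four terms. The signs that `pathCat_twist` puts on a mixed term
    -- make up for the sign of the corner.
    · change -((C.comp g.2.1.2.1 f.2.2.2.2 + C.comp g.2.1.2.2 (C.twist f.2.2.1)) +
          (C.comp g.2.2.2.1 ((pathCat C).twist f.1).2.2 +
            C.comp g.2.2.2.2 (C.twist ((pathCat C).twist f.1).1))) =
        (C.comp g.2.1.2.1 (-f.2.2.2.2) + C.comp g.2.2.2.1 (C.twist f.1.2.2)) +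
          (C.comp g.2.1.2.2 ((pathCat C).twist (X := P.mapObj (pathSrc C))
            (Y := Q.mapObj (pathSrc C)) (f.1.1, f.2.1.1, f.2.2.1)).2.2 +
            C.comp (-g.2.2.2.2) (C.twist ((pathCat C).twist (X := P.mapObj (pathSrc C))
            (Y := Q.mapObj (pathSrc C)) (f.1.1, f.2.1.1, f.2.2.1)).1))
      rw [h1, h2]
      simp only [map_neg, LinearMap.neg_apply]
      abel
  map_mem hf := ⟨⟨hf.1.1, hf.2.1.1, hf.2.2.1⟩, ⟨hf.1.2.1, hf.2.1.2.1, hf.2.2.2.1⟩,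
    ⟨hf.1.2.2, hf.2.1.2.2, neg_mem hf.2.2.2.2⟩⟩
  map_d {P Q} f := by
    have h1 := pathCat_twist (P := P.src) (Q := Q.src) f.1
    have h2 := pathCat_twist (P := P.tgt) (Q := Q.tgt) f.2.1
    have h3 := pathCat_twist (P := P.mapObj (pathSrc C)) (Q := Q.mapObj (pathSrc C))
      (f.1.1, f.2.1.1, f.2.2.1)
    have h4 := pathCat_twist (P := P.mapObj (pathTgt C)) (Q := Q.mapObj (pathTgt C))
      (f.1.2.1, f.2.1.2.1, f.2.2.2.1)
    refine Prod.ext (Prod.ext rfl (Prod.ext rfl ?_)) (Prod.ext (Prod.ext rfl (Prod.ext rfl ?_))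
      (Prod.ext ?_ (Prod.ext ?_ ?_)))
    · change C.d f.2.2.1 - (C.comp ((pathCat C).twist f.2.1).1 P.t.1 -
        C.comp Q.t.1 ((pathCat C).twist f.1).1) =
        C.d f.2.2.1 - (C.comp (C.twist f.2.1.1) P.t.1 - C.comp Q.t.1 (C.twist f.1.1))
      rw [h1, h2]
    · change C.d f.2.2.2.1 - (C.comp ((pathCat C).twist f.2.1).2.1 P.t.2.1 -
        C.comp Q.t.2.1 ((pathCat C).twist f.1).2.1) =
        C.d f.2.2.2.1 - (C.comp (C.twist f.2.1.2.1) P.t.2.1 - C.comp Q.t.2.1 (C.twist f.1.2.1))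
      rw [h1, h2]
    · change C.d f.1.2.2 - (C.comp (C.twist f.1.2.1) P.src.t - C.comp Q.src.t (C.twist f.1.1)) =
        C.d f.1.2.2 - (C.comp ((pathCat C).twist (X := P.mapObj (pathTgt C))
            (Y := Q.mapObj (pathTgt C)) (f.1.2.1, f.2.1.2.1, f.2.2.2.1)).1 P.src.t -
          C.comp Q.src.t ((pathCat C).twist (X := P.mapObj (pathSrc C))
            (Y := Q.mapObj (pathSrc C)) (f.1.1, f.2.1.1, f.2.2.1)).1)
      rw [h3, h4]
    · change C.d f.2.1.2.2 - (C.comp (C.twist f.2.1.2.1) P.tgt.t -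
          C.comp Q.tgt.t (C.twist f.2.1.1)) =
        C.d f.2.1.2.2 - (C.comp ((pathCat C).twist (X := P.mapObj (pathTgt C))
            (Y := Q.mapObj (pathTgt C)) (f.1.2.1, f.2.1.2.1, f.2.2.2.1)).2.1 P.tgt.t -
          C.comp Q.tgt.t ((pathCat C).twist (X := P.mapObj (pathSrc C))
            (Y := Q.mapObj (pathSrc C)) (f.1.1, f.2.1.1, f.2.2.1)).2.1)
      rw [h3, h4]
    · change -((C.d f.2.2.2.2 - (C.comp (C.twist f.2.2.2.1) P.src.t -
            C.comp Q.tgt.t (C.twist f.2.2.1))) -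
          ((C.comp ((pathCat C).twist f.2.1).2.1 P.t.2.2 +
            C.comp ((pathCat C).twist f.2.1).2.2 (C.twist P.t.1)) -
          (C.comp Q.t.2.1 ((pathCat C).twist f.1).2.2 +
            C.comp Q.t.2.2 (C.twist ((pathCat C).twist f.1).1)))) =
        (C.d (-f.2.2.2.2) - (C.comp (C.twist f.2.1.2.2) P.t.1 -
            C.comp Q.t.2.1 (C.twist f.1.2.2))) -
          ((C.comp ((pathCat C).twist (X := P.mapObj (pathTgt C))
            (Y := Q.mapObj (pathTgt C)) (f.1.2.1, f.2.1.2.1, f.2.2.2.1)).2.1 (-P.t.2.2) +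
            C.comp ((pathCat C).twist (X := P.mapObj (pathTgt C))
            (Y := Q.mapObj (pathTgt C)) (f.1.2.1, f.2.1.2.1, f.2.2.2.1)).2.2 (C.twist P.src.t)) -
          (C.comp Q.tgt.t ((pathCat C).twist (X := P.mapObj (pathSrc C))
            (Y := Q.mapObj (pathSrc C)) (f.1.1, f.2.1.1, f.2.2.1)).2.2 +
            C.comp (-Q.t.2.2) (C.twist ((pathCat C).twist (X := P.mapObj (pathSrc C))
            (Y := Q.mapObj (pathSrc C)) (f.1.1, f.2.1.1, f.2.2.1)).1)))
      have h5 := C.twist_of_mem P.t_mem.1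
      rw [sgn_zero, one_smul] at h5
      rw [h1, h2, h3, h4, h5, HEquiv.twist_t]
      simp only [map_neg, LinearMap.neg_apply, C.twist_twist]
      abel

end Swap

/-! ### The interchange functor -/

section Interchange

variable {k : Type u} [CommRing k] {A : DGCat k} (a : Gens A) (h : a.IsFree)
  (c : Gens (Cyl A a h)) (hc : c.IsFree)

namespace Cyl

/-- The square of homotopy equivalences that defines the interchange. -/
noncomputable def interchangeSq : A ⟶ pathCat (pathCat (Cyl (Cyl A a h) c hc)) :=
  -- Transposing the identity of the double cylinder twice gives the universal square.
  flat a h (flat c hc (𝟙 _)) ≫ swapFunctor _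

/-- The interchange dg functor. -/
noncomputable def interchange : Cyl (Cyl A a h) c hc ⟶ Cyl (Cyl A a h) c hc :=
  sharp c hc (sharp a h (interchangeSq a h c hc))

/-- An outer end reads off one side of the transposed square, which is the corresponding inner end
of the universal square, that is, `Cyl(i_r)`. The two are compared component by component after
`flat`. -/
theorem incl_interchange (r : Bool) :
    incl c hc r ≫ interchange a h c hc = map a h c hc (incl a h r) := by
  rw [interchange, incl_sharp]
  apply flat_injective a h
  have e1 := sharp_t a h (interchangeSq a h c hc)
  have e2 := sharp_tInv a h (interchangeSq a h c hc)
  have e3 := sharp_tHat a h (interchangeSq a h c hc)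
  have e4 := sharp_tCheck a h (interchangeSq a h c hc)
  have e5 := sharp_tBar a h (interchangeSq a h c hc)
  have m1 := fun X => map_map_edge a h c hc (incl a h r) (.t X)
  have m2 := fun X => map_map_edge a h c hc (incl a h r) (.tInv X)
  have m3 := fun X => map_map_edge a h c hc (incl a h r) (.tHat X)
  have m4 := fun X => map_map_edge a h c hc (incl a h r) (.tCheck X)
  have m5 := fun X => map_map_edge a h c hc (incl a h r) (.tBar X)
  cases r
  · refine DGFunctor.hext (funext fun X => HEquiv.ext rfl rfl
      (heq_of_eq ((congrArg Prod.fst (e1 X)).trans (m1 X).symm))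
      (heq_of_eq ((congrArg Prod.fst (e2 X)).trans (m2 X).symm))
      (heq_of_eq ((congrArg Prod.fst (e3 X)).trans (m3 X).symm))
      (heq_of_eq ((congrArg Prod.fst (e4 X)).trans (m4 X).symm))
      (heq_of_eq ((congrArg Prod.fst (e5 X)).trans (m5 X).symm)))
      fun X Y f => heq_of_eq (Prod.ext ?_ (Prod.ext ?_ ?_))
    · exact (congrArg Prod.fst (sharp_incl_false a h (interchangeSq a h c hc) f)).trans
        (map_map_incl a h c hc (incl a h false) false f).symm
    · exact (congrArg Prod.fst (sharp_incl_true a h (interchangeSq a h c hc) f)).trans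
        (map_map_incl a h c hc (incl a h false) true f).symm
    · exact (congrArg Prod.fst (sharp_tMor a h (interchangeSq a h c hc) f)).trans
        (map_map_tMor a h c hc (incl a h false) f).symm
  · refine DGFunctor.hext (funext fun X => HEquiv.ext rfl rfl
      (heq_of_eq ((congrArg (fun z => z.2.1) (e1 X)).trans (m1 X).symm))
      (heq_of_eq ((congrArg (fun z => z.2.1) (e2 X)).trans (m2 X).symm))
      (heq_of_eq ((congrArg (fun z => z.2.1) (e3 X)).trans (m3 X).symm))
      (heq_of_eq ((congrArg (fun z => z.2.1) (e4 X)).trans (m4 X).symm))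
      (heq_of_eq ((congrArg (fun z => z.2.1) (e5 X)).trans (m5 X).symm)))
      fun X Y f => heq_of_eq (Prod.ext ?_ (Prod.ext ?_ ?_))
    · exact (congrArg (fun z => z.2.1) (sharp_incl_false a h (interchangeSq a h c hc) f)).trans
        (map_map_incl a h c hc (incl a h true) false f).symm
    · exact (congrArg (fun z => z.2.1) (sharp_incl_true a h (interchangeSq a h c hc) f)).trans
        (map_map_incl a h c hc (incl a h true) true f).symm
    · exact (congrArg (fun z => z.2.1) (sharp_tMor a h (interchangeSq a h c hc) f)).trans
        (map_map_tMor a h c hc (incl a h true) f).symm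

/-- By naturality of `sharp`, an inner end of `T` is read off by an end projection from
`interchangeSq`; this is the transpose of the outer end by definition. -/
theorem map_interchange (r : Bool) :
    map a h c hc (incl a h r) ≫ interchange a h c hc = incl c hc r := by
  rw [interchange, map_comp_sharp, incl_sharp]
  apply flat_injective a h
  rw [flat_sharp]
  cases r
  · rfl
  · rfl

/-- A morphism `t_θ` of the outer cylinder goes to the homotopy component of the value at `θ`. For
`θ` among `t`, `t'`, `t̂`, `ť`, `t̄` that is a field of `swap`, and for `θ = t_f` it is the negated
corner of `swapFunctor`. -/
theorem interchange_isInterchangeFormula :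
    IsInterchangeFormula a h c hc (interchange a h c hc) where
  obj X r s := by cases r <;> cases s <;> rfl
  t X := heq_of_eq ((sharp_tMor c hc _ _).trans
    (congrArg (fun z => z.2.2) (sharp_t a h (interchangeSq a h c hc) X)))
  tInv X := heq_of_eq ((sharp_tMor c hc _ _).trans
    (congrArg (fun z => z.2.2) (sharp_tInv a h (interchangeSq a h c hc) X)))
  tHat X := heq_of_eq ((sharp_tMor c hc _ _).trans
    (congrArg (fun z => z.2.2) (sharp_tHat a h (interchangeSq a h c hc) X)))
  tCheck X := heq_of_eq ((sharp_tMor c hc _ _).trans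
    (congrArg (fun z => z.2.2) (sharp_tCheck a h (interchangeSq a h c hc) X)))
  tBar X := heq_of_eq ((sharp_tMor c hc _ _).trans
    (congrArg (fun z => z.2.2) (sharp_tBar a h (interchangeSq a h c hc) X)))
  tMor X Y θ := heq_of_eq ((sharp_tMor c hc _ _).trans
    (congrArg (fun z => z.2.2) (sharp_tMor a h (interchangeSq a h c hc) θ)))

end Cyl

end Interchange

/-! ### Linear functors, free generators and the retraction criterion -/

section LinearFunctors

variable {k : Type u} [CommRing k]

/-- A `k`-linear functor with a given map on objects, not necessarily compatible with degrees and
differentials. -/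
structure LinOver (A B : DGCat k) (o : A.Obj → B.Obj) where
  map : ∀ {X Y}, A.Hom X Y →ₗ[k] B.Hom (o X) (o Y)
  map_id : ∀ X, map (A.id X) = B.id (o X)
  map_comp : ∀ {X Y Z} (g : A.Hom Y Z) (f : A.Hom X Y),
    map (A.comp g f) = B.comp (map g) (map f)

/-- The underlying `k`-linear functor of a dg functor. -/
def DGFunctor.toLinOver {A B : DGCat k} (F : DGFunctor A B) : LinOver A B F.obj where
  map := F.map
  map_id := F.map_id
  map_comp := F.map_comp

namespace LinOver

variable {A B C : DGCat k} {o : A.Obj → B.Obj}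

/-- Composition of `k`-linear functors. -/
def comp (K : LinOver A B o) {o' : B.Obj → C.Obj} (L : LinOver B C o') :
    LinOver A C (fun X => o' (o X)) where
  map := L.map ∘ₗ K.map
  map_id X := by simp [K.map_id, L.map_id]
  map_comp g f := by simp [K.map_comp, L.map_comp]

/-- Replacing the map on objects by an equal one. -/
def castObj (K : LinOver A B o) {o' : A.Obj → B.Obj} (h : ∀ X, o X = o' X) : LinOver A B o' :=
  (funext h : o = o') ▸ K

/-- Maps on objects that involve a chosen preimage agree with the expected ones only
propositionally. Moving a functor along such an equality changes its values up to `HEq` only, so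
degrees and differentials survive. -/
theorem castObj_map_heq (K : LinOver A B o) {o' : A.Obj → B.Obj} (h : ∀ X, o X = o' X)
    {X Y : A.Obj} (f : A.Hom X Y) : (K.castObj h).map f ≍ K.map f := by
  obtain rfl : o = o' := funext h
  rfl

theorem castObj_map_mem (K : LinOver A B o) {o' : A.Obj → B.Obj} (h : ∀ X, o X = o' X)
    {X Y : A.Obj} {f : A.Hom X Y} {n : ℤ} (hf : K.map f ∈ B.homDeg _ _ n) :
    (K.castObj h).map f ∈ B.homDeg _ _ n := by
  obtain rfl : o = o' := funext h
  exact hf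

theorem castObj_map_d (K : LinOver A B o) {o' : A.Obj → B.Obj} (h : ∀ X, o X = o' X)
    {X Y : A.Obj} {f : A.Hom X Y} (hf : K.map (A.d f) = B.d (K.map f)) :
    (K.castObj h).map (A.d f) = B.d ((K.castObj h).map f) := by
  obtain rfl : o = o' := funext h
  exact hf

/-- Agreement is needed only on a class that generates the one morphism `f`. This is how a functor
defined on an initial segment of generators is compared with the full one. -/
theorem congr_of_generated {K L : LinOver A B o} {P : ∀ ⦃X Y : A.Obj⦄, A.Hom X Y → Prop}
    (h : ∀ ⦃X Y⦄ (f : A.Hom X Y), P f → K.map f = L.map f) {X Y : A.Obj} {f : A.Hom X Y}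
    (hf : A.Generated P f) : K.map f = L.map f := by
  induction hf with
  | of f hf => exact h f hf
  | id X => rw [K.map_id, L.map_id]
  | comp g f _ _ hg hf => rw [K.map_comp, L.map_comp, hg, hf]
  | zero X Y => rw [map_zero, map_zero]
  | add f g _ _ hf hg => rw [map_add, map_add, hf, hg]
  | smul c f _ hf => rw [map_smul, map_smul, hf]

end LinOver

theorem DGCat.Generated.map {A B : DGCat k} (F : A ⟶ B) {P : ∀ ⦃X Y : A.Obj⦄, A.Hom X Y → Prop}
    {Q : ∀ ⦃X Y : B.Obj⦄, B.Hom X Y → Prop}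
    (hP : ∀ ⦃X Y⦄ (f : A.Hom X Y), P f → B.Generated Q (F.map f)) {X Y : A.Obj} {f : A.Hom X Y}
    (hf : A.Generated P f) : B.Generated Q (F.map f) := by
  induction hf with
  | of f hf => exact hP f hf
  | id X => rw [F.map_id]; exact .id _
  | comp g f _ _ hg hf => rw [F.map_comp]; exact .comp _ _ hg hf
  | zero X Y => rw [map_zero]; exact .zero _ _
  | add f g _ _ hf hg => rw [map_add]; exact .add _ _ hf hg
  | smul c f _ hf => rw [map_smul]; exact .smul _ _ hf

namespace Gens

variable {A B C : DGCat k} (g : Gens B)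

/-- The class of the generators. -/
inductive Mem : ∀ ⦃X Y : B.Obj⦄, B.Hom X Y → Prop
  | gen {X Y : B.Obj} (e : g.E X Y) : Mem (g.gen e)

theorem lin_generated {X Y : B.Obj} (x : FHom k g.E X Y) : B.Generated g.Mem (g.lin x) := by
  induction x using Finsupp.induction_linear with
  | zero => rw [map_zero]; exact .zero _ _
  | add x y hx hy => rw [map_add]; exact .add _ _ hx hy
  | single p c =>
    have : Finsupp.single p c = c • pt k p := by simp [pt]
    rw [this, map_smul]
    refine .smul _ _ ?_
    induction p with
    | nil => rw [lin_nil]; exact .id _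
    | cons e p ih =>
      rw [pt_cons, lin_fcomp, lin_edge]
      exact .comp _ _ (.of _ (.gen e)) (ih (by simp [pt]))

variable {g}

theorem IsFree.generated (hg : g.IsFree) {X Y : B.Obj} (f : B.Hom X Y) :
    B.Generated g.Mem f := by
  rw [← g.lin_inv hg f]
  exact g.lin_generated _

/-- The `k`-linear functor with given values on free generators. -/
noncomputable def linLift (hg : g.IsFree) {o : B.Obj → C.Obj}
    (φ : ∀ ⦃X Y⦄, g.E X Y → C.Hom (o X) (o Y)) : LinOver B C o where
  map := evL C o φ ∘ₗ (g.inv hg).toLinearMap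
  map_id X := by
    rw [LinearMap.comp_apply, LinearEquiv.coe_coe, inv_id, evL_nil]
  map_comp a b := by
    simp only [LinearMap.comp_apply, LinearEquiv.coe_coe, inv_comp, evL_fcomp]

theorem linLift_gen (hg : g.IsFree) {o : B.Obj → C.Obj}
    (φ : ∀ ⦃X Y⦄, g.E X Y → C.Hom (o X) (o Y)) {X Y : B.Obj} (e : g.E X Y) :
    (linLift hg φ).map (g.gen e) = φ e := by
  change evL C o φ (g.inv hg (g.gen e)) = _
  rw [inv_gen, evL_edge]

theorem linLift_mem (hg : g.IsFree) {o : B.Obj → C.Obj}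
    {φ : ∀ ⦃X Y⦄, g.E X Y → C.Hom (o X) (o Y)}
    (hφ : ∀ ⦃X Y⦄ (e : g.E X Y), φ e ∈ C.homDeg _ _ (g.deg e)) {X Y : B.Obj} {f : B.Hom X Y} {n : ℤ}
    (hf : f ∈ B.homDeg X Y n) : (linLift hg φ).map f ∈ C.homDeg _ _ n :=
  evL_mem g.deg C o φ hφ (g.inv_mem hg hf)

theorem linLift_d (hg : g.IsFree) {o : B.Obj → C.Obj}
    {φ : ∀ ⦃X Y⦄, g.E X Y → C.Hom (o X) (o Y)}
    (hφ : ∀ ⦃X Y⦄ (e : g.E X Y), φ e ∈ C.homDeg _ _ (g.deg e))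
    (hd : ∀ ⦃X Y⦄ (e : g.E X Y), (linLift hg φ).map (B.d (g.gen e)) = C.d (φ e))
    {X Y : B.Obj} (f : B.Hom X Y) :
    (linLift hg φ).map (B.d f) = C.d ((linLift hg φ).map f) := by
  change evL C o φ (g.inv hg (B.d f)) = C.d (evL C o φ (g.inv hg f))
  rw [inv_d]
  exact evL_fd g.deg (g.δ hg) C o φ hφ hd _

variable (g)

/-- The free `k`-linear category on the edges of `g`, with the zero differential. -/
noncomputable abbrev freeCat : DGCat k :=
  freeDG (V := B.Obj) (E := g.E) g.deg (fun _ _ _ => 0) (fun _ _ _ => zero_mem _)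
    (fun _ _ _ => map_zero _)

variable {g}

/-- Surjectivity of `lin` is generation. For injectivity, `Ψ` sends each generator to its edge, so
`Ψ` after `lin` fixes all paths and is a left inverse. -/
theorem isFree_of_retraction (hg : ∀ ⦃X Y⦄ (f : B.Hom X Y), B.Generated g.Mem f)
    (Ψ : LinOver B g.freeCat (fun X => X))
    (hΨ : ∀ ⦃X Y⦄ (e : g.E X Y), Ψ.map (g.gen e) = edge k e) : g.IsFree := by
  intro X Y
  constructor
  · have : (Ψ.map ∘ₗ g.lin : FHom k g.E X Y →ₗ[k] FHom k g.E X Y) = LinearMap.id := by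
      apply FHom.hom_ext; intro p
      change Ψ.map (g.lin (pt k p)) = pt k p
      induction p with
      | nil => rw [lin_nil, Ψ.map_id]
      | cons e p ih =>
        rw [pt_cons, lin_fcomp, Ψ.map_comp, ih, lin_edge, hΨ]
    intro x y hxy
    have hx := congrArg (fun l => l x) this
    have hy := congrArg (fun l => l y) this
    simp only [LinearMap.comp_apply, LinearMap.id_apply] at hx hy
    rw [← hx, ← hy, hxy]
  · intro f
    have := hg f
    induction this with
    | of f hf => obtain ⟨e⟩ := hf; exact ⟨_, g.lin_edge e⟩
    | id X => exact ⟨_, g.lin_nil X⟩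
    | comp a b _ _ ha hb =>
      obtain ⟨x, rfl⟩ := ha
      obtain ⟨y, rfl⟩ := hb
      exact ⟨_, g.lin_fcomp x y⟩
    | zero X Y => exact ⟨0, map_zero _⟩
    | add a b _ _ ha hb =>
      obtain ⟨x, rfl⟩ := ha
      obtain ⟨y, rfl⟩ := hb
      exact ⟨_, map_add _ x y⟩
    | smul c a _ ha =>
      obtain ⟨x, rfl⟩ := ha
      exact ⟨_, map_smul _ c x⟩

variable (g) in
/-- The generators as a family of morphisms. -/
def fam (i : g.Idx) : Σ X Y : B.Obj, B.Hom X Y := ⟨i.1, i.2.1, g.gen i.2.2⟩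

/-- Freeness depends only on the family of morphisms. -/
theorem IsFree.reindex (hg : g.IsFree) {g' : Gens B} (φ : g.Idx → g'.Idx)
    (hφ : ∀ i, g'.fam (φ i) = g.fam i) (hs : Function.Surjective φ) : g'.IsFree := by
  have h1 : ∀ ⦃X Y⦄ (e : g.E X Y), ∃ e' : g'.E X Y, φ ⟨X, Y, e⟩ = ⟨X, Y, e'⟩ ∧
      g'.gen e' = g.gen e := by
    intro X Y e
    have := hφ ⟨X, Y, e⟩
    generalize φ ⟨X, Y, e⟩ = j at this
    obtain ⟨X', Y', e'⟩ := j
    simp only [fam, Sigma.mk.injEq] at this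
    obtain ⟨rfl, h2⟩ := this
    simp only [heq_eq_eq, Sigma.mk.injEq] at h2
    obtain ⟨rfl, h3⟩ := h2
    exact ⟨e', rfl, eq_of_heq h3⟩
  choose m hm1 hm2 using h1
  -- The retraction sends a generator of `g` to the matching edge of `g'`; by surjectivity of `φ`
  -- every edge of `g'` arises in this way.
  refine isFree_of_retraction (fun X Y f => (hg.generated f).mono ?_)
    (linLift hg (C := g'.freeCat) (o := fun X => X) fun _ _ e => edge k (m e)) ?_
  · rintro X Y _ ⟨e⟩
    rw [← hm2]
    exact .of _ (.gen _)
  · intro X Y e'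
    obtain ⟨⟨X', Y', e⟩, he⟩ := hs ⟨X, Y, e'⟩
    rw [hm1] at he
    cases he
    rw [hm2, linLift_gen]

/-- A well-founded relation extends to a well-order, and this only enlarges the class of preceding
generators. Orders can thus be given by ranks with ties. -/
theorem isSemifree_of_wellFounded (hg : g.IsFree) (r : g.Idx → g.Idx → Prop) (hr : WellFounded r)
    (hd : ∀ (X Y : B.Obj) (e : g.E X Y), B.Generated (g.Before r ⟨X, Y, e⟩) (B.d (g.gen e))) :
    g.IsSemifree := by
  have : IsWellFounded _ r := ⟨hr⟩
  obtain ⟨s, hs, hws⟩ := IsWellFounded.exists_well_order_ge r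
  refine ⟨hg, s, hws, fun X Y e => (hd X Y e).mono ?_⟩
  rintro X' Y' _ ⟨e', he'⟩
  exact .of _ (.gen e' (hs _ _ he'))

end Gens

end LinearFunctors

/-! ### Free extensions of a dg category -/

section Extensions

variable {k : Type u} [CommRing k] {A B C : DGCat k}

/-- The morphisms in the image of `F` and in `S`. -/
inductive ExtMem (F : A ⟶ B) (S : Gens B) : ∀ ⦃U W : B.Obj⦄, B.Hom U W → Prop
  | image {X Y : A.Obj} (f : A.Hom X Y) : ExtMem F S (F.map f)
  | gen {U W : B.Obj} (s : S.E U W) : ExtMem F S (S.gen s)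

namespace Gens.IsFree

variable {F : A ⟶ B} {a : Gens A} {S : Gens B} (hb : (extGens F a S).IsFree)
include hb

theorem ext_generated {U W : B.Obj} (f : B.Hom U W) : B.Generated (ExtMem F S) f := by
  refine (hb.generated f).mono ?_
  rintro U W _ ⟨e⟩
  cases e with
  | old e => exact .of _ (.image _)
  | new s => exact .of _ (.gen s)

theorem ext_hom_ext {o : B.Obj → C.Obj} {K L : LinOver B C o}
    (h1 : ∀ {X Y : A.Obj} (f : A.Hom X Y), K.map (F.map f) = L.map (F.map f))
    (h2 : ∀ {U W : B.Obj} (s : S.E U W), K.map (S.gen s) = L.map (S.gen s)) {U W : B.Obj}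
    (f : B.Hom U W) : K.map f = L.map f := by
  refine LinOver.congr_of_generated ?_ (ext_generated hb f)
  rintro U W _ (f | s)
  · exact h1 f
  · exact h2 s

omit hb in
/-- The values of `extLift` on edges. -/
def extE {o : B.Obj → C.Obj} (K : LinOver A C (fun X => o (F.obj X)))
    (φ : ∀ ⦃U W⦄, S.E U W → C.Hom (o U) (o W)) :
    ∀ ⦃U W⦄, (extGens F a S).E U W → C.Hom (o U) (o W)
  | _, _, .old e => K.map (a.gen e)
  | _, _, .new s => φ s

/-- The universal property of free extensions for `k`-linear functors. -/
noncomputable def extLift {o : B.Obj → C.Obj} (K : LinOver A C (fun X => o (F.obj X)))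
    (φ : ∀ ⦃U W⦄, S.E U W → C.Hom (o U) (o W)) : LinOver B C o :=
  linLift hb (extE K φ)

theorem extLift_gen {o : B.Obj → C.Obj} (K : LinOver A C (fun X => o (F.obj X)))
    (φ : ∀ ⦃U W⦄, S.E U W → C.Hom (o U) (o W)) {U W : B.Obj} (s : S.E U W) :
    (extLift hb K φ).map (S.gen s) = φ s :=
  linLift_gen hb (extE K φ) (.new s)

theorem extLift_map (ha : a.IsFree) {o : B.Obj → C.Obj} (K : LinOver A C (fun X => o (F.obj X)))
    (φ : ∀ ⦃U W⦄, S.E U W → C.Hom (o U) (o W)) {X Y : A.Obj} (f : A.Hom X Y) :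
    (extLift hb K φ).map (F.map f) = K.map f := by
  change (F.toLinOver.comp (extLift hb K φ)).map f = K.map f
  refine LinOver.congr_of_generated ?_ (ha.generated f)
  rintro X Y _ ⟨e⟩
  exact linLift_gen hb (extE K φ) (.old e)

theorem extLift_mem {o : B.Obj → C.Obj} {K : LinOver A C (fun X => o (F.obj X))}
    {φ : ∀ ⦃U W⦄, S.E U W → C.Hom (o U) (o W)}
    (hK : ∀ {X Y : A.Obj} {f : A.Hom X Y} {n : ℤ}, f ∈ A.homDeg X Y n → K.map f ∈ C.homDeg _ _ n)
    (hφ : ∀ ⦃U W⦄ (s : S.E U W), φ s ∈ C.homDeg _ _ (S.deg s)) {U W : B.Obj} {f : B.Hom U W}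
    {n : ℤ} (hf : f ∈ B.homDeg U W n) : (extLift hb K φ).map f ∈ C.homDeg _ _ n := by
  refine linLift_mem hb ?_ hf
  intro U W e
  cases e with
  | old e => exact hK (a.gen_mem e)
  | new s => exact hφ s

theorem extLift_d (ha : a.IsFree) {o : B.Obj → C.Obj} {K : LinOver A C (fun X => o (F.obj X))}
    {φ : ∀ ⦃U W⦄, S.E U W → C.Hom (o U) (o W)}
    (hK : ∀ {X Y : A.Obj} {f : A.Hom X Y} {n : ℤ}, f ∈ A.homDeg X Y n → K.map f ∈ C.homDeg _ _ n)
    (hφ : ∀ ⦃U W⦄ (s : S.E U W), φ s ∈ C.homDeg _ _ (S.deg s))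
    (hKd : ∀ {X Y : A.Obj} (f : A.Hom X Y), K.map (A.d f) = C.d (K.map f))
    (hφd : ∀ ⦃U W⦄ (s : S.E U W), (extLift hb K φ).map (B.d (S.gen s)) = C.d (φ s)) {U W : B.Obj}
    (f : B.Hom U W) : (extLift hb K φ).map (B.d f) = C.d ((extLift hb K φ).map f) := by
  refine linLift_d hb ?_ ?_ f
  · intro U W e
    cases e with
    | old e => exact hK (a.gen_mem e)
    | new s => exact hφ s
  · intro U W e
    cases e with
    | old e =>
      refine Eq.trans ?_ (hKd (a.gen e))
      refine Eq.trans ?_ (extLift_map hb ha K φ _)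
      exact congrArg (extLift hb K φ).map (F.map_d _).symm
    | new s => exact hφd s

/-- Freeness of an extension does not depend on the free generators of the base. -/
theorem ext_congr (ha : a.IsFree) {a' : Gens A} (ha' : a'.IsFree) :
    (extGens F a' S).IsFree := by
  -- The retraction is the free lift along `a'` on the base, extended to `B` by the universal
  -- property for the old generators `a`.
  refine isFree_of_retraction (fun U W f => (ext_generated hb f).mono ?_)
    (extLift hb (C := (extGens F a' S).freeCat) (o := fun U => U)
      (linLift ha' (C := (extGens F a' S).freeCat) (o := F.obj) fun _ _ e => edge k (.old e))
      fun _ _ s => edge k (.new s)) ?_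
  · rintro U W _ (f | s)
    · refine (ha'.generated f).map F ?_
      rintro X Y _ ⟨e⟩
      exact .of _ (.gen (g := extGens F a' S) (.old e))
    · exact .of _ (.gen (g := extGens F a' S) (.new s))
  · intro U W e
    cases e with
    | old e => exact (extLift_map hb ha _ _ _).trans (linLift_gen ha' _ e)
    | new s => exact extLift_gen hb _ _ s

end Gens.IsFree

/-- The list of edges of a path. -/
def QPath.toList {V : Type u} {E : V → V → Type u} {X : V} :
    ∀ {Y : V}, QPath E X Y → List (Σ X Y : V, E X Y)
  | _, .nil _ => []
  | _, .cons e p => ⟨_, _, e⟩ :: p.toList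

/-- The types of subpaths depend on the intermediate vertices. The list of edges has no such
dependence, and the endpoint is generalised in the induction. -/
theorem QPath.toList_injective {V : Type u} {E : V → V → Type u} {X Y : V} :
    Function.Injective (QPath.toList (E := E) (X := X) (Y := Y)) := by
  have key : ∀ {Y : V} (p : QPath E X Y) {Y' : V} (q : QPath E X Y'), p.toList = q.toList →
      (⟨Y, p⟩ : Σ Y, QPath E X Y) = ⟨Y', q⟩ := by
    intro Y p
    induction p with
    | nil =>
      intro Y' q h
      cases q with
      | nil => rfl
      | cons e q => simp [QPath.toList] at h
    | cons e p ih =>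
      intro Y' q h
      cases q with
      | nil => simp [QPath.toList] at h
      | cons e' q =>
        rw [QPath.toList, QPath.toList, List.cons.injEq] at h
        obtain ⟨h1, h2⟩ := h
        have h3 := ih q h2
        cases h1
        cases h3
        rfl
  intro p q h
  have := key p q h
  cases this
  rfl

/-- The image of a path of generators of the base of an extension. -/
def oldPath (F : A ⟶ B) (a : Gens A) (S : Gens B) {X : A.Obj} : ∀ {Y : A.Obj}, QPath a.E X Y →
    QPath (extGens F a S).E (F.obj X) (F.obj Y)
  | _, .nil _ => .nil _
  | _, .cons e p => .cons (.old e) (oldPath F a S p)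

/-- The generator of the base that corresponds to a generator of an extension. -/
def oldIdx {F : A ⟶ B} {a : Gens A} {S : Gens B} : (extGens F a S).Idx → Option a.Idx
  | ⟨_, _, .old e⟩ => some ⟨_, _, e⟩
  | ⟨_, _, .new _⟩ => none

/-- Each edge `old e` remembers `e`, so `oldIdx` recovers the list of edges of the original path. -/
theorem oldPath_injective (F : A ⟶ B) (a : Gens A) (S : Gens B)
    {X Y : A.Obj} : Function.Injective (oldPath F a S (X := X) (Y := Y)) := by
  have key : ∀ {Y : A.Obj} (p : QPath a.E X Y), (oldPath F a S p).toList.map oldIdx =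
      p.toList.map some := by
    intro Y p
    induction p with
    | nil => rfl
    | cons e p ih => exact congrArg (List.cons _) ih
  intro p q h
  apply QPath.toList_injective
  have := congrArg (fun p => p.toList.map oldIdx) h
  simp only [key] at this
  exact List.map_injective_iff.2 (Option.some_injective _) this

/-- In the bases of paths, `F` is the linear map induced by the injection `oldPath` of one basis
into the other. -/
theorem map_injective_of_free {F : A ⟶ B} {a : Gens A}
    (ha : a.IsFree) {S : Gens B} (hb : (extGens F a S).IsFree) (X Y : A.Obj) :
    Function.Injective (F.map (X := X) (Y := Y)) := by
  have key : ∀ x : FHom k a.E X Y, F.map (a.lin x) =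
      (extGens F a S).lin (Finsupp.lmapDomain k k (oldPath F a S) x) := by
    have : F.map ∘ₗ a.lin = (extGens F a S).lin ∘ₗ
        Finsupp.lmapDomain k k (oldPath F a S (X := X) (Y := Y)) := by
      apply FHom.hom_ext; intro p
      have h0 : ∀ {Y : A.Obj} (p : QPath a.E X Y),
          Finsupp.lmapDomain k k (oldPath F a S (X := X)) (pt k p) = pt k (oldPath F a S p) := by
        intro Y p; simp [pt]
      simp only [LinearMap.comp_apply, h0]
      induction p with
      | nil => exact (congrArg F.map (a.lin_nil _)).trans ((F.map_id _).trans
          ((extGens F a S).lin_nil _).symm)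
      | cons e p ih =>
        rw [pt_cons, Gens.lin_fcomp, F.map_comp, ih, Gens.lin_edge]
        refine Eq.trans ?_ (congrArg (extGens F a S).lin
          (pt_cons (E := (extGens F a S).E) (.old e) (oldPath F a S p))).symm
        rw [Gens.lin_fcomp]
        exact congrArg (fun z => B.comp z _) ((extGens F a S).lin_edge (.old e)).symm
    exact fun x => congrArg (fun l => l x) this
  intro f f' hff
  obtain ⟨x, rfl⟩ := (ha X Y).2 f
  obtain ⟨y, rfl⟩ := (ha X Y).2 f'
  rw [key, key] at hff
  exact congrArg a.lin (Finsupp.mapDomain_injective (oldPath_injective F a S) ((hb _ _).1 hff))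

end Extensions

/-! ### Semifree extensions: isomorphisms, empty source, composition -/

section Cofibrations

variable {k : Type u} [CommRing k] {A B C : DGCat k}

/-- A well-founded order suffices in the definition of a semifree extension. -/
theorem isSemifreeExtensionBy_of_wellFounded {F : A ⟶ B} {S : Gens B}
    (hF : Function.Injective F.obj) {a : Gens A} (ha : a.IsSemifree) (hb : (extGens F a S).IsFree)
    (r : S.Idx → S.Idx → Prop) (hr : WellFounded r)
    (hd : ∀ (U W : B.Obj) (s : S.E U W),
      B.Generated (ExtBefore F S r ⟨U, W, s⟩) (B.d (S.gen s))) : IsSemifreeExtensionBy F S where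
  obj_injective := hF
  map_injective := map_injective_of_free ha.1 hb
  free := ⟨a, ha, hb⟩
  order := by
    have : IsWellFounded _ r := ⟨hr⟩
    obtain ⟨s, hs, hws⟩ := IsWellFounded.exists_well_order_ge r
    refine ⟨s, hws, fun U W e => (hd U W e).mono ?_⟩
    rintro X' Y' _ (f | ⟨e', he'⟩)
    · exact .of _ (.image f)
    · exact .of _ (.gen e' (hs _ _ he'))

/-- The generators of an extension as a sum. -/
def extIdx {F : A ⟶ B} {a : Gens A} {S : Gens B} : (extGens F a S).Idx → a.Idx ⊕ S.Idx
  | ⟨_, _, .old e⟩ => .inl ⟨_, _, e⟩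
  | ⟨_, _, .new s⟩ => .inr ⟨_, _, s⟩

theorem IsSemifreeExtensionBy.isFree {F : A ⟶ B} {S : Gens B} (h : IsSemifreeExtensionBy F S)
    {a : Gens A} (ha : a.IsFree) : (extGens F a S).IsFree := by
  obtain ⟨a', ha', hb⟩ := h.free
  exact hb.ext_congr ha'.1 ha

/-- All generators of the base are placed before those in `S`. The differential of an element of `S`
may involve any morphism of the base, and each of these is generated by what precedes. -/
theorem IsSemifreeExtensionBy.isSemifree {F : A ⟶ B} {S : Gens B}
    (h : IsSemifreeExtensionBy F S) {a : Gens A} (ha : a.IsSemifree) :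
    (extGens F a S).IsSemifree := by
  obtain ⟨r, hr, hd⟩ := h.order
  obtain ⟨haf, ra, hra, had⟩ := ha
  refine Gens.isSemifree_of_wellFounded (h.isFree haf) (InvImage (Sum.Lex ra r) extIdx)
    (InvImage.wf _ (Sum.lex_wf hra.wf hr.wf)) ?_
  intro U W e
  cases e with
  | @old X Y e =>
    change B.Generated _ (B.d (F.map (a.gen e)))
    rw [← F.map_d]
    refine (had X Y e).map F ?_
    rintro X' Y' _ ⟨e', he'⟩
    exact .of _ (.gen (a := extGens F a S) (.old e') (Sum.Lex.inl he'))
  | new s =>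
    refine (hd U W s).mono ?_
    rintro X' Y' _ (f | ⟨s', hs'⟩)
    · refine (haf.generated f).map F ?_
      rintro X' Y' _ ⟨e'⟩
      exact .of _ (.gen (a := extGens F a S) (.old e') (Sum.Lex.sep _ _))
    · exact .of _ (.gen (a := extGens F a S) (.new s') (Sum.Lex.inr hs'))

/-- The empty set of generators. -/
def Gens.empty (B : DGCat k) : Gens B where
  E _ _ := PEmpty
  gen _ _ e := e.elim
  deg _ _ e := e.elim
  gen_mem _ _ e := e.elim

theorem DGFunctor.congr_map_heq {F G : A ⟶ B} (h : F = G) {X Y : A.Obj} (f : A.Hom X Y) :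
    F.map f ≍ G.map f := by rw [h]

theorem map_heq_of_heq (F : A ⟶ B) {X Y X' Y' : A.Obj} (hX : X = X') (hY : Y = Y')
    {f : A.Hom X Y} {f' : A.Hom X' Y'} (hf : f ≍ f') : F.map f ≍ F.map f' := by
  subst hX hY
  rw [eq_of_heq hf]

/-- Every morphism of `B` is, up to the propositional equality of objects, an image under `F`. The
retraction is the inverse functor followed by the free lift along `a`, moved along that equality. -/
theorem isSemifreeExtensionBy_of_isIso (F : A ⟶ B) [IsIso F] {a : Gens A} (ha : a.IsSemifree) :
    IsSemifreeExtensionBy F (Gens.empty B) := by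
  have h1 : ∀ X, (inv F).obj (F.obj X) = X := fun X =>
    congrArg (fun G : A ⟶ A => G.obj X) (IsIso.hom_inv_id F)
  have h2 : ∀ U, F.obj ((inv F).obj U) = U := fun U =>
    congrArg (fun G : B ⟶ B => G.obj U) (IsIso.inv_hom_id F)
  have hl : ∀ {X Y : A.Obj} (f : A.Hom X Y), (inv F).map (F.map f) ≍ f := fun f =>
    DGFunctor.congr_map_heq (IsIso.hom_inv_id F) f
  have hr : ∀ {U W : B.Obj} (f : B.Hom U W), F.map ((inv F).map f) ≍ f := fun f =>
    DGFunctor.congr_map_heq (IsIso.inv_hom_id F) f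
  have hgen : ∀ {U W : B.Obj} (f : B.Hom U W), B.Generated (extGens F a (Gens.empty B)).Mem f := by
    intro U W f
    have h3 : B.Generated (extGens F a (Gens.empty B)).Mem (F.map ((inv F).map f)) := by
      refine (ha.1.generated _).map F ?_
      rintro X Y _ ⟨e⟩
      exact .of _ (.gen (g := extGens F a (Gens.empty B)) (.old e))
    have h4 : ∀ {U' W' : B.Obj} (hU : U' = U) (hW : W' = W) (f' : B.Hom U' W'), f' ≍ f →
        B.Generated (extGens F a (Gens.empty B)).Mem f' →
        B.Generated (extGens F a (Gens.empty B)).Mem f := by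
      rintro U' W' rfl rfl f' hf hf'
      rwa [← eq_of_heq hf]
    exact h4 (h2 U) (h2 W) _ (hr f) h3
  refine isSemifreeExtensionBy_of_wellFounded
    (fun X Y hXY => by rw [← h1 X, ← h1 Y, hXY]) ha ?_ (fun _ _ => False)
    ⟨fun i => i.2.2.elim⟩ (fun _ _ e => e.elim)
  let K : LinOver A (extGens F a (Gens.empty B)).freeCat F.obj :=
    Gens.linLift ha.1 (C := (extGens F a (Gens.empty B)).freeCat) (o := F.obj)
      fun _ _ e => edge k (.old e)
  refine Gens.isFree_of_retraction (fun _ _ f => hgen f)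
    (((inv F).toLinOver.comp K).castObj h2) ?_
  intro U W e
  cases e with
  | @old X Y e =>
    refine eq_of_heq ((LinOver.castObj_map_heq _ _ _).trans ?_)
    have h5 : ∀ {X' Y' : A.Obj} (hX : X' = X) (hY : Y' = Y) (f' : A.Hom X' Y'), f' ≍ a.gen e →
        K.map f' ≍ K.map (a.gen e) := by
      rintro X' Y' rfl rfl f' hf
      rw [eq_of_heq hf]
    refine (h5 (h1 X) (h1 Y) _ (hl (a.gen e))).trans (heq_of_eq ?_)
    exact Gens.linLift_gen ha.1 _ e
  | new s => exact s.elim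

/-- Over a base without objects nothing old remains, so the generators of the extension are those of
`B`. -/
theorem isSemifreeExtensionBy_of_isEmpty [IsEmpty A.Obj] (F : A ⟶ B) {b : Gens B}
    (hb : b.IsSemifree) : IsSemifreeExtensionBy F b := by
  obtain ⟨hfree, r, hr, hd⟩ := hb
  let a : Gens A := Gens.empty A
  have ha : a.IsSemifree := by
    refine Gens.isSemifree_of_wellFounded (fun X => isEmptyElim X) (fun _ _ => False)
      ⟨fun i => i.2.2.elim⟩ (fun _ _ e => e.elim)
  refine isSemifreeExtensionBy_of_wellFounded (fun X => isEmptyElim X) ha ?_ r hr.wf ?_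
  · refine hfree.reindex (fun i => ⟨i.1, i.2.1, .new i.2.2⟩) (fun i => rfl) ?_
    rintro ⟨_, _, e⟩
    cases e with
    | old e => exact e.elim
    | new s => exact ⟨⟨_, _, s⟩, rfl⟩
  · intro U W s
    refine (hd U W s).mono ?_
    rintro U' W' _ ⟨s', hs'⟩
    exact .of _ (.gen s' hs')

/-- The generators of `C` over `B` over `A` are only regrouped. The new set is ordered with the
images of `S` before `T`. -/
theorem IsSemifreeExtensionBy.comp {F : A ⟶ B} {S : Gens B} (hF : IsSemifreeExtensionBy F S)
    {G : B ⟶ C} {T : Gens C} (hG : IsSemifreeExtensionBy G T) :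
    IsSemifreeExtensionBy (F ≫ G) (extGens G S T) := by
  obtain ⟨a, ha, -⟩ := hF.free
  obtain ⟨r, hr, hrd⟩ := hF.order
  obtain ⟨q, hq, hqd⟩ := hG.order
  refine isSemifreeExtensionBy_of_wellFounded
    (fun X Y h => hF.obj_injective (hG.obj_injective h)) ha ?_ (InvImage (Sum.Lex r q) extIdx)
    (InvImage.wf _ (Sum.lex_wf hr.wf hq.wf)) ?_
  · refine (hG.isFree (hF.isFree ha.1)).reindex (fun
      | ⟨_, _, .old (.old e)⟩ => ⟨_, _, .old e⟩
      | ⟨_, _, .old (.new s)⟩ => ⟨_, _, .new (.old s)⟩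
      | ⟨_, _, .new t⟩ => ⟨_, _, .new (.new t)⟩) ?_ ?_
    · rintro ⟨_, _, ((e | s) | t)⟩ <;> rfl
    · rintro ⟨_, _, (e | (s | t))⟩
      · exact ⟨⟨_, _, .old (.old e)⟩, rfl⟩
      · exact ⟨⟨_, _, .old (.new s)⟩, rfl⟩
      · exact ⟨⟨_, _, .new t⟩, rfl⟩
  · intro U W e
    cases e with
    | @old X Y s =>
      change C.Generated _ (C.d (G.map (S.gen s)))
      rw [← G.map_d]
      refine (hrd X Y s).map G ?_
      rintro X' Y' _ (f | ⟨s', hs'⟩)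
      · exact .of _ (.image (F := F ≫ G) f)
      · exact .of _ (.gen (S := extGens G S T) (.old s') (Sum.Lex.inl hs'))
    | new t =>
      refine (hqd U W t).mono ?_
      rintro X' Y' _ (f | ⟨t', ht'⟩)
      -- A morphism of `B` is generated by `A` and `S`, and all of `S` precedes any element of `T`.
      · refine ((hF.isFree ha.1).ext_generated f).map G ?_
        rintro X' Y' _ (f | s)
        · exact .of _ (.image (F := F ≫ G) f)
        · exact .of _ (.gen (S := extGens G S T) (.old s) (Sum.Lex.sep _ _))
      · exact .of _ (.gen (S := extGens G S T) (.new t') (Sum.Lex.inr ht'))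

end Cofibrations

/-! ### Derivations and functors on free categories -/

section FreeTools

variable {k : Type u} [CommRing k] {V : Type u} {E : V → V → Type u} (dg : ∀ ⦃X Y⦄, E X Y → ℤ)
  (δ : ∀ ⦃X Y⦄, E X Y → FHom k E X Y)

variable (k E) in
/-- The free category on a quiver with the zero differential. -/
noncomputable abbrev freeZero : DGCat k :=
  freeDG (E := E) dg (fun _ _ _ => 0) (fun _ _ _ => zero_mem _) (fun _ _ _ => map_zero _)

/-- A graded `k`-linear functor to a free category commutes with the derivation of the free
category when it does so on generators. -/
theorem LinOver.map_d_of_gens {B : DGCat k} {g : Gens B} (hg : g.IsFree) {o : B.Obj → V}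
    (Ψ : LinOver B (freeZero k E dg) o)
    (hmem : ∀ ⦃X Y⦄ (e : g.E X Y), Ψ.map (g.gen e) ∈ fdeg k dg (o X) (o Y) (g.deg e))
    (hd : ∀ ⦃X Y⦄ (e : g.E X Y), Ψ.map (B.d (g.gen e)) = fd dg δ (Ψ.map (g.gen e)))
    {X Y : B.Obj} (f : B.Hom X Y) : Ψ.map (B.d f) = fd dg δ (Ψ.map f) := by
  obtain ⟨x, rfl⟩ := (hg X Y).2 f
  have : Ψ.map ∘ₗ B.d ∘ₗ g.lin = fd dg δ ∘ₗ Ψ.map ∘ₗ g.lin (X := X) (Y := Y) := by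
    clear x
    apply FHom.hom_ext; intro p
    change Ψ.map (B.d (g.lin (pt k p))) = fd dg δ (Ψ.map (g.lin (pt k p)))
    induction p with
    | nil =>
      rw [Gens.lin_nil, B.d_id, map_zero, Ψ.map_id]
      exact (fd_pt dg δ (.nil (o _))).symm
    | cons e p ih =>
      rw [pt_cons, Gens.lin_fcomp, Gens.lin_edge, B.leibniz _ (g.gen_mem e), map_add, map_smul,
        Ψ.map_comp, Ψ.map_comp, Ψ.map_comp, hd, ih]
      refine Eq.trans ?_ (fd_leibniz dg δ _ _).symm
      rw [twist_of_mem dg (hmem e), map_smul]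
      rfl
  exact congrArg (fun l => l x) this

/-- The `k`-linear functor on a free category with given values on the edges. -/
noncomputable def freeLin (C : DGCat k) (o : V → C.Obj) (φ : ∀ ⦃X Y⦄, E X Y → C.Hom (o X) (o Y)) :
    LinOver (freeZero k E dg) C o where
  map := evL C o φ
  map_id := evL_nil C o φ
  map_comp := evL_fcomp C o φ

/-- The edges as generators of a free dg category. -/
noncomputable def freeGens (hδ : ∀ ⦃X Y⦄ (e : E X Y), δ e ∈ fdeg k dg X Y (dg e + 1))
    (hδδ : ∀ ⦃X Y⦄ (e : E X Y), fd dg δ (δ e) = 0) : Gens (freeDG dg δ hδ hδδ) where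
  E := E
  gen _ _ e := edge k e
  deg := dg
  gen_mem _ _ e := edge_mem_fdeg dg e

theorem freeGens_isFree (hδ : ∀ ⦃X Y⦄ (e : E X Y), δ e ∈ fdeg k dg X Y (dg e + 1))
    (hδδ : ∀ ⦃X Y⦄ (e : E X Y), fd dg δ (δ e) = 0) : (freeGens dg δ hδ hδδ).IsFree := by
  intro X Y
  have : (freeGens dg δ hδ hδδ).lin (X := X) (Y := Y) = (LinearMap.id : FHom k E X Y →ₗ[k] _) := by
    refine FHom.hom_ext (k := k) (E := E) ?_
    intro p
    induction p with
    | nil => exact Gens.lin_nil _ _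
    | cons e p ih =>
      rw [pt_cons]
      refine (Gens.lin_fcomp (freeGens dg δ hδ hδδ) _ _).trans ?_
      exact congrArg₂ (fun y z => fcomp y z) (Gens.lin_edge (freeGens dg δ hδ hδδ) e) ih
  rw [this]
  exact Function.bijective_id

/-- Two dg functors agree when they agree on objects and on free generators. -/
theorem Gens.IsFree.functor_ext {A D : DGCat k} {a : Gens A} (ha : a.IsFree) {F G : A ⟶ D}
    (ho : F.obj = G.obj) (he : ∀ ⦃X Y⦄ (e : a.E X Y), F.map (a.gen e) ≍ G.map (a.gen e)) :
    F = G := by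
  obtain ⟨o, m, m1, m2, m3, m4⟩ := F
  obtain ⟨o', m', m1', m2', m3', m4'⟩ := G
  obtain rfl : o = o' := ho
  refine DGFunctor.hext rfl fun X Y f => heq_of_eq ?_
  exact LinOver.congr_of_generated (K := ⟨m, m1, m2⟩) (L := ⟨m', m1', m2'⟩)
    (by rintro X Y _ ⟨e⟩; exact eq_of_heq (he e)) (ha.generated f)

end FreeTools

/-! ### Images of families of generators -/

section Image

variable {k : Type u} [CommRing k] {B D : DGCat k}

/-- The edges of the image of a set of generators. -/
inductive ImE (G : B ⟶ D) (S : Gens B) : D.Obj → D.Obj → Type u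
  | mk {U W : B.Obj} (s : S.E U W) : ImE G S (G.obj U) (G.obj W)

/-- The image of a set of homogeneous morphisms under a dg functor. -/
def Gens.image (G : B ⟶ D) (S : Gens B) : Gens D where
  E := ImE G S
  gen := fun | _, _, .mk s => G.map (S.gen s)
  deg := fun | _, _, .mk s => S.deg s
  gen_mem := fun | _, _, .mk s => G.map_mem (S.gen_mem s)

/-- The generator with a given image. -/
def imIdx {G : B ⟶ D} {S : Gens B} : (S.image G).Idx → S.Idx
  | ⟨_, _, .mk s⟩ => ⟨_, _, s⟩

theorem DGCat.Generated.of_heq {P : ∀ ⦃X Y : B.Obj⦄, B.Hom X Y → Prop} {X Y X' Y' : B.Obj}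
    (hX : X = X') (hY : Y = Y') {f : B.Hom X Y} {f' : B.Hom X' Y'} (h : f ≍ f')
    (hf : B.Generated P f') : B.Generated P f := by
  subst hX hY
  rwa [eq_of_heq h]

theorem LinOver.map_heq {A : DGCat k} {o : A.Obj → B.Obj} (K : LinOver A B o) {X Y X' Y' : A.Obj}
    (hX : X = X') (hY : Y = Y') {f : A.Hom X Y} {f' : A.Hom X' Y'} (h : f ≍ f') :
    K.map f ≍ K.map f' := by
  subst hX hY
  rw [eq_of_heq h]

end Image

/-! ### An explicit pushout of a semifree extension -/

namespace PushoutModel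

variable {k : Type u} [CommRing k] {A B C : DGCat k} (F : A ⟶ B) (G : A ⟶ C) (S : Gens B)
  (c : Gens C)

/-- The objects of the pushout. -/
abbrev Obj : Type u := C.Obj ⊕ {U : B.Obj // U ∉ Set.range F.obj}

open Classical in
/-- The map on objects from `B` to the pushout. -/
noncomputable def objMap (U : B.Obj) : Obj (C := C) F :=
  if h : U ∈ Set.range F.obj then .inl (G.obj h.choose) else .inr ⟨U, h⟩

/-- Injectivity of `F` on objects identifies the chosen preimage with `X`. -/
theorem objMap_obj (hF : Function.Injective F.obj) (X : A.Obj) :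
    objMap F G (F.obj X) = .inl (G.obj X) := by
  have h : F.obj X ∈ Set.range F.obj := ⟨X, rfl⟩
  rw [objMap, dif_pos h, hF h.choose_spec]

theorem objMap_of_notMem (U : {U : B.Obj // U ∉ Set.range F.obj}) :
    objMap F G U.1 = .inr U := by
  rw [objMap, dif_neg U.2]

/-- The edges of the pushout. -/
inductive PoE : Obj (C := C) F → Obj (C := C) F → Type u
  | old {X Y : C.Obj} (e : c.E X Y) : PoE (.inl X) (.inl Y)
  | new {U W : B.Obj} (s : S.E U W) : PoE (objMap F G U) (objMap F G W)

/-- The degrees of the edges of the pushout. -/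
def deg : ∀ ⦃P Q⦄, PoE F G S c P Q → ℤ
  | _, _, .old e => c.deg e
  | _, _, .new s => S.deg s

variable {F S c} {a : Gens A} (hF : Function.Injective F.obj) (ha : a.IsFree)
  (hb : (extGens F a S).IsFree) (hc : c.IsFree)

variable (F S) in
/-- The functor from `C`. -/
noncomputable def linC : LinOver C (freeZero k (PoE F G S c) (deg F G S c)) Sum.inl :=
  Gens.linLift hc (C := freeZero k (PoE F G S c) (deg F G S c)) fun _ _ e => edge k (.old e)

/-- The functor from `A`. -/
noncomputable def linA : LinOver A (freeZero k (PoE F G S c) (deg F G S c))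
    (fun X => objMap F G (F.obj X)) :=
  (G.toLinOver.comp (linC F G S hc)).castObj fun X => (objMap_obj F G hF X).symm

/-- The functor from `B`. -/
noncomputable def linB : LinOver B (freeZero k (PoE F G S c) (deg F G S c)) (objMap F G) :=
  hb.extLift (C := freeZero k (PoE F G S c) (deg F G S c)) (linA G hF hc)
    fun _ _ s => edge k (.new s)

/-- The differentials of the edges of the pushout. -/
noncomputable def δ : ∀ ⦃P Q⦄, PoE F G S c P Q → FHom k (PoE F G S c) P Q
  | _, _, .old e => (linC F G S hc).map (C.d (c.gen e))
  -- No recursion is needed here: `linB` is a functor to the free category with zero differential,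
  -- built before any differential on the pushout is defined.
  | _, _, .new s => (linB G hF hb hc).map (B.d (S.gen s))

theorem linC_gen {X Y : C.Obj} (e : c.E X Y) : (linC F G S hc).map (c.gen e) = edge k (.old e) :=
  Gens.linLift_gen hc _ e

theorem linB_gen {U W : B.Obj} (s : S.E U W) :
    (linB G hF hb hc).map (S.gen s) = edge k (.new s) :=
  hb.extLift_gen _ _ s

theorem linC_mem {X Y : C.Obj} {f : C.Hom X Y} {n : ℤ} (hf : f ∈ C.homDeg X Y n) :
    (linC F G S hc).map f ∈ fdeg k (deg F G S c) _ _ n :=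
  Gens.linLift_mem hc (C := freeZero k (PoE F G S c) (deg F G S c))
    (fun _ _ e => edge_mem_fdeg (deg F G S c) (.old e)) hf

theorem linA_mem {X Y : A.Obj} {f : A.Hom X Y} {n : ℤ} (hf : f ∈ A.homDeg X Y n) :
    (linA (S := S) G hF hc).map f ∈ fdeg k (deg F G S c) _ _ n :=
  LinOver.castObj_map_mem (G.toLinOver.comp (linC F G S hc))
    (fun X => (objMap_obj F G hF X).symm) (linC_mem G hc (G.map_mem hf))

theorem linB_mem {U W : B.Obj} {f : B.Hom U W} {n : ℤ} (hf : f ∈ B.homDeg U W n) :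
    (linB G hF hb hc).map f ∈ fdeg k (deg F G S c) _ _ n :=
  hb.extLift_mem (C := freeZero k (PoE F G S c) (deg F G S c)) (linA_mem G hF hc)
    (fun _ _ s => edge_mem_fdeg (deg F G S c) (.new s)) hf

theorem δ_mem ⦃P Q⦄ (e : PoE F G S c P Q) :
    δ G hF hb hc e ∈ fdeg k (deg F G S c) P Q (deg F G S c e + 1) := by
  cases e with
  | old e => exact linC_mem G hc (C.d_mem (c.gen_mem e))
  | new s => exact linB_mem G hF hb hc (B.d_mem (S.gen_mem s))

theorem linC_d {X Y : C.Obj} (f : C.Hom X Y) : (linC F G S hc).map (C.d f) =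
    fd (deg F G S c) (δ G hF hb hc) ((linC F G S hc).map f) := by
  refine LinOver.map_d_of_gens (deg F G S c) (δ G hF hb hc) hc _
    (fun _ _ e => linC_mem G hc (c.gen_mem e)) (fun X Y e => ?_) f
  rw [linC_gen, fd_edge, δ]

-- Only `HEq` is available since the two maps on objects agree propositionally, by `objMap_obj`.
include ha in
theorem linB_map {X Y : A.Obj} (f : A.Hom X Y) :
    (linB G hF hb hc).map (F.map f) ≍ (linC F G S hc).map (G.map f) := by
  rw [linB, hb.extLift_map ha]
  exact LinOver.castObj_map_heq _ _ _

include ha in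
theorem linB_d {U W : B.Obj} (f : B.Hom U W) : (linB G hF hb hc).map (B.d f) =
    fd (deg F G S c) (δ G hF hb hc) ((linB G hF hb hc).map f) := by
  refine LinOver.map_d_of_gens (deg F G S c) (δ G hF hb hc) hb _
    (fun _ _ e => linB_mem G hF hb hc ((extGens F a S).gen_mem e)) (fun U W e => ?_) f
  cases e with
  | @old X Y e =>
    change (linB G hF hb hc).map (B.d (F.map (a.gen e))) = fd _ _ ((linB G hF hb hc).map
      (F.map (a.gen e)))
    rw [← F.map_d]
    have h1 := linB_map G hF ha hb hc (A.d (a.gen e))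
    have h2 := linB_map G hF ha hb hc (a.gen e)
    rw [G.map_d, linC_d G hF hb hc] at h1
    have key : ∀ {P Q P' Q' : Obj (C := C) F} (hP : P = P') (hQ : Q = Q')
        {x : FHom k (PoE F G S c) P Q} {x' : FHom k (PoE F G S c) P' Q'}, x ≍ x' →
        fd (deg F G S c) (δ G hF hb hc) x ≍ fd (deg F G S c) (δ G hF hb hc) x' := by
      rintro P Q P' Q' rfl rfl x x' h
      rw [eq_of_heq h]
    -- On generators that come from `A` the claim is the compatibility of `linC` with `d`,
    -- transported along the equality of objects.
    exact eq_of_heq (h1.trans (key (objMap_obj F G hF X) (objMap_obj F G hF Y) h2).symm)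
  | new s =>
    change (linB G hF hb hc).map (B.d (S.gen s)) = fd _ _ ((linB G hF hb hc).map (S.gen s))
    rw [linB_gen, fd_edge, δ]

-- Since `linC` and `linB` carry the differentials of `C` and `B` to the new derivation, its square
-- vanishes on edges because it does in `C` and `B`.
include ha in
theorem fd_δ ⦃P Q⦄ (e : PoE F G S c P Q) :
    fd (deg F G S c) (δ G hF hb hc) (δ G hF hb hc e) = 0 := by
  cases e with
  | old e => rw [δ, ← linC_d, C.d_d, map_zero]
  | new s => rw [δ, ← linB_d G hF ha hb hc, B.d_d, map_zero]

/-- The pushout of a semifree extension `F` along `G`. -/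
noncomputable abbrev pushout : DGCat k :=
  freeDG (deg F G S c) (δ G hF hb hc) (δ_mem G hF hb hc) (fd_δ G hF ha hb hc)

/-- The functor from `C` to the pushout. -/
noncomputable def inr : C ⟶ pushout G hF ha hb hc where
  obj := Sum.inl
  map := (linC F G S hc).map
  map_id := (linC F G S hc).map_id
  map_comp := (linC F G S hc).map_comp
  map_mem := linC_mem G hc
  map_d := linC_d G hF hb hc

/-- The functor from `B` to the pushout. -/
noncomputable def inl : B ⟶ pushout G hF ha hb hc where
  obj := objMap F G
  map := (linB G hF hb hc).map
  map_id := (linB G hF hb hc).map_id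
  map_comp := (linB G hF hb hc).map_comp
  map_mem := linB_mem G hF hb hc
  map_d := linB_d G hF ha hb hc

theorem condition : F ≫ inl G hF ha hb hc = G ≫ inr G hF ha hb hc :=
  DGFunctor.hext (funext fun X => objMap_obj F G hF X) fun _ _ f => linB_map G hF ha hb hc f

/-- Each object and each edge of the model comes from `C` or from `B`, and free generators determine
a functor. -/
theorem hom_ext {X : DGCat k} {m m' : pushout G hF ha hb hc ⟶ X}
    (h1 : inl G hF ha hb hc ≫ m = inl G hF ha hb hc ≫ m')
    (h2 : inr G hF ha hb hc ≫ m = inr G hF ha hb hc ≫ m') : m = m' := by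
  refine (freeGens_isFree (deg F G S c) (δ G hF hb hc) (δ_mem G hF hb hc)
    (fd_δ G hF ha hb hc)).functor_ext ?_ ?_
  · funext P
    cases P with
    | inl Y => exact congrArg (fun H : C ⟶ X => H.obj Y) h2
    | inr U =>
      have := congrArg (fun H : B ⟶ X => H.obj U.1) h1
      change m.obj (objMap F G U.1) = m'.obj (objMap F G U.1) at this
      rwa [objMap_of_notMem] at this
  · intro P Q e
    cases e with
    | old e =>
      have := DGFunctor.congr_map_heq h2 (c.gen e)
      change m.map ((linC F G S hc).map (c.gen e)) ≍ m'.map ((linC F G S hc).map (c.gen e)) at this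
      rwa [linC_gen] at this
    | new s =>
      have := DGFunctor.congr_map_heq h1 (S.gen s)
      change m.map ((linB G hF hb hc).map (S.gen s)) ≍ m'.map ((linB G hF hb hc).map (S.gen s))
        at this
      rwa [linB_gen] at this

section Desc

variable {X : DGCat k} (L : B ⟶ X) (K : C ⟶ X) (w : F ≫ L = G ≫ K)

/-- The values of `desc` on objects. -/
def descObj : Obj (C := C) F → X.Obj := Sum.elim K.obj fun U => L.obj U.1

include w hF in
theorem descObj_objMap (U : B.Obj) : descObj (F := F) L K (objMap F G U) = L.obj U := by
  by_cases h : U ∈ Set.range F.obj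
  · obtain ⟨Y, rfl⟩ := h
    rw [objMap_obj F G hF]
    exact (congrArg (fun H : A ⟶ X => H.obj Y) w).symm
  · exact congrArg (descObj L K) (objMap_of_notMem F G ⟨U, h⟩)

/-- The functor on `B` over the map on objects given by `descObj`. -/
noncomputable def descB : LinOver B X (fun U => descObj (F := F) L K (objMap F G U)) :=
  L.toLinOver.castObj fun U => (descObj_objMap G hF L K w U).symm

/-- The values of `desc` on edges. -/
noncomputable def descE : ∀ ⦃P Q⦄, PoE F G S c P Q →
    X.Hom (descObj (F := F) L K P) (descObj (F := F) L K Q)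
  | _, _, .old e => K.map (c.gen e)
  | _, _, .new s => (descB G hF L K w).map (S.gen s)

/-- The linear extension of `descE`. -/
noncomputable def descLin : LinOver (freeZero k (PoE F G S c) (deg F G S c)) X (descObj L K) :=
  freeLin (deg F G S c) X _ (descE G hF L K w)

theorem descLin_linC {Y Z : C.Obj} (f : C.Hom Y Z) :
    (descLin (S := S) G hF L K w).map ((linC F G S hc).map f) = K.map f := by
  refine LinOver.congr_of_generated (K := (linC F G S hc).comp (descLin (S := S) G hF L K w))
    (L := K.toLinOver) ?_ (hc.generated f)
  rintro Y Z _ ⟨e⟩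
  change (descLin (S := S) G hF L K w).map ((linC F G S hc).map (c.gen e)) = _
  rw [linC_gen]
  exact evL_edge _ _ _ _

-- Two functors on a free extension are compared on `F(A)`, where `w` identifies both with `K` after
-- `G`, and on `S`, where they agree by definition.
include ha in
theorem descLin_linB {U W : B.Obj} (f : B.Hom U W) :
    (descLin G hF L K w).map ((linB G hF hb hc).map f) = (descB G hF L K w).map f := by
  refine hb.ext_hom_ext (K := (linB G hF hb hc).comp (descLin G hF L K w))
    (L := descB G hF L K w) ?_ ?_ f
  · intro Y Z f
    refine eq_of_heq (((descLin G hF L K w).map_heq (objMap_obj F G hF Y) (objMap_obj F G hF Z)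
      (linB_map G hF ha hb hc f)).trans ?_)
    rw [descLin_linC]
    exact (DGFunctor.congr_map_heq w f).symm.trans (LinOver.castObj_map_heq L.toLinOver
      (fun U => (descObj_objMap G hF L K w U).symm) (F.map f)).symm
  · intro U W s
    change (descLin G hF L K w).map ((linB G hF hb hc).map (S.gen s)) = _
    rw [linB_gen]
    exact evL_edge _ _ _ _

/-- The functor from the pushout given by the universal property. -/
noncomputable def desc : pushout G hF ha hb hc ⟶ X :=
  freeDGLift (deg F G S c) (δ G hF hb hc) X (descObj L K) (descE G hF L K w)
    (δ_mem G hF hb hc) (fd_δ G hF ha hb hc)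
    (by
      intro P Q e
      cases e with
      | old e => exact K.map_mem (c.gen_mem e)
      | new s => 
        exact LinOver.castObj_map_mem L.toLinOver
          (fun U => (descObj_objMap G hF L K w U).symm) (L.map_mem (S.gen_mem s)))
    (by
      intro P Q e
      cases e with
      | old e =>
        change (descLin G hF L K w).map ((linC F G S hc).map (C.d (c.gen e))) = X.d (K.map (c.gen e))
        rw [descLin_linC, K.map_d]
      | new s =>
        change (descLin G hF L K w).map ((linB G hF hb hc).map (B.d (S.gen s))) =
          X.d ((descB G hF L K w).map (S.gen s))
        rw [descLin_linB G hF ha]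
        exact LinOver.castObj_map_d L.toLinOver
          (fun U => (descObj_objMap G hF L K w U).symm) (L.map_d _))

theorem inl_desc : inl G hF ha hb hc ≫ desc G hF ha hb hc L K w = L :=
  DGFunctor.hext (funext fun U => descObj_objMap G hF L K w U) fun _ _ f =>
    (heq_of_eq (descLin_linB G hF ha hb hc L K w f)).trans (LinOver.castObj_map_heq _ _ _)

theorem inr_desc : inr G hF ha hb hc ≫ desc G hF ha hb hc L K w = K :=
  DGFunctor.hext rfl fun _ _ f => heq_of_eq (descLin_linC G hF hc L K w f)

end Desc

theorem isPushout : IsPushout F G (inl G hF ha hb hc) (inr G hF ha hb hc) :=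
  ⟨⟨condition G hF ha hb hc⟩, ⟨Limits.PushoutCocone.IsColimit.mk _
    (fun s => desc G hF ha hb hc s.inl s.inr s.condition)
    (fun s => inl_desc G hF ha hb hc s.inl s.inr s.condition)
    (fun s => inr_desc G hF ha hb hc s.inl s.inr s.condition)
    fun s _ h1 h2 => hom_ext G hF ha hb hc
      (h1.trans (inl_desc G hF ha hb hc s.inl s.inr s.condition).symm)
      (h2.trans (inr_desc G hF ha hb hc s.inl s.inr s.condition).symm)⟩⟩

/-- The order is that of `S`. In the differential of an element of `S`, the parts from `F(A)` become
morphisms of `C` by commutativity of the square. -/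
theorem isSemifreeExtensionBy (hext : IsSemifreeExtensionBy F S) (hc' : c.IsSemifree) :
    IsSemifreeExtensionBy (inr G hF ha hb hc) (S.image (inl G hF ha hb hc)) := by
  obtain ⟨r, hr, hd⟩ := hext.order
  refine isSemifreeExtensionBy_of_wellFounded Sum.inl_injective hc' ?_ (InvImage r imIdx)
    (InvImage.wf _ hr.wf) ?_
  · refine (freeGens_isFree (deg F G S c) (δ G hF hb hc) (δ_mem G hF hb hc)
      (fd_δ G hF ha hb hc)).reindex (fun
      | ⟨_, _, .old e⟩ => ⟨_, _, .old e⟩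
      | ⟨_, _, .new s⟩ => ⟨_, _, .new (.mk s)⟩) ?_ ?_
    · rintro ⟨_, _, (e | s)⟩
      · exact congrArg (fun z => (⟨_, _, z⟩ : Σ X Y, (pushout G hF ha hb hc).Hom X Y))
          (linC_gen G hc e)
      · exact congrArg (fun z => (⟨_, _, z⟩ : Σ X Y, (pushout G hF ha hb hc).Hom X Y))
          (linB_gen G hF hb hc s)
    · rintro ⟨_, _, e⟩
      cases e with
      | old e => exact ⟨⟨_, _, .old e⟩, rfl⟩
      | new s =>
        cases s with
        | mk s => exact ⟨⟨_, _, .new s⟩, rfl⟩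
  · rintro _ _ ⟨s⟩
    change DGCat.Generated _ _ (DGCat.d _ ((inl G hF ha hb hc).map (S.gen s)))
    rw [← (inl G hF ha hb hc).map_d]
    refine (hd _ _ s).map _ ?_
    rintro X' Y' _ (f | ⟨s', hs'⟩)
    · refine .of_heq (objMap_obj F G hF _) (objMap_obj F G hF _)
        (DGFunctor.congr_map_heq (condition G hF ha hb hc) f) ?_
      exact .of _ (.image (F := inr G hF ha hb hc) (G.map f))
    · exact .of _ (.gen (S := S.image (inl G hF ha hb hc)) (.mk s') hs')

end PushoutModel

/-- Pushouts of semifree extensions exist and are semifree extensions by the same morphisms and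
objects. -/
theorem IsSemifreeExtensionBy.exists_isPushout {k : Type u} [CommRing k] {A B C : DGCat k}
    {F : A ⟶ B} {S : Gens B} (hF : IsSemifreeExtensionBy F S) (G : A ⟶ C) {c : Gens C}
    (hc : c.IsSemifree) : ∃ (D : DGCat k) (G' : B ⟶ D) (F' : C ⟶ D), IsPushout F G G' F' ∧
      IsSemifreeExtensionBy F' (S.image G') ∧
      ∀ Z : D.Obj, (∃ Y, Z = F'.obj Y) ∨ ∃ U, U ∉ Set.range F.obj ∧ Z = G'.obj U := by
  obtain ⟨a, ha, hb⟩ := hF.free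
  refine ⟨_, _, _, PushoutModel.isPushout G hF.obj_injective ha.1 hb hc.1,
    PushoutModel.isSemifreeExtensionBy G hF.obj_injective ha.1 hb hc.1 hF hc, ?_⟩
  -- The model has a disjoint sum as objects; the resulting description is what later gives
  -- injectivity on objects for the relative cylinder.
  rintro (Y | U)
  · exact .inl ⟨Y, rfl⟩
  · exact .inr ⟨U.1, U.2, (PushoutModel.objMap_of_notMem F G U).symm⟩

/-! ### Transfinite recursion along a semifree extension -/

section Recursion

variable {k : Type u} [CommRing k] {A B X D : DGCat k}

/-- A graded `k`-linear functor commutes with the sign twist. -/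
theorem LinOver.map_twist {o : A.Obj → B.Obj} (K : LinOver A B o)
    (hK : ∀ {X Y : A.Obj} {f : A.Hom X Y} {n : ℤ}, f ∈ A.homDeg X Y n → K.map f ∈ B.homDeg _ _ n)
    {X Y : A.Obj} (f : A.Hom X Y) : K.map (A.twist f) = B.twist (K.map f) := by
  have : K.map ∘ₗ A.twist = B.twist ∘ₗ K.map (X := X) (Y := Y) :=
    A.hom_lin_ext fun n f hf => by
      simp only [LinearMap.comp_apply, A.twist_of_mem hf, map_smul, B.twist_of_mem (hK hf)]
  exact congrArg (fun l => l f) this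

/-- Functors on a semifree extension can be defined by transfinite recursion: the value at each
element `s` of `S` may depend on the value at `d s`. -/
theorem IsSemifreeExtensionBy.exists_linOver {F : A ⟶ B} {S : Gens B}
    (hF : IsSemifreeExtensionBy F S) {o : B.Obj → X.Obj}
    (K : LinOver A X (fun Y => o (F.obj Y)))
    (hK : ∀ {Y Z : A.Obj} {f : A.Hom Y Z} {n : ℤ}, f ∈ A.homDeg Y Z n → K.map f ∈ X.homDeg _ _ n)
    (hKd : ∀ {Y Z : A.Obj} (f : A.Hom Y Z), K.map (A.d f) = X.d (K.map f))
    (π : X ⟶ D) (G : LinOver B D (fun U => π.obj (o U)))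
    (hπ : ∀ {Y Z : A.Obj} (f : A.Hom Y Z), π.map (K.map f) = G.map (F.map f))
    (v : ∀ ⦃U W⦄, S.E U W → X.Hom (o U) (o W) → X.Hom (o U) (o W))
    (hv : ∀ ⦃U W⦄ (s : S.E U W) (y : X.Hom (o U) (o W)), y ∈ X.homDeg _ _ (S.deg s + 1) →
      X.d y = 0 → π.map y = G.map (B.d (S.gen s)) →
      v s y ∈ X.homDeg _ _ (S.deg s) ∧ X.d (v s y) = y ∧ π.map (v s y) = G.map (S.gen s)) :
    ∃ N : LinOver B X o, (∀ {Y Z : A.Obj} (f : A.Hom Y Z), N.map (F.map f) = K.map f) ∧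
      (∀ {U W : B.Obj} (s : S.E U W), N.map (S.gen s) = v s (N.map (B.d (S.gen s)))) ∧
      (∀ {U W : B.Obj} {f : B.Hom U W} {n : ℤ}, f ∈ B.homDeg U W n →
        N.map f ∈ X.homDeg _ _ n) ∧
      (∀ {U W : B.Obj} (f : B.Hom U W), N.map (B.d f) = X.d (N.map f)) ∧
      ∀ {U W : B.Obj} (f : B.Hom U W), π.map (N.map f) = G.map f := by
  classical
  obtain ⟨a, ha, hb⟩ := hF.free
  obtain ⟨r, hr, hd⟩ := hF.order
  -- The recursive call needs a functor on all of `B`, so generators that do not precede `i` get the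
  -- value `0`; the differential of `i` does not see them.
  let φ : ∀ i : S.Idx, X.Hom (o i.1) (o i.2.1) := hr.wf.fix fun i rec =>
    v i.2.2 ((hb.extLift K fun U W s =>
      if h : r ⟨U, W, s⟩ i then rec ⟨U, W, s⟩ h else 0).map (B.d (S.gen i.2.2)))
  let Φ : LinOver B X o := hb.extLift K fun U W s => φ ⟨U, W, s⟩
  have hΦ : ∀ {U W : B.Obj} (s : S.E U W), Φ.map (S.gen s) = φ ⟨U, W, s⟩ := fun s =>
    hb.extLift_gen K _ s
  have hΦF : ∀ {Y Z : A.Obj} (f : A.Hom Y Z), Φ.map (F.map f) = K.map f := fun f =>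
    hb.extLift_map ha.1 K _ f
  -- The truncated functor and `Φ` agree on whatever is generated by `F(A)` and the preceding
  -- generators, in particular on `d s`.
  have htrunc : ∀ {U W : B.Obj} (s : S.E U W), Φ.map (B.d (S.gen s)) =
      (hb.extLift K fun U' W' s' => if r ⟨U', W', s'⟩ ⟨U, W, s⟩ then φ ⟨U', W', s'⟩ else 0).map
        (B.d (S.gen s)) := by
    intro U W s
    refine LinOver.congr_of_generated ?_ (hd U W s)
    rintro U' W' _ (f | ⟨s', hs'⟩)
    · rw [hΦF, hb.extLift_map ha.1]
    · rw [hΦ, hb.extLift_gen, if_pos hs']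
  have hφ : ∀ {U W : B.Obj} (s : S.E U W), φ ⟨U, W, s⟩ = v s (Φ.map (B.d (S.gen s))) := by
    intro U W s
    rw [htrunc]
    exact hr.wf.fix_eq _ _
  -- Degree, differential and projection must be proved together, since `hv` needs all three facts
  -- about the value at `d s`.
  have main : ∀ i : S.Idx, φ i ∈ X.homDeg _ _ (S.deg i.2.2) ∧
      X.d (φ i) = Φ.map (B.d (S.gen i.2.2)) ∧ π.map (φ i) = G.map (S.gen i.2.2) := by
    intro i
    induction i using hr.wf.induction with
    | h i ih =>
    obtain ⟨U, W, s⟩ := i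
    rw [hφ]
    refine hv s _ ?_ ?_ ?_
    -- The truncated functor preserves degrees everywhere: by induction on the preceding generators,
    -- trivially at `0`.
    · rw [htrunc]
      refine hb.extLift_mem hK ?_ (B.d_mem (S.gen_mem s))
      intro U' W' s'
      split_ifs with h
      · exact (ih _ h).1
      · exact zero_mem _
    -- `Φ` is not yet known to commute with `d`, but it does on everything generated by the
    -- predecessors, so `d (Φ (d s)) = Φ (d (d s)) = 0`. The twist is carried along because the
    -- Leibniz rule uses it.
    · have key : ∀ {U' W' : B.Obj} {f : B.Hom U' W'},
          B.Generated (ExtBefore F S r ⟨U, W, s⟩) f →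
          Φ.map (B.twist f) = X.twist (Φ.map f) ∧ Φ.map (B.d f) = X.d (Φ.map f) := by
        intro U' W' f hf
        induction hf with
        | of f hf =>
          obtain (f | ⟨s', hs'⟩) := hf
          · rw [← F.map_twist, ← F.map_d, hΦF, hΦF, hΦF]
            exact ⟨K.map_twist hK f, hKd f⟩
          · rw [B.twist_of_mem (S.gen_mem s'), map_smul, hΦ, X.twist_of_mem (ih _ hs').1]
            exact ⟨rfl, (ih _ hs').2.1.symm⟩
        | id Y => rw [B.twist_id, B.d_id, Φ.map_id, map_zero, X.twist_id, X.d_id]; exact ⟨rfl, rfl⟩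
        | comp g f _ _ hg hf =>
          rw [B.twist_comp, B.d_comp, map_add, Φ.map_comp, Φ.map_comp, Φ.map_comp, Φ.map_comp,
            X.twist_comp, X.d_comp, hg.1, hg.2, hf.1, hf.2]
          exact ⟨rfl, rfl⟩
        | zero => simp
        | add f g _ _ hf hg => simp [hf.1, hf.2, hg.1, hg.2]
        | smul c f _ hf => simp [hf.1, hf.2]
      rw [← (key (hd U W s)).2, B.d_d, map_zero]
    · refine LinOver.congr_of_generated (K := Φ.comp π.toLinOver) (L := G) ?_ (hd U W s)
      rintro U' W' _ (f | ⟨s', hs'⟩)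
      · exact (congrArg π.map (hΦF f)).trans (hπ f)
      · exact (congrArg π.map (hΦ s')).trans (ih _ hs').2.2
  refine ⟨Φ, hΦF, fun s => (hΦ s).trans (hφ s), ?_, ?_, ?_⟩
  · exact fun hf => hb.extLift_mem hK (fun _ _ s => (main ⟨_, _, s⟩).1) hf
  · exact fun f => hb.extLift_d ha.1 hK (fun _ _ s => (main ⟨_, _, s⟩).1) hKd
      (fun _ _ s => (main ⟨_, _, s⟩).2.1.symm) f
  · intro U W f
    exact hb.ext_hom_ext (K := Φ.comp π.toLinOver) (L := G)
      (fun f => (congrArg π.map (hΦF f)).trans (hπ f))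
      (fun s => (congrArg π.map (hΦ s)).trans (main ⟨_, _, s⟩).2.2) f

end Recursion

/-! ### Solving `d z = y` in the path object with a prescribed end -/

section Filling

variable {k : Type u} [CommRing k] {C : DGCat k}

namespace HEquiv

variable {P Q : HEquiv C}

/-- The morphism with source part `x` and differential `y`. -/
noncomputable def fillSrc (n : ℤ) (x : C.Hom P.src Q.src) (y : Hom P Q) : Hom P Q :=
  (x, C.comp Q.t (C.comp x P.tInv) - sgn k n • C.comp y.2.2 P.tInv -
      sgn k n • C.comp y.2.1 P.tCheck,
    -C.comp Q.t (C.comp x P.tHat) + sgn k n • C.comp y.2.2 P.tHat -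
      sgn k n • C.comp y.2.1 P.tBar)

/-- The morphism with target part `x` and differential `y`. -/
noncomputable def fillTgt (n : ℤ) (x : C.Hom P.tgt Q.tgt) (y : Hom P Q) : Hom P Q :=
  (C.comp Q.tInv (C.comp x P.t) + sgn k n • C.comp Q.tInv y.2.2 + C.comp Q.tHat y.1, x,
    sgn k n • C.comp Q.tCheck (C.comp x P.t) + C.comp Q.tCheck y.2.2 -
      sgn k n • C.comp Q.tBar y.1)

variable {n : ℤ} {y : Hom P Q}

theorem fillSrc_mem {x : C.Hom P.src Q.src} (hx : x ∈ C.homDeg _ _ n)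
    (hy : y ∈ homDeg P Q (n + 1)) : fillSrc n x y ∈ homDeg P Q n := by
  obtain ⟨-, y2, y3⟩ := hy
  rw [add_sub_cancel_right] at y3
  refine ⟨hx, sub_mem (sub_mem ?_ (Submodule.smul_mem _ _ ?_)) (Submodule.smul_mem _ _ ?_),
    sub_mem (add_mem (neg_mem ?_) (Submodule.smul_mem _ _ ?_)) (Submodule.smul_mem _ _ ?_)⟩
  · simpa using C.comp_mem Q.t_mem (C.comp_mem hx P.tInv_mem)
  · simpa using C.comp_mem y3 P.tInv_mem
  · simpa using C.comp_mem y2 P.tCheck_mem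
  · have := C.comp_mem Q.t_mem (C.comp_mem hx P.tHat_mem)
    rwa [zero_add, ← sub_eq_add_neg] at this
  · exact C.comp_mem y3 P.tHat_mem
  · have := C.comp_mem y2 P.tBar_mem
    rwa [show n + 1 + -2 = n - 1 by ring] at this

theorem fillTgt_mem {x : C.Hom P.tgt Q.tgt} (hx : x ∈ C.homDeg _ _ n)
    (hy : y ∈ homDeg P Q (n + 1)) : fillTgt n x y ∈ homDeg P Q n := by
  obtain ⟨y1, -, y3⟩ := hy
  rw [add_sub_cancel_right] at y3
  refine ⟨add_mem (add_mem ?_ (Submodule.smul_mem _ _ ?_)) ?_, hx,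
    sub_mem (add_mem (Submodule.smul_mem _ _ ?_) ?_) (Submodule.smul_mem _ _ ?_)⟩
  · simpa using C.comp_mem Q.tInv_mem (C.comp_mem hx P.t_mem)
  · simpa using C.comp_mem Q.tInv_mem y3
  · simpa using C.comp_mem Q.tHat_mem y1
  · have := C.comp_mem Q.tCheck_mem (C.comp_mem hx P.t_mem)
    rwa [show -1 + (n + 0) = n - 1 by ring] at this
  · have := C.comp_mem Q.tCheck_mem y3
    rwa [show -1 + n = n - 1 by ring] at this
  · have := C.comp_mem Q.tBar_mem y1
    rwa [show -2 + (n + 1) = n - 1 by ring] at this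

/-- The third equation lets composites with `t` be traded between the two ends of a cycle, at the
cost of `d y.2.2`; both filling computations rest on it. -/
theorem d_eq_of_cycle (hy : y ∈ homDeg P Q (n + 1)) (hd : d y = 0) :
    C.d y.1 = 0 ∧ C.d y.2.1 = 0 ∧
      C.d y.2.2 = sgn k n • C.comp Q.t y.1 - sgn k n • C.comp y.2.1 P.t := by
  obtain ⟨y1, y2, -⟩ := hy
  rw [hd_apply, C.twist_of_mem y1, C.twist_of_mem y2, sgn_succ] at hd
  refine ⟨congrArg Prod.fst hd, congrArg (fun z => z.2.1) hd, ?_⟩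
  have h3 := congrArg (fun z => z.2.2) hd
  rw [← sub_eq_zero]
  refine Eq.trans ?_ h3
  simp only [map_smul, LinearMap.smul_apply, neg_smul, map_neg, LinearMap.neg_apply]
  abel

/-- For the target part, the term with `ť` contributes `y.2.1 - y.2.1 t t'`, and the terms with
`y.2.2` and `x` restore `y.2.1 t t'`. The homotopy part repeats this with `t̂` in place of `t'`, and
`d t̄` absorbs the difference. -/
theorem d_fillSrc {x : C.Hom P.src Q.src} (hx : x ∈ C.homDeg _ _ n)
    (hy : y ∈ homDeg P Q (n + 1)) (hd : d y = 0) (hxy : y.1 = C.d x) :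
    d (fillSrc n x y) = y := by
  obtain ⟨d1, d2, d3⟩ := d_eq_of_cycle hy hd
  obtain ⟨f1, f2, -⟩ := fillSrc_mem hx hy
  obtain ⟨-, y2, y3⟩ := hy
  rw [add_sub_cancel_right] at y3
  have e := sgn_mul_self k n
  have h2 : C.d (fillSrc n x y).2.1 = y.2.1 := by
    simp only [fillSrc, map_sub, map_smul, C.leibniz _ Q.t_mem, C.leibniz _ hx, C.leibniz _ y3,
      C.leibniz _ y2, P.d_tInv, Q.d_t, P.d_tCheck, d2, d3, map_zero, LinearMap.zero_apply,
      LinearMap.sub_apply, LinearMap.smul_apply, sgn_zero, sgn_succ, hxy, C.comp_id, C.assoc,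
      smul_sub, smul_smul, e,
      smul_neg, neg_smul, one_smul, smul_zero, add_zero, zero_add]
    abel
  have h3 : C.d (fillSrc n x y).2.2 - (C.comp (C.twist (fillSrc n x y).2.1) P.t -
      C.comp Q.t (C.twist (fillSrc n x y).1)) = y.2.2 := by
    rw [C.twist_of_mem f1, C.twist_of_mem f2]
    simp only [fillSrc, map_sub, map_add, map_neg, map_smul, C.leibniz _ Q.t_mem, C.leibniz _ hx,
      C.leibniz _ y3,
      C.leibniz _ y2, P.d_tHat, Q.d_t, P.d_tBar, d2, d3, map_zero, LinearMap.zero_apply,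
      LinearMap.sub_apply,
      LinearMap.smul_apply, sgn_zero, sgn_succ, hxy, C.comp_id, C.assoc,
      smul_sub, smul_add, smul_smul, e, one_mul,
      smul_neg, neg_smul, one_smul, zero_add]
    abel
  rw [hd_apply, h2, h3, fillSrc, ← hxy]

/-- The mirror image, with the homotopies of `Q` composed on the left: `t̂` contributes `y.1 - t' t
y.1`, and the terms with `x` and `y.2.2` restore `t' t y.1`. -/
theorem d_fillTgt {x : C.Hom P.tgt Q.tgt} (hx : x ∈ C.homDeg _ _ n)
    (hy : y ∈ homDeg P Q (n + 1)) (hd : d y = 0) (hxy : y.2.1 = C.d x) :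
    d (fillTgt n x y) = y := by
  obtain ⟨d1, d2, d3⟩ := d_eq_of_cycle hy hd
  obtain ⟨f1, f2, -⟩ := fillTgt_mem hx hy
  obtain ⟨y1, -, y3⟩ := hy
  rw [add_sub_cancel_right] at y3
  have e := sgn_mul_self k n
  have s2 : sgn k (-2) = 1 := by
    rw [show (-2 : ℤ) = -1 - 1 by norm_num, sgn_sub_one, sgn_neg_one, neg_neg]
  have h2 : C.d (fillTgt n x y).1 = y.1 := by
    simp only [fillTgt, map_sub, map_add, map_smul, C.leibniz _ Q.tInv_mem, C.leibniz _ hx,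
      C.leibniz _ Q.tHat_mem, P.d_t, Q.d_tInv, Q.d_tHat, d1, d3, map_zero, LinearMap.zero_apply,
      LinearMap.sub_apply, sgn_zero, sgn_neg_one, hxy, C.id_comp,
      C.assoc, smul_sub, smul_smul, e, one_mul,
      one_smul, smul_zero, add_zero, zero_add]
    abel
  have h3 : C.d (fillTgt n x y).2.2 - (C.comp (C.twist (fillTgt n x y).2.1) P.t -
      C.comp Q.t (C.twist (fillTgt n x y).1)) = y.2.2 := by
    rw [C.twist_of_mem f1, C.twist_of_mem f2]
    simp only [fillTgt, map_sub, map_add, map_smul, C.leibniz _ Q.tCheck_mem,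
      C.leibniz _ hx, C.leibniz _ Q.tBar_mem, P.d_t, Q.d_tCheck, Q.d_tBar, d1, d3, map_zero,
      LinearMap.sub_apply,
      LinearMap.smul_apply, sgn_neg_one, s2, hxy, C.id_comp, C.assoc,
      smul_sub, smul_add, smul_smul, e, neg_mul, one_mul,
      smul_neg, neg_smul, one_smul, smul_zero, add_zero]
    abel
  rw [hd_apply, h2, h3, fillTgt, ← hxy]

/-- The morphism with end `x` and differential `y`. -/
noncomputable def fill : ∀ (r : Bool) (_ : ℤ) (_ : C.Hom ((pathEnd C r).obj P)
    ((pathEnd C r).obj Q)) (_ : Hom P Q), Hom P Q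
  | false => fillSrc
  | true => fillTgt

/-- This is the hypothesis on `v` in `exists_linOver`, for the projection to either end. -/
theorem fill_spec (r : Bool) {x : C.Hom ((pathEnd C r).obj P) ((pathEnd C r).obj Q)}
    (hx : x ∈ C.homDeg _ _ n) (hy : y ∈ homDeg P Q (n + 1)) (hd : d y = 0)
    (hxy : (pathEnd C r).map y = C.d x) : fill r n x y ∈ homDeg P Q n ∧ d (fill r n x y) = y ∧
      (pathEnd C r).map (fill r n x y) = x := by
  cases r
  · exact ⟨fillSrc_mem hx hy, d_fillSrc hx hy hd hxy, rfl⟩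
  · exact ⟨fillTgt_mem hx hy, d_fillTgt hx hy hd hxy, rfl⟩

end HEquiv

theorem pathEnd_obj_refl (r : Bool) (X : C.Obj) : (pathEnd C r).obj (HEquiv.refl C X) = X := by
  cases r <;> rfl

end Filling

theorem Cyl.sharp_flat {k : Type u} [CommRing k] {A C : DGCat k} (a : Gens A) (h : a.IsFree)
    (K : Cyl A a h ⟶ C) : sharp a h (flat a h K) = K :=
  flat_injective a h (flat_sharp a h _)

/-! ### Homotopy extension -/

section HomotopyExtension

variable {k : Type u} [CommRing k] {A B C : DGCat k}

/-- Homotopies extend along semifree extensions. -/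
theorem IsSemifreeExtensionBy.exists_path_extension {F : A ⟶ B} {S : Gens B}
    (hF : IsSemifreeExtensionBy F S) (r : Bool) (K : A ⟶ pathCat C) (G : B ⟶ C)
    (h : F ≫ G = K ≫ pathEnd C r) : ∃ N : B ⟶ pathCat C, F ≫ N = K ∧ N ≫ pathEnd C r = G ∧
      (∀ U ∉ Set.range F.obj, N.obj U = HEquiv.refl C (G.obj U)) ∧
      ∀ {U W : B.Obj} (s : S.E U W), N.map (S.gen s) = HEquiv.fill r (S.deg s)
        ((pathEnd C r).map (N.map (S.gen s))) (N.map (B.d (S.gen s))) := by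
  classical
  -- New objects get the identity equivalence, which yields the values `1` and `0` in the explicit
  -- formula.
  let o : B.Obj → HEquiv C := fun U =>
    if hU : U ∈ Set.range F.obj then K.obj hU.choose else HEquiv.refl C (G.obj U)
  have hoF : ∀ Y, K.obj Y = o (F.obj Y) := by
    intro Y
    have hU : F.obj Y ∈ Set.range F.obj := ⟨Y, rfl⟩
    simp only [o, dif_pos hU, hF.obj_injective hU.choose_spec]
  have ho : ∀ U ∉ Set.range F.obj, o U = HEquiv.refl C (G.obj U) := fun U hU => dif_neg hU
  have hoG : ∀ U, G.obj U = (pathEnd C r).obj (o U) := by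
    intro U
    by_cases hU : U ∈ Set.range F.obj
    · obtain ⟨Y, rfl⟩ := hU
      rw [← hoF]
      exact congrArg (fun L : A ⟶ C => L.obj Y) h
    · rw [ho U hU, pathEnd_obj_refl]
  -- Only `hoF`, `ho` and `hoG` matter below, so the choice of preimages is hidden.
  clear_value o
  let G' : LinOver B C (fun U => (pathEnd C r).obj (o U)) := G.toLinOver.castObj hoG
  have hG' : ∀ {U W : B.Obj} (f : B.Hom U W), G'.map f ≍ G.map f := fun f =>
    LinOver.castObj_map_heq G.toLinOver hoG f
  let K' : LinOver A (pathCat C) (fun Y => o (F.obj Y)) := K.toLinOver.castObj hoF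
  have hK' : ∀ {Y Z : A.Obj} (f : A.Hom Y Z), K'.map f ≍ K.map f := fun f =>
    LinOver.castObj_map_heq K.toLinOver hoF f
  obtain ⟨N, hNF, hNS, hNm, hNd, hNG⟩ := hF.exists_linOver (X := pathCat C) K'
    (fun hf => LinOver.castObj_map_mem K.toLinOver hoF (K.map_mem hf))
    (fun f => LinOver.castObj_map_d K.toLinOver hoF (K.map_d f)) (pathEnd C r) G'
    (by
      intro Y Z f
      refine eq_of_heq ((map_heq_of_heq (pathEnd C r) (hoF Y).symm (hoF Z).symm (hK' f)).trans ?_)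
      exact (DGFunctor.congr_map_heq h f).symm.trans (hG' _).symm)
    -- The end of the value at `s` is forced to be `G s`, and its differential is the value `y`
    -- already assigned to `d s`.
    (fun U W s y => HEquiv.fill r (S.deg s) (G'.map (S.gen s)) y)
    (by
      intro U W s y hy hd hyG
      refine HEquiv.fill_spec r (LinOver.castObj_map_mem G.toLinOver hoG (G.map_mem (S.gen_mem s)))
        hy hd (hyG.trans ?_)
      exact LinOver.castObj_map_d G.toLinOver hoG (G.map_d _))
  refine ⟨⟨o, N.map, N.map_id, N.map_comp, hNm, hNd⟩, ?_, ?_, ho, ?_⟩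
  · exact DGFunctor.hext (funext fun Y => (hoF Y).symm) fun _ _ f =>
      (heq_of_eq (hNF f)).trans (hK' f)
  · exact DGFunctor.hext (funext fun U => (hoG U).symm) fun _ _ f =>
      (heq_of_eq (hNG f)).trans (hG' f)
  · intro U W s
    exact (hNS s).trans (congrArg (fun x => HEquiv.fill r (S.deg s) x _) (hNG _).symm)

variable (a : Gens A) (ha : a.IsFree) (b : Gens B) (hb : b.IsFree)

/-- The homotopy extension property of semifree extensions, with the values of the extension when
it starts at `i₁`. -/
theorem IsSemifreeExtensionBy.exists_homotopy_extension {F : A ⟶ B} {S : Gens B}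
    (hF : IsSemifreeExtensionBy F S) (r : Bool) (G : B ⟶ C) (H : Cyl A a ha ⟶ C)
    (h : F ≫ G = Cyl.incl a ha r ≫ H) : ∃ E : Cyl B b hb ⟶ C, Cyl.incl b hb r ≫ E = G ∧
      Cyl.map a ha b hb F ≫ E = H ∧
      (r = false → IsExtensionFormula b hb (Set.range F.obj)ᶜ S E) := by
  -- The problem is solved after transposition: `flat H` is the homotopy on `A`, and `h` says that
  -- its end is `G` restricted along `F`.
  obtain ⟨N, h1, h2, h3, h4⟩ := hF.exists_path_extension r (Cyl.flat a ha H) G (by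
    rw [← Cyl.incl_sharp a ha, Cyl.sharp_flat, h])
  refine ⟨Cyl.sharp b hb N, (Cyl.incl_sharp b hb N r).trans h2, ?_, ?_⟩
  · rw [Cyl.map_comp_sharp, h1, Cyl.sharp_flat]
  · rintro rfl
    have hs : ∀ {U W : B.Obj} (s : S.E U W), N.map (S.gen s) = HEquiv.fillSrc (S.deg s)
        (N.map (S.gen s)).1 (N.map (B.d (S.gen s))) := h4
    have key : ∀ {P : HEquiv C} {X : C.Obj}, P = HEquiv.refl C X → P.tgt = P.src ∧
        P.t ≍ C.id P.src ∧ P.tInv ≍ C.id P.src ∧ P.tHat = 0 ∧ P.tCheck = 0 ∧ P.tBar = 0 := by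
      rintro P X rfl
      exact ⟨rfl, .rfl, .rfl, rfl, rfl, rfl⟩
    have hc : ∀ {P Q R : B.Obj × Bool} (y : FHom k (CylE b.E) Q R) (x : FHom k (CylE b.E) P Q),
        (Cyl.sharp b hb N).map (fcomp y x) =
          C.comp ((Cyl.sharp b hb N).map y) ((Cyl.sharp b hb N).map x) :=
      Cyl.sharpL_fcomp b N
    have hcc : ∀ {P Q R : C.Obj} {y y' : C.Hom Q R} {x x' : C.Hom P Q}, y' = y → x' = x →
        C.comp y x = C.comp y' x' := by
      rintro _ _ _ _ _ _ _ rfl rfl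
      rfl
    constructor
    · exact fun U hU => (key (h3 U hU)).1
    · exact fun U hU => (heq_of_eq (Cyl.sharp_t b hb N U)).trans (key (h3 U hU)).2.1
    · exact fun U hU => (heq_of_eq (Cyl.sharp_tInv b hb N U)).trans (key (h3 U hU)).2.2.1
    · exact fun U hU => (Cyl.sharp_tHat b hb N U).trans (key (h3 U hU)).2.2.2.1
    · exact fun U hU => (Cyl.sharp_tCheck b hb N U).trans (key (h3 U hU)).2.2.2.2.1
    · exact fun U hU => (Cyl.sharp_tBar b hb N U).trans (key (h3 U hU)).2.2.2.2.2
    -- The target part of `fillSrc` at `y = N (d s)` has entries `(ds)²` and `t_{ds}` under `E`;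
    -- substituting them gives the formula for `s²`. The homotopy part gives `t_s` in the same way.
    · intro U W s
      refine (Cyl.sharp_incl_true b hb N (S.gen s)).trans
        ((congrArg (fun z => z.2.1) (hs s)).trans ?_)
      simp only [map_sub, map_smul, hc]
      exact congrArg₂ (· - ·) (congrArg₂ (· - ·)
        (hcc (Cyl.sharp_t b hb N W)
          (hcc (Cyl.sharp_incl_false b hb N _) (Cyl.sharp_tInv b hb N U)).symm)
        (congrArg (sgn k (S.deg s) • ·)
          (hcc (Cyl.sharp_tMor b hb N _) (Cyl.sharp_tInv b hb N U))))
        (congrArg (sgn k (S.deg s) • ·)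
          (hcc (Cyl.sharp_incl_true b hb N _) (Cyl.sharp_tCheck b hb N U)))
    · intro U W s
      refine (Cyl.sharp_tMor b hb N (S.gen s)).trans
        ((congrArg (fun z => z.2.2) (hs s)).trans ?_)
      simp only [map_sub, map_add, map_neg, map_smul, hc]
      exact congrArg₂ (· - ·) (congrArg₂ (· + ·)
        (congrArg (- ·) (hcc (Cyl.sharp_t b hb N W)
          (hcc (Cyl.sharp_incl_false b hb N _) (Cyl.sharp_tHat b hb N U)).symm))
        (congrArg (sgn k (S.deg s) • ·)
          (hcc (Cyl.sharp_tMor b hb N _) (Cyl.sharp_tHat b hb N U))))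
        (congrArg (sgn k (S.deg s) • ·)
          (hcc (Cyl.sharp_incl_true b hb N _) (Cyl.sharp_tBar b hb N U)))

end HomotopyExtension

/-! ### The relative cylinder -/

section RelativeCylinder

variable {k : Type u} [CommRing k]

namespace Cyl

variable {B : DGCat k} (b : Gens B) (hb : b.IsFree)

/-- The generators of the cylinder that come from any choice of free generators. -/
noncomputable def gensOf (b' : Gens B) : Gens (Cyl B b hb) where
  E := CylE b'.E
  gen _ _ e := mapE b' b hb (𝟙 B) e
  deg := cylDeg b'.deg
  gen_mem P Q e := by
    cases e with
    | incl r e => exact inclMap_mem b hb r (b'.gen_mem e)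
    | t X => exact (hequiv b hb X).t_mem
    | tInv X => exact (hequiv b hb X).tInv_mem
    | tHat X => exact (hequiv b hb X).tHat_mem
    | tCheck X => exact (hequiv b hb X).tCheck_mem
    | tBar X => exact (hequiv b hb X).tBar_mem
    | tGen e => exact tMor_mem b hb (b'.gen_mem e)

/-- The cylinders built from `b` and `b'` are isomorphic by `Cyl` of the identity, and an
isomorphism carries free generators to free generators. One may therefore choose generators of `B`
adapted to `F`. -/
theorem gensOf_isFree {b' : Gens B} (hb' : b'.IsSemifree) : (gensOf b hb b').IsFree := by
  have : IsIso (map b' hb'.1 b hb (𝟙 B)) := ⟨map b hb b' hb'.1 (𝟙 B), by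
    rw [← map_comp, Category.id_comp, map_id], by rw [← map_comp, Category.id_comp, map_id]⟩
  have h1 := (isSemifreeExtensionBy_of_isIso (map b' hb'.1 b hb (𝟙 B))
    (gens_isSemifree b' hb'.1 hb')).isFree (gens_isFree b' hb'.1)
  refine h1.reindex (fun
    | ⟨_, _, .old (X := P) (Y := Q) e⟩ => ⟨P, Q, e⟩
    | ⟨_, _, .new s⟩ => s.elim) ?_ ?_
  · rintro ⟨_, _, (e | s)⟩
    · exact congrArg (fun z => (⟨_, _, z⟩ : Σ P Q, (Cyl B b hb).Hom P Q))
        (map_map_edge b' hb'.1 b hb (𝟙 B) e).symm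
    · exact s.elim
  · rintro ⟨P, Q, e⟩
    exact ⟨⟨_, _, .old e⟩, rfl⟩

end Cyl

variable {A B : DGCat k}

/-- The edges by which the cylinder on `B` extends the relative cylinder of `F : A ⟶ B`. -/
inductive RelE (F : A ⟶ B) (S : Gens B) : B.Obj × Bool → B.Obj × Bool → Type u
  | t (X : B.Obj) (hX : X ∉ Set.range F.obj) : RelE F S (X, false) (X, true)
  | tInv (X : B.Obj) (hX : X ∉ Set.range F.obj) : RelE F S (X, true) (X, false)
  | tHat (X : B.Obj) (hX : X ∉ Set.range F.obj) : RelE F S (X, false) (X, false)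
  | tCheck (X : B.Obj) (hX : X ∉ Set.range F.obj) : RelE F S (X, true) (X, true)
  | tBar (X : B.Obj) (hX : X ∉ Set.range F.obj) : RelE F S (X, false) (X, true)
  | tGen {U W : B.Obj} (s : S.E U W) : RelE F S (U, false) (W, true)

/-- The morphisms by which the cylinder on `B` extends the relative cylinder of `F : A ⟶ B`. -/
noncomputable def relGens (b : Gens B) (hb : b.IsFree) (F : A ⟶ B) (S : Gens B) :
    Gens (Cyl B b hb) where
  E := RelE F S
  gen := fun
    | _, _, .t X _ => Cyl.t b hb X
    | _, _, .tInv X _ => Cyl.tInv b hb X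
    | _, _, .tHat X _ => Cyl.tHat b hb X
    | _, _, .tCheck X _ => Cyl.tCheck b hb X
    | _, _, .tBar X _ => Cyl.tBar b hb X
    | _, _, .tGen s => Cyl.tMor b hb (S.gen s)
  deg := fun
    | _, _, .t _ _ => 0
    | _, _, .tInv _ _ => 0
    | _, _, .tHat _ _ => -1
    | _, _, .tCheck _ _ => -1
    | _, _, .tBar _ _ => -2
    | _, _, .tGen s => S.deg s - 1
  gen_mem := fun
    | _, _, .t X _ => (Cyl.hequiv b hb X).t_mem
    | _, _, .tInv X _ => (Cyl.hequiv b hb X).tInv_mem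
    | _, _, .tHat X _ => (Cyl.hequiv b hb X).tHat_mem
    | _, _, .tCheck X _ => (Cyl.hequiv b hb X).tCheck_mem
    | _, _, .tBar X _ => (Cyl.hequiv b hb X).tBar_mem
    | _, _, .tGen s => Cyl.tMor_mem b hb (S.gen_mem s)

/-- The rank of the elements of `relGens`. -/
def relRank {b : Gens B} {hb : b.IsFree} {F : A ⟶ B} {S : Gens B} :
    (relGens b hb F S).Idx → ℕ ⊕ S.Idx
  | ⟨_, _, .t _ _⟩ => .inl 0
  | ⟨_, _, .tInv _ _⟩ => .inl 0
  | ⟨_, _, .tHat _ _⟩ => .inl 1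
  | ⟨_, _, .tCheck _ _⟩ => .inl 1
  | ⟨_, _, .tBar _ _⟩ => .inl 2
  | ⟨_, _, .tGen s⟩ => .inr ⟨_, _, s⟩

variable {a : Gens A} {ha : a.IsSemifree} {b : Gens B} {hb : b.IsFree} {F : A ⟶ B} {S : Gens B}
  {P₁ P₂ : DGCat k} {u₁ : B ⟶ P₁} {v₁ : Cyl A a ha.1 ⟶ P₁} {u₂ : B ⟶ P₂} {v₂ : P₁ ⟶ P₂}
  {G : P₂ ⟶ Cyl B b hb}

section Free

variable (b hb F S a ha u₁ v₁ u₂ v₂ G) in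
/-- The generators of `Cyl B` as an extension of `P₂`. -/
noncomputable abbrev relExtGens : Gens (Cyl B b hb) :=
  extGens G (extGens v₂ (extGens v₁ (Cyl.gens a ha.1) (S.image u₁)) (S.image u₂))
    (relGens b hb F S)

/-- The generators in `relExtGens` that come from the cylinder of `A`. -/
def relOld {P Q : A.Obj × Bool} (e : CylE a.E P Q) :
    (relExtGens a ha b hb F S u₁ v₁ u₂ v₂ G).Idx :=
  ⟨_, _, .old (.old (.old e))⟩

theorem fam_relOld (w : v₁ ≫ v₂ ≫ G = Cyl.map a ha.1 b hb F) {P Q : A.Obj × Bool}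
    (e : CylE a.E P Q) : (relExtGens a ha b hb F S u₁ v₁ u₂ v₂ G).fam (relOld e) =
      ⟨_, _, Cyl.mapE a b hb F e⟩ := by
  refine (congrArg (fun H : Cyl A a ha.1 ⟶ Cyl B b hb => (⟨H.obj P, H.obj Q, H.map (edge k e)⟩ :
    Σ P Q, (Cyl B b hb).Hom P Q)) w).trans ?_
  exact congrArg (fun z => (⟨_, _, z⟩ : Σ P Q, (Cyl B b hb).Hom P Q))
    (Cyl.map_map_edge a ha.1 b hb F e)

/-- The objects of `B` are those of `A` and those outside the image of `F`. -/
noncomputable def objEquiv (hF : Function.Injective F.obj) :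
    A.Obj ⊕ {U : B.Obj // U ∉ Set.range F.obj} ≃ B.Obj :=
  Equiv.ofBijective (Sum.elim F.obj Subtype.val) (by
    constructor
    · rintro (X | U) (Y | W) h
      · exact congrArg _ (hF h)
      · exact (W.2 ⟨X, h⟩).elim
      · exact (U.2 ⟨Y, h.symm⟩).elim
      · exact congrArg _ (Subtype.ext h)
    · intro U
      by_cases h : U ∈ Set.range F.obj
      · obtain ⟨Y, rfl⟩ := h
        exact ⟨.inl Y, rfl⟩
      · exact ⟨.inr ⟨U, h⟩, rfl⟩)

/-- The comparison of the generators of `Cyl B` with `relExtGens`. -/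
noncomputable def relIdx (hF : Function.Injective F.obj) :
    (Cyl.gensOf b hb (extGens F a S)).Idx → (relExtGens a ha b hb F S u₁ v₁ u₂ v₂ G).Idx
  | ⟨_, _, .incl r (.old e)⟩ => relOld (.incl r e)
  | ⟨_, _, .incl false (.new s)⟩ => ⟨_, _, .old (.old (.new (.mk s)))⟩
  | ⟨_, _, .incl true (.new s)⟩ => ⟨_, _, .old (.new (.mk s))⟩
  | ⟨_, _, .t X⟩ => ((objEquiv hF).symm X).elim (fun Y => relOld (.t Y))
      fun U => ⟨_, _, .new (.t U.1 U.2)⟩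
  | ⟨_, _, .tInv X⟩ => ((objEquiv hF).symm X).elim (fun Y => relOld (.tInv Y))
      fun U => ⟨_, _, .new (.tInv U.1 U.2)⟩
  | ⟨_, _, .tHat X⟩ => ((objEquiv hF).symm X).elim (fun Y => relOld (.tHat Y))
      fun U => ⟨_, _, .new (.tHat U.1 U.2)⟩
  | ⟨_, _, .tCheck X⟩ => ((objEquiv hF).symm X).elim (fun Y => relOld (.tCheck Y))
      fun U => ⟨_, _, .new (.tCheck U.1 U.2)⟩
  | ⟨_, _, .tBar X⟩ => ((objEquiv hF).symm X).elim (fun Y => relOld (.tBar Y))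
      fun U => ⟨_, _, .new (.tBar U.1 U.2)⟩
  | ⟨_, _, .tGen (.old e)⟩ => relOld (.tGen e)
  | ⟨_, _, .tGen (.new s)⟩ => ⟨_, _, .new (.tGen s)⟩

/-- With `B` generated by `a` and `S`, the generators of `Cyl(B)` split into those of `Cyl(A)`, the
two copies of `S` contributed by the two pushouts, and `relGens`. The edges at a vertex are sorted
by whether the vertex lies in the image of `F`. -/
theorem relExtGens_isFree (hF : IsSemifreeExtensionBy F S)
    (w : v₁ ≫ v₂ ≫ G = Cyl.map a ha.1 b hb F) (w₁ : u₁ ≫ v₂ ≫ G = Cyl.incl b hb false)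
    (w₂ : u₂ ≫ G = Cyl.incl b hb true) :
    (relExtGens a ha b hb F S u₁ v₁ u₂ v₂ G).IsFree := by
  have hi := hF.obj_injective
  refine (Cyl.gensOf_isFree b hb (hF.isSemifree ha)).reindex (relIdx hi) ?_ ?_
  · rintro ⟨_, _, e⟩
    cases e with
    | incl r e =>
      cases e with
      | old e => exact fam_relOld w (.incl r e)
      | new s =>
        cases r
        · exact congrArg (fun H : B ⟶ Cyl B b hb => (⟨H.obj _, H.obj _, H.map (S.gen s)⟩ :
            Σ P Q, (Cyl B b hb).Hom P Q)) w₁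
        · exact congrArg (fun H : B ⟶ Cyl B b hb => (⟨H.obj _, H.obj _, H.map (S.gen s)⟩ :
            Σ P Q, (Cyl B b hb).Hom P Q)) w₂
    | tGen e =>
      cases e with
      | old e => exact fam_relOld w (.tGen e)
      | new s => rfl
    | t X =>
      obtain ⟨Y | U, rfl⟩ := (objEquiv hi).surjective X
      · simp only [relIdx, Equiv.symm_apply_apply, Sum.elim_inl]
        exact fam_relOld w (.t Y)
      · simp only [relIdx, Equiv.symm_apply_apply, Sum.elim_inr]
        rfl
    | tInv X =>
      obtain ⟨Y | U, rfl⟩ := (objEquiv hi).surjective X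
      · simp only [relIdx, Equiv.symm_apply_apply, Sum.elim_inl]
        exact fam_relOld w (.tInv Y)
      · simp only [relIdx, Equiv.symm_apply_apply, Sum.elim_inr]
        rfl
    | tHat X =>
      obtain ⟨Y | U, rfl⟩ := (objEquiv hi).surjective X
      · simp only [relIdx, Equiv.symm_apply_apply, Sum.elim_inl]
        exact fam_relOld w (.tHat Y)
      · simp only [relIdx, Equiv.symm_apply_apply, Sum.elim_inr]
        rfl
    | tCheck X =>
      obtain ⟨Y | U, rfl⟩ := (objEquiv hi).surjective X
      · simp only [relIdx, Equiv.symm_apply_apply, Sum.elim_inl]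
        exact fam_relOld w (.tCheck Y)
      · simp only [relIdx, Equiv.symm_apply_apply, Sum.elim_inr]
        rfl
    | tBar X =>
      obtain ⟨Y | U, rfl⟩ := (objEquiv hi).surjective X
      · simp only [relIdx, Equiv.symm_apply_apply, Sum.elim_inl]
        exact fam_relOld w (.tBar Y)
      · simp only [relIdx, Equiv.symm_apply_apply, Sum.elim_inr]
        rfl
  · have hl : ∀ Y, (objEquiv hi).symm (F.obj Y) = .inl Y := fun Y =>
      (Equiv.symm_apply_eq _).2 rfl
    have hr : ∀ U : {U : B.Obj // U ∉ Set.range F.obj}, (objEquiv hi).symm U.1 = .inr U :=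
      fun U => (Equiv.symm_apply_eq _).2 rfl
    rintro ⟨_, _, e⟩
    cases e with
    | old e =>
      cases e with
      | old e =>
        cases e with
        | old e =>
          cases e with
          | incl r e => exact ⟨⟨_, _, .incl r (.old e)⟩, rfl⟩
          | tGen e => exact ⟨⟨_, _, .tGen (.old e)⟩, rfl⟩
          | t Y => exact ⟨⟨_, _, .t (F.obj Y)⟩, by simp only [relIdx, hl, Sum.elim_inl]; rfl⟩
          | tInv Y => exact ⟨⟨_, _, .tInv (F.obj Y)⟩, by simp only [relIdx, hl, Sum.elim_inl]; rfl⟩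
          | tHat Y => exact ⟨⟨_, _, .tHat (F.obj Y)⟩, by simp only [relIdx, hl, Sum.elim_inl]; rfl⟩
          | tCheck Y =>
            exact ⟨⟨_, _, .tCheck (F.obj Y)⟩, by simp only [relIdx, hl, Sum.elim_inl]; rfl⟩
          | tBar Y => exact ⟨⟨_, _, .tBar (F.obj Y)⟩, by simp only [relIdx, hl, Sum.elim_inl]; rfl⟩
        | new s =>
          cases s with
          | mk s => exact ⟨⟨_, _, .incl false (.new s)⟩, rfl⟩
      | new s =>
        cases s with
        | mk s => exact ⟨⟨_, _, .incl true (.new s)⟩, rfl⟩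
    | new s =>
      cases s with
      | t X h => exact ⟨⟨_, _, .t X⟩, by simp only [relIdx, hr ⟨X, h⟩, Sum.elim_inr]⟩
      | tInv X h => exact ⟨⟨_, _, .tInv X⟩, by simp only [relIdx, hr ⟨X, h⟩, Sum.elim_inr]⟩
      | tHat X h => exact ⟨⟨_, _, .tHat X⟩, by simp only [relIdx, hr ⟨X, h⟩, Sum.elim_inr]⟩
      | tCheck X h => exact ⟨⟨_, _, .tCheck X⟩, by simp only [relIdx, hr ⟨X, h⟩, Sum.elim_inr]⟩
      | tBar X h => exact ⟨⟨_, _, .tBar X⟩, by simp only [relIdx, hr ⟨X, h⟩, Sum.elim_inr]⟩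
      | tGen s => exact ⟨⟨_, _, .tGen (.new s)⟩, rfl⟩

end Free

/-- The map from the relative cylinder to the cylinder is a semifree extension. -/
theorem isSemifreeExtensionBy_relGens (hF : IsSemifreeExtensionBy F S)
    (hv₁ : IsSemifreeExtensionBy v₁ (S.image u₁)) (hv₂ : IsSemifreeExtensionBy v₂ (S.image u₂))
    (ho₁ : ∀ Z : P₁.Obj, (∃ Y, Z = v₁.obj Y) ∨ ∃ U, U ∉ Set.range F.obj ∧ Z = u₁.obj U)
    (ho₂ : ∀ Z : P₂.Obj, (∃ Y, Z = v₂.obj Y) ∨ ∃ U, U ∉ Set.range F.obj ∧ Z = u₂.obj U)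
    (w : v₁ ≫ v₂ ≫ G = Cyl.map a ha.1 b hb F) (w₁ : u₁ ≫ v₂ ≫ G = Cyl.incl b hb false)
    (w₂ : u₂ ≫ G = Cyl.incl b hb true) :
    IsSemifreeExtensionBy G (relGens b hb F S) := by
  have hobj : ∀ {X Y : DGCat k} {H H' : X ⟶ Y} (_ : H = H') (Z : X.Obj), H.obj Z = H'.obj Z := by
    rintro X Y H _ rfl Z
    rfl
  -- An object of the relative cylinder is a copy of an object of `A` or of a new object of `B`, in
  -- one of the two ends, and `G` sends it to the object of that name.
  have ho : ∀ Z : P₂.Obj, (∃ X r, Z = v₂.obj (v₁.obj (X, r)) ∧ G.obj Z = (F.obj X, r)) ∨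
      (∃ U, U ∉ Set.range F.obj ∧ Z = v₂.obj (u₁.obj U) ∧ G.obj Z = (U, false)) ∨
      ∃ U, U ∉ Set.range F.obj ∧ Z = u₂.obj U ∧ G.obj Z = (U, true) := by
    intro Z
    obtain ⟨Z, rfl⟩ | ⟨U, hU, rfl⟩ := ho₂ Z
    · obtain ⟨⟨X, r⟩, rfl⟩ | ⟨U, hU, rfl⟩ := ho₁ Z
      · exact .inl ⟨X, r, rfl, hobj w (X, r)⟩
      · exact .inr (.inl ⟨U, hU, rfl, hobj w₁ U⟩)
    · exact .inr (.inr ⟨U, hU, rfl, hobj w₂ U⟩)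
  have hinj : Function.Injective G.obj := by
    intro Z Z' hZ
    obtain ⟨X, r, rfl, h⟩ | ⟨U, hU, rfl, h⟩ | ⟨U, hU, rfl, h⟩ := ho Z <;>
    obtain ⟨X', r', rfl, h'⟩ | ⟨U', hU', rfl, h'⟩ | ⟨U', hU', rfl, h'⟩ := ho Z' <;>
    -- The nine cases are settled by comparing the ends, by injectivity of `F` on objects, or by
    -- membership in its image.
    · rw [hZ, h', Prod.mk.injEq] at h
      obtain ⟨h1, h2⟩ := h
      first
      | cases h2; done
      | cases hF.obj_injective h1; cases h2; rfl
      | cases h1; rfl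
      | exact (hU' ⟨_, h1.symm⟩).elim
      | exact (hU ⟨_, h1⟩).elim
  obtain ⟨r, hr, hd⟩ := hF.order
  refine isSemifreeExtensionBy_of_wellFounded hinj
    (hv₂.isSemifree (hv₁.isSemifree (Cyl.gens_isSemifree a ha.1 ha)))
    -- The order puts `t` and `t'` first, then `t̂` and `ť`, then `t̄`, and after them the `t_s` in
    -- the order of `S`.
    (relExtGens_isFree (ha := ha) hF w w₁ w₂) (InvImage (Sum.Lex (· < ·) r) relRank)
    (InvImage.wf _ (Sum.lex_wf wellFounded_lt hr.wf)) ?_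
  have hgen : ∀ {i : (relGens b hb F S).Idx} {P Q : B.Obj × Bool}
      (e : (relGens b hb F S).E P Q), Sum.Lex (· < ·) r (relRank ⟨P, Q, e⟩) (relRank i) →
      (Cyl B b hb).Generated (ExtBefore G (relGens b hb F S)
        (InvImage (Sum.Lex (· < ·) r) relRank) i) ((relGens b hb F S).gen e) :=
    fun e he => .of _ (.gen e he)
  have himg : ∀ {i : (relGens b hb F S).Idx} {X : DGCat k} {H : X ⟶ P₂} {H' : X ⟶ Cyl B b hb}
      (_ : H ≫ G = H') {Y Z : X.Obj} (f : X.Hom Y Z),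
      (Cyl B b hb).Generated (ExtBefore G (relGens b hb F S)
        (InvImage (Sum.Lex (· < ·) r) relRank) i) (H'.map f) := by
    rintro i X H H' rfl Y Z f
    exact .of _ (.image (F := G) (H.map f))
  have hincl : ∀ {i : (relGens b hb F S).Idx} (q : Bool) {U W : B.Obj} (f : B.Hom U W),
      (Cyl B b hb).Generated (ExtBefore G (relGens b hb F S)
        (InvImage (Sum.Lex (· < ·) r) relRank) i) (Cyl.inclMap b hb q f) := by
    intro i q U W f
    cases q
    · exact himg (H := u₁ ≫ v₂) w₁ f
    · exact himg w₂ f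
  intro P Q e
  cases e with
  | t X hX => exact .of_heq rfl rfl (heq_of_eq (Cyl.hequiv b hb X).d_t) (.zero _ _)
  | tInv X hX => exact .of_heq rfl rfl (heq_of_eq (Cyl.hequiv b hb X).d_tInv) (.zero _ _)
  | tHat X hX =>
    refine .of_heq rfl rfl (heq_of_eq (Cyl.hequiv b hb X).d_tHat) (.sub (.id _) (.comp _ _ ?_ ?_))
    · exact hgen (.tInv X hX) (.inl one_pos)
    · exact hgen (.t X hX) (.inl one_pos)
  | tCheck X hX =>
    refine .of_heq rfl rfl (heq_of_eq (Cyl.hequiv b hb X).d_tCheck) (.sub (.id _) (.comp _ _ ?_ ?_))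
    · exact hgen (.t X hX) (.inl one_pos)
    · exact hgen (.tInv X hX) (.inl one_pos)
  | tBar X hX =>
    refine .of_heq rfl rfl (heq_of_eq (Cyl.hequiv b hb X).d_tBar)
      (.sub (.comp _ _ ?_ ?_) (.comp _ _ ?_ ?_))
    · exact hgen (.t X hX) (.inl two_pos)
    · exact hgen (.tHat X hX) (.inl one_lt_two)
    · exact hgen (.tCheck X hX) (.inl one_lt_two)
    · exact hgen (.t X hX) (.inl two_pos)
  | @tGen U W s =>
    -- At an object in the image of `F`, `t_X` comes from `Cyl(A)`; at a new object it is a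
    -- generator that precedes every `t_s`.
    have ht : ∀ X, (Cyl B b hb).Generated (ExtBefore G (relGens b hb F S)
        (InvImage (Sum.Lex (· < ·) r) relRank) ⟨_, _, .tGen s⟩) (Cyl.t b hb X) := by
      intro X
      by_cases hX : X ∈ Set.range F.obj
      · obtain ⟨Y, rfl⟩ := hX
        have := himg (i := ⟨_, _, .tGen s⟩) (H := v₁ ≫ v₂) w (Cyl.t a ha.1 Y)
        exact .of_heq rfl rfl (heq_of_eq (Cyl.map_map_edge a ha.1 b hb F (.t Y)).symm) this
      · exact hgen (.t X hX) (.sep _ _)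
    -- By the product rule, `t_f` is generated by the `t` of the constituents of `f` and by the two
    -- ends, which already lie in the image of `G`. So `t_{ds}` involves only `t_{s'}` with `s'`
    -- before `s`.
    have hmor : ∀ {U' W' : B.Obj} {f : B.Hom U' W'}, B.Generated (ExtBefore F S r ⟨U, W, s⟩) f →
        (Cyl B b hb).Generated (ExtBefore G (relGens b hb F S)
          (InvImage (Sum.Lex (· < ·) r) relRank) ⟨_, _, .tGen s⟩) (Cyl.tMor b hb f) := by
      intro U' W' f hf
      induction hf with
      | of f hf =>
        obtain (f | ⟨s', hs'⟩) := hf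
        · rw [← Cyl.map_map_tMor a ha.1]
          exact himg (H := v₁ ≫ v₂) w (Cyl.tMor a ha.1 f)
        · exact hgen (.tGen s') (.inr hs')
      | id X => rw [Cyl.tMor_id]; exact .zero _ _
      | comp g f _ _ hg hf =>
        rw [Cyl.tMor_comp']
        exact .add _ _ (.comp _ _ (hincl _ _) hf) (.comp _ _ hg (hincl _ _))
      | zero => rw [map_zero]; exact .zero _ _
      | add f g _ _ hf hg => rw [map_add]; exact .add _ _ hf hg
      | smul c f _ hf => rw [map_smul]; exact .smul _ _ hf
    refine .of_heq rfl rfl (heq_of_eq (Cyl.d_tMor b hb (S.gen_mem s)))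
      (.add _ _ (.smul _ _ (.sub (.comp _ _ (hincl _ _) (ht _)) (.comp _ _ (ht _) (hincl _ _)))) ?_)
    exact hmor (hd U W s)

end RelativeCylinder

/-! ### Gluing both ends as two successive pushouts -/

section CoproductSquares

open Limits

/-- Pushouts along `coprod.map F F` as successive pushouts along `F`. -/
theorem isPushout_coprod_map {M : Type*} [Category M] [HasBinaryCoproducts M] {A B I P₁ P₂ : M}
    {F : A ⟶ B} {i₁ i₂ : A ⟶ I} {u₁ : B ⟶ P₁} {v₁ : I ⟶ P₁} {u₂ : B ⟶ P₂} {v₂ : P₁ ⟶ P₂}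
    (h₁ : IsPushout F i₁ u₁ v₁) (h₂ : IsPushout F (i₂ ≫ v₁) u₂ v₂) :
    IsPushout (coprod.map F F) (coprod.desc i₁ i₂) (coprod.desc (u₁ ≫ v₂) u₂) (v₁ ≫ v₂) := by
  refine ⟨⟨?_⟩, ⟨PushoutCocone.IsColimit.mk _ (fun s => h₂.desc (coprod.inr ≫ s.inl)
    (h₁.desc (coprod.inl ≫ s.inl) s.inr ?_) ?_) ?_ ?_ ?_⟩⟩
  · apply coprod.hom_ext
    · rw [coprod.inl_map_assoc, coprod.inl_desc, coprod.inl_desc_assoc, h₁.w_assoc]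
    · rw [coprod.inr_map_assoc, coprod.inr_desc, coprod.inr_desc_assoc, h₂.w, Category.assoc]
  · rw [← coprod.inl_map_assoc F F, s.condition, coprod.inl_desc_assoc]
  · rw [Category.assoc, h₁.inr_desc, ← coprod.inr_map_assoc F F, s.condition, coprod.inr_desc_assoc]
  · intro s
    apply coprod.hom_ext
    · rw [coprod.inl_desc_assoc, Category.assoc, h₂.inr_desc, h₁.inl_desc]
    · rw [coprod.inr_desc_assoc, h₂.inl_desc]
  · intro s
    rw [Category.assoc, h₂.inr_desc, h₁.inr_desc]
  · intro s m h3 h4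
    apply h₂.hom_ext
    · rw [h₂.inl_desc, ← h3, coprod.inr_desc_assoc]
    · rw [h₂.inr_desc]
      apply h₁.hom_ext
      · rw [h₁.inl_desc, ← h3, coprod.inl_desc_assoc, Category.assoc]
      · rw [h₁.inr_desc, ← h4, Category.assoc]

end CoproductSquares

/-! ### The axioms in the category of semifree dg categories -/

section SemifreeCategory

open Limits

variable {k : Type u} [CommRing k]

variable (k) in
/-- The empty dg category. -/
def emptyDGCat : DGCat k where
  Obj := PEmpty
  Hom _ _ := PUnit
  id X := X.elim
  comp {X} := X.elim
  id_comp {X} := X.elim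
  comp_id {X} := X.elim
  assoc {X} := X.elim
  homDeg X := X.elim
  isInternal X := X.elim
  id_mem X := X.elim
  comp_mem {X} := X.elim
  d {X} := X.elim
  d_mem {X} := X.elim
  d_d {X} := X.elim
  leibniz {X} := X.elim

variable (k) in
/-- The empty dg category is semifree. -/
def emptySemifree : SemifreeDGCat k :=
  ⟨emptyDGCat k, Gens.empty _, Gens.isSemifree_of_wellFounded (fun X => X.elim)
    (fun _ _ => False) ⟨fun i => i.2.2.elim⟩ (fun _ _ e => e.elim)⟩

/-- A dg category without objects is initial. -/
def isInitialOfIsEmpty (X : SemifreeDGCat k) [IsEmpty X.obj.Obj] : IsInitial X :=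
  IsInitial.ofUniqueHom (fun _ => ObjectProperty.homMk
      { obj := isEmptyElim
        map := fun {U} => isEmptyElim U
        map_id := isEmptyElim
        map_comp := fun {U} => isEmptyElim U
        map_mem := fun {U} => (IsEmpty.false U).elim
        map_d := fun {U} => isEmptyElim U })
    fun _ _ => ObjectProperty.hom_ext _ (DGFunctor.hext (funext isEmptyElim) isEmptyElim)

/-- An initial object maps to the empty dg category, which leaves no room for objects. -/
theorem isEmpty_of_isInitial {X : SemifreeDGCat k} (h : IsInitial X) : IsEmpty X.obj.Obj :=
  ⟨fun U => ((h.to (emptySemifree k)).hom.obj U : PEmpty).elim⟩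

instance : HasInitial (SemifreeDGCat k) :=
  have : IsEmpty (emptySemifree k).obj.Obj := inferInstanceAs (IsEmpty PEmpty)
  (isInitialOfIsEmpty (emptySemifree k)).hasInitial

variable {A B C D : SemifreeDGCat k}

theorem semifreeExtensions_of_isIso (F : A ⟶ B) [IsIso F] : semifreeExtensions k F := by
  have : IsIso F.hom := inferInstanceAs (IsIso ((IsSemifree (k := k)).ι.map F))
  obtain ⟨a, ha⟩ := A.property
  exact ⟨_, isSemifreeExtensionBy_of_isIso F.hom ha⟩

theorem semifreeExtensions_comp {F : A ⟶ B} {G : B ⟶ C} (hF : semifreeExtensions k F)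
    (hG : semifreeExtensions k G) : semifreeExtensions k (F ≫ G) := by
  obtain ⟨S, hS⟩ := hF
  obtain ⟨T, hT⟩ := hG
  exact ⟨_, hS.comp hT⟩

theorem semifreeExtensions_of_isInitial (h : IsInitial A) (F : A ⟶ B) :
    semifreeExtensions k F := by
  have := isEmpty_of_isInitial h
  obtain ⟨b, hb⟩ := B.property
  exact ⟨b, isSemifreeExtensionBy_of_isEmpty F.hom hb⟩

/-- Pushouts of semifree dg categories along semifree extensions. -/
theorem exists_isPushout_semifree (F : A ⟶ B) {S : Gens B.obj}
    (hF : IsSemifreeExtensionBy F.hom S) (G : A ⟶ C) :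
    ∃ (D : SemifreeDGCat k) (G' : B ⟶ D) (F' : C ⟶ D), IsPushout F.hom G.hom G'.hom F'.hom ∧
      IsPushout F G G' F' ∧ IsSemifreeExtensionBy F'.hom (S.image G'.hom) ∧
      ∀ Z : D.obj.Obj, (∃ Y, Z = F'.hom.obj Y) ∨
        ∃ U, U ∉ Set.range F.hom.obj ∧ Z = G'.hom.obj U := by
  obtain ⟨c, hc⟩ := C.property
  obtain ⟨D, G', F', sq, h, ho⟩ := hF.exists_isPushout G.hom hc
  let D' : SemifreeDGCat k := ⟨D, _, h.isSemifree hc⟩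
  refine ⟨D', ObjectProperty.homMk G', ObjectProperty.homMk F', sq, ?_, h, ho⟩
  -- The pushout formed among all dg categories is again semifree, and the inclusion of a full
  -- subcategory reflects pushouts.
  exact IsPushout.of_map_of_faithful (F := (IsSemifree (k := k)).ι) sq

/-- Any pushout in the subcategory is isomorphic to the constructed one, which is a pushout among
all dg categories. `Cyl.isPushout_map` needs this stronger property. -/
theorem IsPushout.hom_of_semifreeExtensions {F : A ⟶ B} {G : A ⟶ C} {G' : B ⟶ D} {F' : C ⟶ D}
    (hF : semifreeExtensions k F) (sq : IsPushout F G G' F') :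
    IsPushout F.hom G.hom G'.hom F'.hom := by
  obtain ⟨S, hS⟩ := hF
  obtain ⟨D', G'', F'', sq', sq'', -, -⟩ := exists_isPushout_semifree F hS G
  let e : D' ≅ D := sq''.isoIsPushout _ _ sq
  refine sq'.of_iso (Iso.refl _) (Iso.refl _) (Iso.refl _) ((IsSemifree (k := k)).ι.mapIso e)
    (by simp) (by simp) ?_ ?_
  · exact (congrArg (·.hom) (sq''.inl_isoIsPushout_hom _ _ sq)).trans (Category.id_comp _).symm
  · exact (congrArg (·.hom) (sq''.inr_isoIsPushout_hom _ _ sq)).trans (Category.id_comp _).symm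

theorem IsPushout.semifreeExtensions {F : A ⟶ B} {G : A ⟶ C} {G' : B ⟶ D} {F' : C ⟶ D}
    (hF : semifreeExtensions k F) (sq : IsPushout F G G' F') : semifreeExtensions k F' := by
  obtain ⟨S, hS⟩ := hF
  obtain ⟨D', G'', F'', -, sq', h, -⟩ := exists_isPushout_semifree F hS G
  rw [← sq'.inr_isoIsPushout_hom _ _ sq]
  exact semifreeExtensions_comp ⟨_, h⟩ (semifreeExtensions_of_isIso _)

/-- A coproduct is a pushout over the initial object, from which every morphism is a semifree
extension. -/
instance : HasBinaryCoproducts (SemifreeDGCat k) := by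
  refine @hasBinaryCoproducts_of_hasColimit_pair _ _ fun {A B} => ?_
  obtain ⟨S, hS⟩ := semifreeExtensions_of_isInitial initialIsInitial (initial.to A)
  obtain ⟨D, G', F', -, sq, -, -⟩ := exists_isPushout_semifree _ hS (initial.to B)
  exact ⟨⟨_, isCoproductOfIsInitialIsPushout G' F' _ _ initialIsInitial sq.isColimit⟩⟩

variable (γ : GeneratorChoice k)

/-- A model of the relative cylinder for which the comparison map is a semifree extension. -/
theorem exists_relativeCylinder {F : A ⟶ B} (hF : semifreeExtensions k F) :
    ∃ (P : SemifreeDGCat k) (u : B ⨿ B ⟶ P) (v : cylObj γ A ⟶ P),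
      IsPushout (coprod.map F F) (coprod.desc ((cylIncl γ false).app A : A ⟶ cylObj γ A)
        ((cylIncl γ true).app A : A ⟶ cylObj γ A)) u v ∧
      ∀ G : P ⟶ cylObj γ B,
        u ≫ G = coprod.desc ((cylIncl γ false).app B : B ⟶ cylObj γ B)
          ((cylIncl γ true).app B : B ⟶ cylObj γ B) →
        v ≫ G = (cylFunctor γ).map F → semifreeExtensions k G := by
  obtain ⟨S, hS⟩ := hF
  obtain ⟨P₁, u₁, v₁, -, sq₁, h₁, ho₁⟩ :=
    exists_isPushout_semifree F hS ((cylIncl γ false).app A : A ⟶ cylObj γ A)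
  obtain ⟨P₂, u₂, v₂, -, sq₂, h₂, ho₂⟩ :=
    exists_isPushout_semifree F hS (((cylIncl γ true).app A : A ⟶ cylObj γ A) ≫ v₁)
  refine ⟨P₂, _, _, isPushout_coprod_map sq₁ sq₂, fun G hu hv => ?_⟩
  -- The conditions on `G` are unpacked into its restrictions to the two copies of `B` and to the
  -- cylinder of `A`.
  have w₁ : u₁ ≫ v₂ ≫ G = ((cylIncl γ false).app B : B ⟶ cylObj γ B) :=
    (Category.assoc _ _ _).symm.trans ((coprod.inl_desc_assoc (u₁ ≫ v₂) u₂ G).symm.trans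
      ((coprod.inl ≫= hu).trans (coprod.inl_desc _ _)))
  have w₂ : u₂ ≫ G = ((cylIncl γ true).app B : B ⟶ cylObj γ B) :=
    (coprod.inr_desc_assoc (u₁ ≫ v₂) u₂ G).symm.trans
      ((coprod.inr ≫= hu).trans (coprod.inr_desc _ _))
  have w : v₁ ≫ v₂ ≫ G = (cylFunctor γ).map F := (Category.assoc _ _ _).symm.trans hv
  exact ⟨_, isSemifreeExtensionBy_relGens (ha := (γ A).2) (hb := (γ B).2.1) hS h₁ h₂ ho₁ ho₂
    (congrArg (·.hom) w) (congrArg (·.hom) w₁) (congrArg (·.hom) w₂)⟩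

theorem isICategory_cyl : IsICategory (semifreeExtensions k) (cylFunctor γ) (cylIncl γ)
    (cylProj γ) where
  hasInitial := inferInstance
  cylinder r := by
    ext A
    exact Cyl.incl_proj (γ A).1 (γ A).2.1 r
  hasPushout := by
    rintro A B C F G ⟨S, hS⟩
    obtain ⟨D, G', F', -, sq, -, -⟩ := exists_isPushout_semifree F hS G
    exact sq.hasPushout
  pushout_cof _ _ _ _ hF sq := IsPushout.semifreeExtensions hF sq
  pushout_map {A B C D} F G G' F' hF sq :=
    IsPushout.of_map_of_faithful (F := (IsSemifree (k := k)).ι)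
      (Cyl.isPushout_map (γ A).1 (γ A).2.1 (γ B).1 (γ B).2.1 (γ C).1 (γ C).2.1 (γ D).1 (γ D).2.1
        (IsPushout.hom_of_semifreeExtensions hF sq))
  initial_map := by
    rintro X ⟨hX⟩
    have := isEmpty_of_isInitial hX
    have : IsEmpty ((cylFunctor γ).obj X).obj.Obj := inferInstanceAs (IsEmpty (X.obj.Obj × Bool))
    exact ⟨isInitialOfIsEmpty _⟩
  isIso_cof F _ := semifreeExtensions_of_isIso F
  initial_cof := by
    rintro X A F ⟨hX⟩
    exact semifreeExtensions_of_isInitial hX F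
  comp_cof _ _ := semifreeExtensions_comp
  homotopy_extension := by
    rintro r A B C F G H ⟨S, hS⟩ h
    obtain ⟨E, h1, h2, -⟩ := hS.exists_homotopy_extension (γ A).1 (γ A).2.1 (γ B).1 (γ B).2.1 r
      G.hom H.hom (congrArg (·.hom) h)
    exact ⟨ObjectProperty.homMk E, ObjectProperty.hom_ext _ h1, ObjectProperty.hom_ext _ h2⟩
  hasBinaryCoproducts := inferInstance
  relative_hasPushout F hF := by
    obtain ⟨P, u, v, sq, -⟩ := exists_relativeCylinder γ hF
    exact sq.hasPushout
  relative_cylinder F u v G hF sq hu hv := by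
    obtain ⟨P', u', v', sq', h⟩ := exists_relativeCylinder γ hF
    -- An arbitrary pushout differs from the constructed relative cylinder by an isomorphism, which
    -- is itself a cofibration.
    have hG : G = (sq.isoIsPushout _ _ sq').hom ≫ (sq.isoIsPushout _ _ sq').inv ≫ G := by simp
    rw [hG]
    refine semifreeExtensions_comp (semifreeExtensions_of_isIso _) (h _ ?_ ?_)
    · rw [← hu]
      exact sq.inl_isoIsPushout_inv_assoc _ _ sq' G
    · rw [← hv]
      exact sq.inr_isoIsPushout_inv_assoc _ _ sq' G
  interchange A := ⟨ObjectProperty.homMk (Cyl.interchange (γ A).1 (γ A).2.1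
      (γ (cylObj γ A)).1 (γ (cylObj γ A)).2.1), fun r =>
    ⟨ObjectProperty.hom_ext _ (Cyl.incl_interchange (γ A).1 (γ A).2.1 _ _ r),
      ObjectProperty.hom_ext _ (Cyl.map_interchange (γ A).1 (γ A).2.1 _ _ r)⟩⟩

end SemifreeCategory

/-! ### The theorem with the explicit formulas -/

theorem mainTheorem3 (k : Type u) [CommRing k] (γ : GeneratorChoice k) :
    IsICategory (semifreeExtensions k) (cylFunctor γ) (cylIncl γ) (cylProj γ) ∧
    (∀ {A B C : SemifreeDGCat k} (F : A ⟶ B) (S : Gens B.obj) (G : B ⟶ C) (H : cylObj γ A ⟶ C),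
      IsSemifreeExtensionBy F.hom S → F ≫ G = (cylIncl γ false).app A ≫ H →
      ∃ E : cylObj γ B ⟶ C, (cylIncl γ false).app B ≫ E = G ∧ (cylFunctor γ).map F ≫ E = H ∧
        IsExtensionFormula (γ B).1 (γ B).2.1 (Set.range F.hom.obj)ᶜ S E.hom) ∧
    ∀ A : SemifreeDGCat k, ∃ T : cylObj γ (cylObj γ A) ⟶ cylObj γ (cylObj γ A),
      (∀ r : Bool, (cylIncl γ r).app (cylObj γ A) ≫ T = (cylFunctor γ).map ((cylIncl γ r).app A) ∧
        (cylFunctor γ).map ((cylIncl γ r).app A) ≫ T = (cylIncl γ r).app (cylObj γ A)) ∧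
      IsInterchangeFormula (γ A).1 (γ A).2.1 (γ (cylObj γ A)).1 (γ (cylObj γ A)).2.1 T.hom := by
  refine ⟨isICategory_cyl γ, fun {A B C} F S G H hS h => ?_, fun A => ?_⟩
  · obtain ⟨E, h1, h2, h3⟩ := hS.exists_homotopy_extension (γ A).1 (γ A).2.1 (γ B).1 (γ B).2.1
      false G.hom H.hom (congrArg (·.hom) h)
    exact ⟨ObjectProperty.homMk E, ObjectProperty.hom_ext _ h1, ObjectProperty.hom_ext _ h2,
      h3 rfl⟩
  · exact ⟨ObjectProperty.homMk (Cyl.interchange (γ A).1 (γ A).2.1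
      (γ (cylObj γ A)).1 (γ (cylObj γ A)).2.1), fun r =>
      ⟨ObjectProperty.hom_ext _ (Cyl.incl_interchange (γ A).1 (γ A).2.1 _ _ r),
        ObjectProperty.hom_ext _ (Cyl.map_interchange (γ A).1 (γ A).2.1 _ _ r)⟩,
      Cyl.interchange_isInterchangeFormula (γ A).1 (γ A).2.1 _ _⟩
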